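/- Let $Q_\infty$ be the graph on $\{0,1\}^{\mathbb N}$ in which two vertices are adjacent if and only if they differ in exactly one place; this place is called the coordinate of the edge. Let $T$ be a finite (nonempty) tree with root $v_0$. For $v\in V(T)$ let $\lambda(v)$ be the distance from $v_0$ to $v$ in $T$, and let $\lambda_{\max}(v)$ be the largest value of $\lambda(w)$ over all descendants $w$ of $v$ (the vertices $w$, including $v$ itself, for which the path from $v_0$ to $w$ contains $v$). Let $\lfloor T/2\rfloor$ and $\lceil T/2\rceil$ be the subtrees of $T$, rooted at $v_0$, induced by the vertex sets $\{v:\lambda(v)\le\lfloor\lambda_{\max}(v)/2\rfloor\}$ and $\{v:\lambda(v)\le\lceil\lambda_{\max}(v)/2\rceil\}$, respectively. A homomorphism from a tree to an edge-colored subgraph of $Q_\infty$ is called rainbow if it maps distinct edges of the tree to edges of distinct colors; it is called doubly distinct if it is rainbow and also maps distinct edges to edges with distinct coordinates; and a homomorphism from a rooted tree is called path-distinct if, for every leaf $v$ (a vertex with no descendant other than itself), it maps distinct edges of the path from the root to $v$ to edges with distinct coordinates. An embedding is an injective homomorphism. **Theorem.** Let $G$ be a properly edge-colored subgraph of $Q_\infty$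 with minimum degree $\delta(G)\ge e(T)$, where $e(T)$ is the number of edges of $T$, and let $\phi\colon\lfloor T/2\rfloor\to G$ be a doubly distinct homomorphism. Let $z_{\mathrm{bad}}$ be a vertex of $Q_\infty$ that is adjacent to $\phi(v_0)$ in $Q_\infty$, such that the edge $\phi(v_0)z_{\mathrm{bad}}$ is not an edge of $G$ and such that $\phi$ maps no edge of $\lfloor T/2\rfloor$ to an edge with the same coordinate as $\phi(v_0)z_{\mathrm{bad}}$. Then $\phi$ extends to a rainbow embedding $\Phi$ of $T$ into $G-z_{\mathrm{bad}}$ whose restriction to $\lceil T/2\rceil$ is path-distinct. -/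

import Mathlib

namespace RainbowTree

/-- The vertex set of the infinite hypercube: all `0`-`1` sequences. -/
abbrev Cube : Type := ℕ → Bool

/-- The infinite hypercube: two sequences are adjacent iff they differ in exactly one place. -/
def hypercube : SimpleGraph Cube where
  Adj x y := ∃! i, x i ≠ y i
  symm := ⟨fun x y h => by
    obtain ⟨i, hi, hu⟩ := h
    exact ⟨i, hi.symm, fun j hj => hu j (Ne.symm hj)⟩⟩
  loopless := ⟨fun x h => by
    obtain ⟨i, hi, -⟩ := h
    exact hi rfl⟩

/-- The coordinate of a hypercube edge `s(x, y)`: the unique `i` with `x i ≠ y i`.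
(Only ever used for edges of the hypercube.) -/
noncomputable def coord : Sym2 Cube → ℕ :=
  Sym2.lift ⟨fun x y => sInf {i | x i ≠ y i}, fun x y => by simp only [ne_comm]⟩

/-- The coordinate of an edge is a place where its two ends differ, and the only one. -/
theorem ne_iff_eq_coord {x y : Cube} (h : hypercube.Adj x y) (i : ℕ) :
    x i ≠ y i ↔ i = coord s(x, y) := by
  obtain ⟨j, hj, hu⟩ := h
  have hset : {i | x i ≠ y i} = {j} := by
    ext k
    exact ⟨fun hk => hu k hk, fun hk => by rw [Set.mem_singleton_iff.1 hk]; exact hj⟩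
  have hc : coord s(x, y) = j := by
    simp only [coord, Sym2.lift_mk, hset, csInf_singleton]
  rw [hc]
  exact ⟨fun hk => hu i hk, fun hk => by rw [hk]; exact hj⟩

/-- The minimum degree of a subgraph of the hypercube. -/
noncomputable def minDeg (G : hypercube.Subgraph) : ℕ∞ :=
  ⨅ v : G.verts, (G.neighborSet v).encard

/-! ### Rooted trees -/

section Rooted

variable {V : Type*} (T : SimpleGraph V) (r : V)

/-- `w` is a descendant of `v` in the tree `T` with root `r`: the path from `r` to `w`
contains `v`. -/
def IsDescendant (v w : V) : Prop :=
  ∃ p : T.Walk r w, p.IsPath ∧ v ∈ p.support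

/-- A leaf of a rooted tree: a vertex with no descendant other than itself. -/
def IsLeaf (v : V) : Prop :=
  ∀ w, IsDescendant T r v w → w = v

/-- The level of a vertex: its distance to the root. -/
noncomputable def level (v : V) : ℕ := T.dist v r

/-- The greatest level among all descendants of `v`. -/
noncomputable def levelMax (v : V) : ℕ :=
  sSup {n | ∃ w, IsDescendant T r v w ∧ level T r w = n}

/-- The vertex set of `⌊T/2⌋`. -/
def floorHalf : Set V := {v | level T r v ≤ levelMax T r v / 2}

/-- The vertex set of `⌈T/2⌉`; `(m + 1) / 2` is `m / 2` rounded up. -/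
def ceilHalf : Set V := {v | level T r v ≤ (levelMax T r v + 1) / 2}

theorem root_mem_floorHalf : r ∈ floorHalf T r := by
  simp [floorHalf, level]

theorem root_mem_ceilHalf : r ∈ ceilHalf T r := by
  simp [ceilHalf, level]

end Rooted

/-! ### Homomorphisms into a subgraph of the hypercube -/

section Hom

variable {W C : Type*} {F : SimpleGraph W} {G : hypercube.Subgraph}

/-- For an edge-coloring `c` of `G`, a homomorphism is rainbow if it maps the edges of its domain
to edges of pairwise different colors. A proper edge-coloring of `G` is a proper coloring of
the line graph of `G`. -/
def Rainbow (c : G.coe.lineGraph.Coloring C) (φ : F →g G.coe) : Prop :=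
  Function.Injective fun e : F.edgeSet => c (φ.mapEdgeSet e)

/-- The coordinate of the image of an edge `e` of the domain. -/
noncomputable def imageCoord (φ : F →g G.coe) (e : Sym2 W) : ℕ :=
  coord (e.map fun w => (φ w : Cube))

/-- The edges in `E` are mapped to edges with pairwise different coordinates. -/
def DistinctlyDirectedOn (φ : F →g G.coe) (E : Set (Sym2 W)) : Prop :=
  Set.InjOn (imageCoord φ) E

/-- Both rainbow and distinctly directed on the whole edge set. -/
def DoublyDistinct (c : G.coe.lineGraph.Coloring C) (φ : F →g G.coe) : Prop :=
  Rainbow c φ ∧ DistinctlyDirectedOn φ F.edgeSet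

/-- Distinctly directed on the path from the root `r` to each leaf. -/
def PathDistinct (r : W) (φ : F →g G.coe) : Prop :=
  ∀ v, IsLeaf F r v → ∀ p : F.Walk r v, p.IsPath → DistinctlyDirectedOn φ {e | e ∈ p.edges}

/-- The restriction of a homomorphism to the subgraph induced by a set of vertices. -/
def restrict (Φ : F →g G.coe) (S : Set W) : F.induce S →g G.coe :=
  Φ.comp (SimpleGraph.Embedding.induce S).toHom

end Hom

end RainbowTree

/-! The proof is by induction on the number of vertices of a rooted subtree, and two facts drive it.
At a vertex of `G` each color and each coordinate belongs to at most one edge, so every forbidden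
color, coordinate or vertex costs at most one unit of degree. And a path with distinct coordinates
leads to a distance equal to its length, so if the first half of a path has distinct coordinates,
the second half can undo them only by flipping exactly these coordinates back. The bad vertex serves
to exclude this extremal case.

Splitting (`extensionProperty_of_split`). Let B be the branch at a vertex c with parent v, let A be
the remaining tree, and let Q be ⌊B/2⌋. Reflecting a lower half along longest paths away from the
root (`exists_reflection`) shows that halves are small, so the given map extends greedily to a
doubly distinct map of ⌊A/2⌋ ∪ Q (`exists_doublyDistinct`). By induction A is completed without the
colors and coordinates of Q, and then B without the colors of A and of the edge vc, with the image
of v as bad vertex. If a vertex w of B and a vertex of A had the same image, this point would agree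
with the image of v in the coordinates of Q, as A never flips them; the path from v to w would have
to undo its first half and end at the image of v, which is excluded. The degree suffices if 2|Q| ≤
|B| or if A is a single vertex.

Suppose that the root has at least two children and that 2|Q| > |B| for the branch at each of them.
Then the reflection estimate holds with equality at all grandchildren. If some child has two
children, the tree can be split at a grandchild. Otherwise every branch at the root is a path with
an odd number of vertices, and the tree is a spider.

Spiders (`IsSpider.extensionProperty`). The ceiling half exceeds the floor half by one middle vertex
per leg. The middle edges get coordinates that do not occur in the floor half, but two of them may
share a coordinate. The legs are then completed one at a time. Each leg avoids the lower-half
coordinates of those later legs that have the same middle coordinate, and also the neighbor of the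
root in this coordinate, which is the only point where such legs could still meet (`ne_of_avoids`).
Forbidding that vertex is paid for by a later leg with a different middle coordinate. For this
reason `exists_midExtension` arranges that, among the legs with more than one vertex, two middle
coordinates differ if there are at least two such legs, and that one of them is not the coordinate
of the bad edge. -/

namespace RainbowTree

/-! ### Parents, levels and descendants -/

open scoped Classical

/-- A parent function with a level function that drops by one at every step to the parent. -/
structure Ranked (V : Type*) where
  par : V → V
  lev : V → ℕ
  lev_par : ∀ v, lev (par v) = lev v - 1

namespace Ranked

variable {V : Type*} (P : Ranked V)

/-- `w` is a descendant of `v`: going up from `w` to the level of `v` leads to `v`. -/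
def Desc (v w : V) : Prop := P.lev v ≤ P.lev w ∧ P.par^[P.lev w - P.lev v] w = v

variable {P}

lemma lev_iterate (k : ℕ) (v : V) : P.lev (P.par^[k] v) = P.lev v - k := by
  induction k with
  | zero => simp
  | succ k ih => rw [Function.iterate_succ_apply', P.lev_par, ih]; omega

lemma Desc.refl (v : V) : P.Desc v v := by simp [Desc]

lemma Desc.le {v w : V} (h : P.Desc v w) : P.lev v ≤ P.lev w := h.1

lemma Desc.eq_of_le {v w : V} (h : P.Desc v w) (hl : P.lev w ≤ P.lev v) : v = w := by
  have := h.2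
  rw [Nat.sub_eq_zero_of_le hl] at this
  exact this.symm

lemma Desc.lt_of_ne {v w : V} (h : P.Desc v w) (hne : v ≠ w) : P.lev v < P.lev w := by
  by_contra hc
  exact hne (h.eq_of_le (not_lt.1 hc))

lemma Desc.trans {u v w : V} (h : P.Desc u v) (h' : P.Desc v w) : P.Desc u w := by
  refine ⟨h.1.trans h'.1, ?_⟩
  have : P.lev w - P.lev u = (P.lev v - P.lev u) + (P.lev w - P.lev v) := by
    have := h.1; have := h'.1; omega
  rw [this, Function.iterate_add_apply, h'.2, h.2]

lemma Desc.desc_of_le {u v w : V} (h : P.Desc u w) (h' : P.Desc v w) (hl : P.lev u ≤ P.lev v) :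
    P.Desc u v := by
  refine ⟨hl, ?_⟩
  have : P.lev w - P.lev u = (P.lev v - P.lev u) + (P.lev w - P.lev v) := by
    have := h'.1; omega
  have e := h.2
  rwa [this, Function.iterate_add_apply, h'.2] at e

lemma Desc.unique {u v w : V} (h : P.Desc u w) (h' : P.Desc v w) (hl : P.lev u = P.lev v) :
    u = v := (h.desc_of_le h' hl.le).eq_of_le hl.ge

lemma desc_par {v : V} (h : 0 < P.lev v) : P.Desc (P.par v) v := by
  refine ⟨by rw [P.lev_par]; omega, ?_⟩
  rw [P.lev_par]
  have : P.lev v - (P.lev v - 1) = 1 := by omega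
  rw [this]; rfl

lemma Desc.par_of_ne {u v : V} (h : P.Desc u v) (hne : u ≠ v) : P.Desc u (P.par v) := by
  have h1 := h.lt_of_ne hne
  exact h.desc_of_le (desc_par (by omega)) (by rw [P.lev_par]; omega)

lemma exists_anc (v : V) {l : ℕ} (hl : l ≤ P.lev v) : ∃ u, P.Desc u v ∧ P.lev u = l := by
  have hlev : P.lev (P.par^[P.lev v - l] v) = l := by rw [lev_iterate]; omega
  exact ⟨P.par^[P.lev v - l] v, ⟨by omega, by rw [hlev]⟩, hlev⟩

/-! ### Subtrees and their halves -/

variable (P)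

/-- `S` is the vertex set of a subtree with root `r`. -/
structure IsSubtree (S : Finset V) (r : V) : Prop where
  root_mem : r ∈ S
  par_mem : ∀ v ∈ S, v ≠ r → P.par v ∈ S
  lt : ∀ v ∈ S, v ≠ r → P.lev r < P.lev v

/-- The greatest level of a descendant of `x` in `S`. -/
noncomputable def top (S : Finset V) (x : V) : ℕ := (S.filter (P.Desc x)).sup P.lev

/-- The vertices whose level is at most half of `top + t`. -/
noncomputable def half (S : Finset V) (t : ℕ) : Finset V :=
  S.filter fun x => 2 * P.lev x ≤ P.top S x + t

/-- The descendants of `c` in `S`. -/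
noncomputable def below (S : Finset V) (c : V) : Finset V := S.filter (P.Desc c)

variable {P} {S : Finset V} {r c : V}

lemma mem_half {t : ℕ} {x : V} : x ∈ P.half S t ↔ x ∈ S ∧ 2 * P.lev x ≤ P.top S x + t :=
  Finset.mem_filter

lemma mem_below {x : V} : x ∈ P.below S c ↔ x ∈ S ∧ P.Desc c x := Finset.mem_filter

lemma below_subset : P.below S c ⊆ S := Finset.filter_subset _ _

lemma half_subset {t : ℕ} : P.half S t ⊆ S := Finset.filter_subset _ _

lemma half_mono {t t' : ℕ} (h : t ≤ t') : P.half S t ⊆ P.half S t' := by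
  intro x hx
  rw [mem_half] at hx ⊢
  exact ⟨hx.1, by omega⟩

lemma le_top {x y : V} (hy : y ∈ S) (h : P.Desc x y) : P.lev y ≤ P.top S x :=
  Finset.le_sup (f := P.lev) (Finset.mem_filter.2 ⟨hy, h⟩)

lemma lev_le_top {x : V} (hx : x ∈ S) : P.lev x ≤ P.top S x := le_top hx (Desc.refl x)

lemma exists_top {x : V} (hx : x ∈ S) : ∃ y ∈ S, P.Desc x y ∧ P.lev y = P.top S x := by
  obtain ⟨y, hy, h⟩ := Finset.exists_mem_eq_sup (S.filter (P.Desc x))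
    ⟨x, Finset.mem_filter.2 ⟨hx, Desc.refl x⟩⟩ P.lev
  exact ⟨y, (Finset.mem_filter.1 hy).1, (Finset.mem_filter.1 hy).2, h.symm⟩

lemma top_anti {x y : V} (h : P.Desc x y) : P.top S y ≤ P.top S x := by
  refine Finset.sup_le fun w hw => ?_
  rw [Finset.mem_filter] at hw
  exact le_top hw.1 (h.trans hw.2)

lemma top_mono {S' : Finset V} (h : S' ⊆ S) (x : V) : P.top S' x ≤ P.top S x :=
  Finset.sup_mono (Finset.filter_subset_filter _ h)

namespace IsSubtree

variable (hS : P.IsSubtree S r)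
include hS

lemma lev_par_add {v : V} (hv : v ∈ S) (hne : v ≠ r) : P.lev v = P.lev (P.par v) + 1 := by
  have := hS.lt v hv hne
  rw [P.lev_par]; omega

lemma desc_par' {v : V} (hv : v ∈ S) (hne : v ≠ r) : P.Desc (P.par v) v :=
  desc_par (by have := hS.lt v hv hne; omega)

lemma le_lev {v : V} (hv : v ∈ S) : P.lev r ≤ P.lev v := by
  by_cases h : v = r
  · rw [h]
  · exact (hS.lt v hv h).le

lemma eq_root {v : V} (hv : v ∈ S) (h : P.lev v ≤ P.lev r) : v = r := by
  by_contra hne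
  have := hS.lt v hv hne
  omega

lemma mem_of_desc {u v : V} (hv : v ∈ S) (h : P.Desc u v) (hl : P.lev r ≤ P.lev u) : u ∈ S := by
  induction hn : P.lev v using Nat.strong_induction_on generalizing v with
  | _ n ih =>
    by_cases huv : u = v
    · exact huv ▸ hv
    · have hlt := h.lt_of_ne huv
      have hvr : v ≠ r := by rintro rfl; omega
      have := hS.lev_par_add hv hvr
      exact ih _ (by omega) (hS.par_mem v hv hvr) (h.par_of_ne huv) rfl

lemma root_desc {v : V} (hv : v ∈ S) : P.Desc r v := by
  obtain ⟨u, hu, hl⟩ := exists_anc v (hS.le_lev hv)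
  have := hS.eq_root (hS.mem_of_desc hv hu hl.ge) hl.le
  exact this ▸ hu

lemma exists_anc_mem {v : V} (hv : v ∈ S) {l : ℕ} (hr : P.lev r ≤ l) (hl : l ≤ P.lev v) :
    ∃ u ∈ S, P.Desc u v ∧ P.lev u = l := by
  obtain ⟨u, hu, h⟩ := exists_anc v hl
  exact ⟨u, hS.mem_of_desc hv hu (by omega), hu, h⟩

lemma below_isSubtree (hc : c ∈ S) : P.IsSubtree (P.below S c) c where
  root_mem := mem_below.2 ⟨hc, Desc.refl c⟩
  par_mem v hv hne := by
    rw [mem_below] at hv ⊢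
    have h := hv.2.lt_of_ne (Ne.symm hne)
    have := hS.le_lev hc
    refine ⟨hS.par_mem v hv.1 ?_, hv.2.par_of_ne (Ne.symm hne)⟩
    rintro rfl; omega
  lt v hv hne := (mem_below.1 hv).2.lt_of_ne (Ne.symm hne)

lemma sdiff_isSubtree (hc : c ∈ S) (hcr : c ≠ r) : P.IsSubtree (S \ P.below S c) r where
  root_mem := by
    rw [Finset.mem_sdiff, mem_below]
    refine ⟨hS.root_mem, fun h => ?_⟩
    have := hS.lt c hc hcr
    have := h.2.le
    omega
  par_mem v hv hne := by
    rw [Finset.mem_sdiff, mem_below] at hv ⊢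
    refine ⟨hS.par_mem v hv.1 hne, fun h => hv.2 ⟨hv.1, h.2.trans (hS.desc_par' hv.1 hne)⟩⟩
  lt v hv hne := hS.lt v (Finset.mem_sdiff.1 hv).1 hne

lemma root_mem_half {t : ℕ} (ht : P.lev r ≤ t) : r ∈ P.half S t := by
  rw [mem_half]
  have := lev_le_top (P := P) hS.root_mem
  exact ⟨hS.root_mem, by omega⟩

lemma half_desc_closed {t : ℕ} {u v : V} (hv : v ∈ P.half S t) (h : P.Desc u v)
    (hl : P.lev r ≤ P.lev u) : u ∈ P.half S t := by
  rw [mem_half] at hv ⊢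
  have h1 := top_anti (S := S) h
  have h2 := h.le
  exact ⟨hS.mem_of_desc hv.1 h hl, by omega⟩

lemma half_isSubtree {t : ℕ} (ht : P.lev r ≤ t) : P.IsSubtree (P.half S t) r where
  root_mem := hS.root_mem_half ht
  par_mem v hv hne := by
    have hvS := half_subset hv
    refine hS.half_desc_closed hv (hS.desc_par' hvS hne) ?_
    exact hS.le_lev (hS.par_mem v hvS hne)
  lt v hv hne := hS.lt v (half_subset hv) hne

end IsSubtree

lemma top_below {x : V} (hx : P.Desc c x) : P.top (P.below S c) x = P.top S x := by
  unfold top below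
  congr 1
  ext y
  simp only [Finset.mem_filter]
  exact ⟨fun h => ⟨h.1.1, h.2⟩, fun h => ⟨⟨h.1, hx.trans h.2⟩, h.2⟩⟩

/-- A branch keeps all descendants of its vertices, and levels are not shifted at its root. With the
level of the root as threshold, `half` is the floor half; with one more, the ceiling half. Hence for
a child `c` of the root the floor half of the branch at `c` is the part of the ceiling half of `S`
in this branch. -/
lemma half_below (t : ℕ) : P.half (P.below S c) t = P.half S t ∩ P.below S c := by
  ext x
  simp only [mem_half, Finset.mem_inter]
  constructor
  · rintro ⟨h1, h2⟩
    rw [top_below (mem_below.1 h1).2] at h2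
    exact ⟨⟨below_subset h1, h2⟩, h1⟩
  · rintro ⟨h1, h2⟩
    refine ⟨h2, ?_⟩
    rw [top_below (mem_below.1 h2).2]
    exact h1.2

/-- Only ancestors of `c` lose descendants when the branch at `c` is removed. -/
lemma top_sdiff {x : V} (hx : x ∈ S \ P.below S c) (h : ¬ P.Desc x c) :
    P.top (S \ P.below S c) x = P.top S x := by
  unfold top
  congr 1
  ext y
  simp only [Finset.mem_filter, Finset.mem_sdiff, mem_below]
  refine ⟨fun h => ⟨h.1.1, h.2⟩, fun hy => ⟨⟨hy.1, fun hc => ?_⟩, hy.2⟩⟩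
  rw [Finset.mem_sdiff, mem_below] at hx
  rcases le_total (P.lev x) (P.lev c) with hl | hl
  · exact h (hy.2.desc_of_le hc.2 hl)
  · exact hx.2 ⟨hx.1, hc.2.desc_of_le hy.2 hl⟩

/-- The ancestors of `c` may lose their deepest descendants, so they are required to lie in a half
of the remaining tree; for all other vertices nothing changes. -/
lemma half_sdiff {t₀ t : ℕ} (ht : t₀ ≤ t)
    (h : ∀ x ∈ S \ P.below S c, P.Desc x c → x ∈ P.half (S \ P.below S c) t₀) :
    P.half (S \ P.below S c) t = P.half S t ∩ (S \ P.below S c) := by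
  ext x
  rw [Finset.mem_inter]
  constructor
  · intro hx
    refine ⟨?_, half_subset hx⟩
    rw [mem_half] at hx ⊢
    have := top_mono (P := P) (Finset.sdiff_subset : S \ P.below S c ⊆ S) x
    exact ⟨(Finset.mem_sdiff.1 hx.1).1, by omega⟩
  · rintro ⟨hx, hxA⟩
    by_cases hd : P.Desc x c
    · exact half_mono ht (h x hxA hd)
    · rw [mem_half] at hx ⊢
      exact ⟨hxA, by rw [top_sdiff hxA hd]; exact hx.2⟩

/-! ### Reflection and the size of halves -/

/-- The reflection of the lower half of `Y` into the upper half. -/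
lemma exists_reflection {Y : Finset V} {t : ℕ} (hS : P.IsSubtree S r)
    (hY : ∀ x ∈ Y, ∀ y ∈ S, P.Desc x y → y ∈ Y) (hl : ∀ x ∈ Y, t + 1 ≤ P.lev x) :
    ∃ f : V → V, Set.InjOn f (P.half S t ∩ Y : Finset V) ∧
      ∀ x ∈ P.half S t ∩ Y, f x ∈ Y \ P.half S t ∧ P.Desc x (f x) ∧
        P.top S (f x) = P.top S x ∧ P.lev (f x) = P.top S x + (t + 1) - P.lev x := by
  have key : ∀ x ∈ P.half S t ∩ Y, ∃ y, y ∈ Y \ P.half S t ∧ P.Desc x y ∧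
        P.top S y = P.top S x ∧ P.lev y = P.top S x + (t + 1) - P.lev x := by
    intro x hx
    rw [Finset.mem_inter, mem_half] at hx
    have h1 := hl x hx.2
    have h2 := hx.1.2
    obtain ⟨w, hw, hxw, hwt⟩ := exists_top (P := P) hx.1.1
    -- The image lies on the path to a deepest descendant `w` of `x`. Its level is at most that of
    -- `w` because `x` has level at least `t + 1`, and it exceeds that of `x` because `x` is in the
    -- half.
    obtain ⟨y, hyw, hyl⟩ := exists_anc (P := P) w (l := P.top S x + (t + 1) - P.lev x) (by omega)
    have hxy : P.Desc x y := hxw.desc_of_le hyw (by rw [hyl]; omega)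
    have hyS : y ∈ S := hS.mem_of_desc hw hyw ((hS.le_lev hx.1.1).trans hxy.le)
    have htop : P.top S y = P.top S x :=
      le_antisymm (top_anti hxy) (hwt ▸ le_top hw hyw)
    refine ⟨y, ?_, hxy, htop, hyl⟩
    rw [Finset.mem_sdiff, mem_half, htop]
    exact ⟨hY x hx.2 y hyS hxy, fun h => by have := h.2; omega⟩
  choose! f hf using key
  refine ⟨f, ?_, hf⟩
  intro x hx y hy hxy
  have hx' := hf x hx
  have hy' := hf y hy
  have hx1 := hl x (Finset.mem_inter.1 hx).2
  have hy1 := hl y (Finset.mem_inter.1 hy).2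
  have e1 := (mem_half.1 (Finset.mem_inter.1 hx).1).2
  have e2 := (mem_half.1 (Finset.mem_inter.1 hy).1).2
  have e3 := hx'.2.2.2
  have e4 := hy'.2.2.2
  have e5 := hx'.2.2.1
  have e6 := hy'.2.2.1
  rw [← hxy] at e4 e6
  -- The levels of a vertex and of its reflection sum to `t + 1` plus the top of the reflection. So
  -- `x` and `y` are ancestors of one vertex at equal levels.
  exact hx'.2.1.unique (hxy ▸ hy'.2.1) (by omega)

lemma two_mul_card_half_le {Y : Finset V} {t : ℕ} (hS : P.IsSubtree S r)
    (hY : ∀ x ∈ Y, ∀ y ∈ S, P.Desc x y → y ∈ Y) (hl : ∀ x ∈ Y, t + 1 ≤ P.lev x) :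
    2 * (P.half S t ∩ Y).card ≤ Y.card := by
  obtain ⟨f, hf, hfm⟩ := exists_reflection hS hY hl
  have h1 : (P.half S t ∩ Y).card ≤ (Y \ P.half S t).card :=
    Finset.card_le_card_of_injOn f (fun x hx => (hfm x hx).1) hf
  have h2 := Finset.card_sdiff_add_card_inter Y (P.half S t)
  rw [Finset.inter_comm] at h2
  omega

namespace IsSubtree

variable (hS : P.IsSubtree S r)
include hS

/-- Edges correspond to vertices other than the root. All of these lie above the level of the root
and can be reflected, so the floor half has at most half of the edges. -/
lemma two_mul_card_half_le_card : 2 * ((P.half S (P.lev r)).card - 1) ≤ S.card - 1 := by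
  have h := two_mul_card_half_le (P := P) (Y := S.erase r) (t := P.lev r)
    hS
    (fun x hx y hy hxy => Finset.mem_erase.2 ⟨by
      rintro rfl
      have := hS.lt x (Finset.mem_of_mem_erase hx) (Finset.ne_of_mem_erase hx)
      have := hxy.le
      omega, hy⟩)
    (fun x hx => hS.lt x (Finset.mem_of_mem_erase hx) (Finset.ne_of_mem_erase hx))
  rw [Finset.card_erase_of_mem hS.root_mem] at h
  have h2 : P.half S (P.lev r) ∩ S.erase r = (P.half S (P.lev r)).erase r := by
    ext x
    simp only [Finset.mem_inter, Finset.mem_erase]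
    exact ⟨fun h => ⟨h.2.1, h.1⟩, fun h => ⟨h.2, h.1, half_subset h.2⟩⟩
  rwa [h2, Finset.card_erase_of_mem (hS.root_mem_half le_rfl)] at h

/-- The threshold is one below the level of `c`, so `c` is reflected too and no error term arises.
-/
lemma half_below_card {t : ℕ} (ht : P.lev c = t + 1) :
    2 * (P.half S t ∩ P.below S c).card ≤ (P.below S c).card := by
  refine two_mul_card_half_le hS ?_ ?_
  · intro x hx y hy hxy
    exact mem_below.2 ⟨hy, (mem_below.1 hx).2.trans hxy⟩
  · intro x hx
    exact ht ▸ (mem_below.1 hx).2.le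

/-- Here the root `c` of the branch has no reflection, which causes the extra 1. Whether this bound
is attained decides between splitting and the spider case. -/
lemma card_half_below_le (hc : c ∈ S) :
    2 * (P.half S (P.lev c) ∩ P.below S c).card ≤ (P.below S c).card + 1 := by
  have hS' := hS.below_isSubtree hc
  have h := hS'.two_mul_card_half_le_card
  rw [half_below] at h
  have : 0 < (P.below S c).card := Finset.card_pos.2 ⟨c, hS'.root_mem⟩
  omega

end IsSubtree

/-! ### Branches at the children of the root -/

variable (P) in
/-- The children of `r` in `S`. -/
noncomputable def children (S : Finset V) (r : V) : Finset V :=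
  S.filter fun c => P.par c = r ∧ P.lev c = P.lev r + 1

lemma mem_children {x : V} : x ∈ P.children S r ↔ x ∈ S ∧ P.par x = r ∧ P.lev x = P.lev r + 1 :=
  Finset.mem_filter

lemma disjoint_below {d : V} (hl : P.lev c = P.lev d) (hne : c ≠ d) :
    Disjoint (P.below S c) (P.below S d) := by
  rw [Finset.disjoint_left]
  intro x hx hx'
  exact hne ((mem_below.1 hx).2.unique (mem_below.1 hx').2 hl)

lemma children_ne_root (hc : c ∈ P.children S r) : c ≠ r := by
  rintro rfl
  have := (mem_children.1 hc).2.2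
  omega

lemma pairwiseDisjoint_children :
    ((P.children S r : Finset V) : Set V).PairwiseDisjoint (P.below S) := by
  intro c hc d hd hne
  exact disjoint_below ((mem_children.1 hc).2.2.trans (mem_children.1 hd).2.2.symm) hne

lemma child_mem_half (hc : c ∈ P.children S r) : c ∈ P.half S (P.lev r + 1) := by
  have h := mem_children.1 hc
  have := lev_le_top (P := P) h.1
  exact mem_half.2 ⟨h.1, by omega⟩

namespace IsSubtree

variable (hS : P.IsSubtree S r)
include hS

lemma exists_child {x : V} (hx : x ∈ S) (hne : x ≠ r) : ∃ c ∈ P.children S r, P.Desc c x := by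
  have hlt := hS.lt x hx hne
  obtain ⟨c, hc, hcx, hl⟩ := hS.exists_anc_mem hx (l := P.lev r + 1) (by omega) (by omega)
  have hcr : c ≠ r := by rintro rfl; omega
  refine ⟨c, mem_children.2 ⟨hc, ?_, hl⟩, hcx⟩
  refine hS.eq_root (hS.par_mem c hc hcr) ?_
  rw [P.lev_par]; omega

lemma biUnion_children : (P.children S r).biUnion (P.below S) = S.erase r := by
  ext x
  simp only [Finset.mem_biUnion, Finset.mem_erase]
  constructor
  · rintro ⟨c, hc, hx⟩
    rw [mem_below] at hx
    refine ⟨?_, hx.1⟩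
    rintro rfl
    have := (mem_children.1 hc).2.2
    have := hx.2.le
    omega
  · rintro ⟨hne, hx⟩
    obtain ⟨c, hc, h⟩ := hS.exists_child hx hne
    exact ⟨c, hc, mem_below.2 ⟨hx, h⟩⟩

lemma sum_card_below : ∑ c ∈ P.children S r, (P.below S c).card = S.card - 1 := by
  rw [← Finset.card_erase_of_mem hS.root_mem, ← hS.biUnion_children,
    Finset.card_biUnion pairwiseDisjoint_children]

lemma sum_card_inter_below {X : Finset V} (hX : X ⊆ S) :
    ∑ c ∈ P.children S r, (X ∩ P.below S c).card = (X.erase r).card := by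
  have : X.erase r = (P.children S r).biUnion fun c => X ∩ P.below S c := by
    ext x
    have h := Finset.ext_iff.1 hS.biUnion_children x
    simp only [Finset.mem_biUnion, Finset.mem_erase, Finset.mem_inter] at h ⊢
    constructor
    · rintro ⟨h1, h2⟩
      obtain ⟨c, hc, h3⟩ := h.2 ⟨h1, hX h2⟩
      exact ⟨c, hc, h2, h3⟩
    · rintro ⟨c, hc, h2, h3⟩
      exact ⟨(h.1 ⟨c, hc, h3⟩).1, h2⟩
  rw [this, Finset.card_biUnion]
  intro c hc d hd hne
  exact (pairwiseDisjoint_children hc hd hne).mono Finset.inter_subset_right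
    Finset.inter_subset_right

/-- Removing `c` turns both cardinalities into sums over the branches at the children of `c`, where
the estimate without error term applies. -/
lemma card_below_child {t : ℕ} (hc : c ∈ S) (hch : c ∈ P.half S t) :
    (P.below S c).card = ∑ d ∈ P.children (P.below S c) c, (P.below S d).card + 1 ∧
    (P.half S t ∩ P.below S c).card =
      ∑ d ∈ P.children (P.below S c) c, (P.half S t ∩ P.below S d).card + 1 := by
  have hS' := hS.below_isSubtree hc
  have hbb : ∀ d ∈ P.children (P.below S c) c, P.below (P.below S c) d = P.below S d := by
    intro d hd
    have hcd := (mem_below.1 (mem_children.1 hd).1).2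
    ext x
    simp only [mem_below]
    exact ⟨fun h => ⟨h.1.1, h.2⟩, fun h => ⟨⟨h.1, hcd.trans h.2⟩, h.2⟩⟩
  have h1 := hS'.sum_card_below
  have h2 := hS'.sum_card_inter_below (X := P.half S t ∩ P.below S c) Finset.inter_subset_right
  have hcb : c ∈ P.half S t ∩ P.below S c := Finset.mem_inter.2 ⟨hch, hS'.root_mem⟩
  rw [Finset.card_erase_of_mem hcb] at h2
  have e1 : ∑ d ∈ P.children (P.below S c) c, (P.below (P.below S c) d).card
      = ∑ d ∈ P.children (P.below S c) c, (P.below S d).card :=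
    Finset.sum_congr rfl fun d hd => by rw [hbb d hd]
  have e2 : ∑ d ∈ P.children (P.below S c) c,
        (P.half S t ∩ P.below S c ∩ P.below (P.below S c) d).card
      = ∑ d ∈ P.children (P.below S c) c, (P.half S t ∩ P.below S d).card := by
    refine Finset.sum_congr rfl fun d hd => ?_
    rw [← hbb d hd, Finset.inter_assoc, Finset.inter_eq_right.2 (below_subset)]
  rw [e1] at h1
  rw [e2] at h2
  have : 0 < (P.below S c).card := Finset.card_pos.2 ⟨c, hS'.root_mem⟩
  have : 0 < (P.half S t ∩ P.below S c).card := Finset.card_pos.2 ⟨c, hcb⟩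
  exact ⟨by omega, by omega⟩

/-- If the reflection is onto, the branch has only one leaf, hence is a path. -/
lemma injOn_lev_below {t : ℕ} (ht : P.lev c = t + 1)
    (h : (P.below S c).card ≤ 2 * (P.half S t ∩ P.below S c).card) :
    Set.InjOn P.lev (P.below S c : Set V) := by
  have hcl : ∀ x ∈ P.below S c, ∀ y ∈ S, P.Desc x y → y ∈ P.below S c :=
    fun x hx y hy hxy => mem_below.2 ⟨hy, (mem_below.1 hx).2.trans hxy⟩
  have hlev : ∀ x ∈ P.below S c, t + 1 ≤ P.lev x := fun x hx => ht ▸ (mem_below.1 hx).2.le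
  obtain ⟨f, hf, hfm⟩ := exists_reflection hS hcl hlev
  have hcard := Finset.card_sdiff_add_card_inter (P.below S c) (P.half S t)
  rw [Finset.inter_comm] at hcard
  -- Equality in the count makes the reflection surjective onto the upper part.
  have himg : (P.half S t ∩ P.below S c).image f = P.below S c \ P.half S t := by
    refine Finset.eq_of_subset_of_card_le ?_ ?_
    · intro y hy
      obtain ⟨x, hx, rfl⟩ := Finset.mem_image.1 hy
      exact (hfm x hx).1
    · rw [Finset.card_image_of_injOn hf]; omega
  -- A vertex at its own top can only be the reflection of a vertex of level `t + 1`, which is `c`.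
  -- So `f c` is the only leaf of the branch.
  have hleaf : ∀ l ∈ P.below S c, P.lev l = P.top S l → l = f c := by
    intro l hl hlt
    have h1 := hlev l hl
    have : l ∈ P.below S c \ P.half S t := by
      rw [Finset.mem_sdiff, mem_half]
      exact ⟨hl, fun h => by have := h.2; omega⟩
    rw [← himg] at this
    obtain ⟨x, hx, rfl⟩ := Finset.mem_image.1 this
    have h2 := hfm x hx
    have h3 := hlev x (Finset.mem_inter.1 hx).2
    have h4 := (mem_half.1 (Finset.mem_inter.1 hx).1).2
    have h5 := (mem_below.1 (Finset.mem_inter.1 hx).2).2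
    rw [← h5.eq_of_le (by omega)]
  intro x hx y hy hxy
  have hx' : x ∈ P.below S c := hx
  have hy' : y ∈ P.below S c := hy
  obtain ⟨l, hl, hxl, hlt⟩ := exists_top (P := P) (below_subset hx')
  obtain ⟨m, hm, hym, hmt⟩ := exists_top (P := P) (below_subset hy')
  have e1 := hleaf l (hcl x hx' l hl hxl)
    (le_antisymm (lev_le_top hl) (hlt ▸ top_anti hxl))
  have e2 := hleaf m (hcl y hy' m hm hym)
    (le_antisymm (lev_le_top hm) (hmt ▸ top_anti hym))
  rw [e1] at hxl
  rw [e2] at hym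
  exact hxl.unique hym hxy

end IsSubtree

end Ranked

/-! ### Degrees after deleting colors, directions and vertices -/

/-- `κ` is a proper edge-coloring of the graph `H`, a subgraph of the hypercube. -/
structure IsColored {C : Type*} (H : Cube → Cube → Prop) (κ : Cube → Cube → C) : Prop where
  symm : ∀ {x y}, H x y → H y x
  cube : ∀ {x y}, H x y → hypercube.Adj x y
  col_symm : ∀ x y, κ x y = κ y x
  proper : ∀ {x y y'}, H x y → H x y' → κ x y = κ x y' → y = y'

/-- All neighbors lie in `U`, and all vertices of `U` have at least `n` of them. -/
structure HasDeg (U : Set Cube) (H : Cube → Cube → Prop) (n : ℕ) : Prop where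
  mem : ∀ {x y}, H x y → y ∈ U
  deg : ∀ {x}, x ∈ U → (n : ℕ∞) ≤ {y | H x y}.encard

/-- Deletion of the colors in `Γ`, the directions in `Δ` and the vertices in `Y`. -/
def del {C : Type*} (H : Cube → Cube → Prop) (κ : Cube → Cube → C) (Γ : Finset C) (Δ : Finset ℕ)
    (Y : Finset Cube) (x y : Cube) : Prop :=
  H x y ∧ κ x y ∉ Γ ∧ coord s(x, y) ∉ Δ ∧ x ∉ Y ∧ y ∉ Y

section

variable {C : Type*} {H : Cube → Cube → Prop} {κ : Cube → Cube → C} {U : Set Cube} {n : ℕ}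

lemma eq_of_coord_eq {x y y' : Cube} (h : hypercube.Adj x y) (h' : hypercube.Adj x y')
    (he : coord s(x, y) = coord s(x, y')) : y = y' := by
  funext i
  have h1 := ne_iff_eq_coord h i
  have h2 := ne_iff_eq_coord h' i
  rw [he] at h1
  by_cases hi : i = coord s(x, y')
  · have e1 := h1.2 hi
    have e2 := h2.2 hi
    cases hx : x i <;> cases hy : y i <;> cases hy' : y' i <;> simp_all
  · have e1 : x i = y i := by by_contra hc; exact hi (h1.1 hc)
    have e2 : x i = y' i := by by_contra hc; exact hi (h2.1 hc)
    rw [← e1, e2]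

lemma IsColored.del (hH : IsColored H κ) (Γ : Finset C) (Δ : Finset ℕ) (Y : Finset Cube) :
    IsColored (del H κ Γ Δ Y) κ where
  symm := by
    rintro x y ⟨h1, h2, h3, h4, h5⟩
    exact ⟨hH.symm h1, hH.col_symm x y ▸ h2, Sym2.eq_swap (a := x) (b := y) ▸ h3, h5, h4⟩
  cube h := hH.cube h.1
  col_symm := hH.col_symm
  proper h h' := hH.proper h.1 h'.1

lemma HasDeg.mono {m : ℕ} (hU : HasDeg U H n) (h : m ≤ n) : HasDeg U H m where
  mem := hU.mem
  deg hx := le_trans (by exact_mod_cast h) (hU.deg hx)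

/-- The coloring is proper and a direction determines the neighbor, so each deleted color, direction
or vertex removes at most one neighbor of a surviving vertex. -/
lemma HasDeg.del (hU : HasDeg U H n) (hH : IsColored H κ) (Γ : Finset C) (Δ : Finset ℕ)
    (Y : Finset Cube) :
    HasDeg (U \ Y) (RainbowTree.del H κ Γ Δ Y) (n - (Γ.card + Δ.card + Y.card)) where
  mem h := ⟨hU.mem h.1, fun hy => h.2.2.2.2 (by exact_mod_cast hy)⟩
  deg := by
    intro x hx
    have hxY : x ∉ Y := fun h => hx.2 (by exact_mod_cast h)
    have hsub : {y | H x y} ⊆ {y | RainbowTree.del H κ Γ Δ Y x y} ∪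
        ({y | H x y ∧ κ x y ∈ Γ} ∪ {y | H x y ∧ coord s(x, y) ∈ Δ} ∪ (Y : Set Cube)) := by
      intro y hy
      by_cases h1 : κ x y ∈ Γ
      · exact Or.inr (Or.inl (Or.inl ⟨hy, h1⟩))
      by_cases h2 : coord s(x, y) ∈ Δ
      · exact Or.inr (Or.inl (Or.inr ⟨hy, h2⟩))
      by_cases h3 : y ∈ Y
      · exact Or.inr (Or.inr (by exact_mod_cast h3))
      exact Or.inl ⟨hy, h1, h2, hxY, h3⟩
    have hΓ : {y | H x y ∧ κ x y ∈ Γ}.encard ≤ Γ.card := by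
      rw [← Set.encard_coe_eq_coe_finsetCard]
      refine Set.encard_le_encard_of_injOn (f := fun y => κ x y) (fun y hy => ?_) ?_
      · exact_mod_cast hy.2
      · intro y hy y' hy' h
        exact hH.proper hy.1 hy'.1 h
    have hΔ : {y | H x y ∧ coord s(x, y) ∈ Δ}.encard ≤ Δ.card := by
      rw [← Set.encard_coe_eq_coe_finsetCard]
      refine Set.encard_le_encard_of_injOn (f := fun y => coord s(x, y)) (fun y hy => ?_) ?_
      · exact_mod_cast hy.2
      · intro y hy y' hy' h
        exact eq_of_coord_eq (hH.cube hy.1) (hH.cube hy'.1) h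
    have hbound : (n : ℕ∞) ≤ {y | RainbowTree.del H κ Γ Δ Y x y}.encard +
        ((Γ.card + Δ.card + Y.card : ℕ) : ℕ∞) := by
      refine (hU.deg hx.1).trans ((Set.encard_le_encard hsub).trans
        ((Set.encard_union_le _ _).trans ?_))
      gcongr
      refine (Set.encard_union_le _ _).trans ?_
      rw [Set.encard_coe_eq_coe_finsetCard, Nat.cast_add, Nat.cast_add]
      gcongr
      refine (Set.encard_union_le _ _).trans ?_
      gcongr
    rw [ENat.natCast_sub]
    exact tsub_le_iff_right.2 hbound

lemma HasDeg.exists_next (hU : HasDeg U H n) (hH : IsColored H κ) {x : Cube} (hx : x ∈ U)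
    (Γ : Finset C) (Δ : Finset ℕ) (h : Γ.card + Δ.card < n) :
    ∃ y, H x y ∧ κ x y ∉ Γ ∧ coord s(x, y) ∉ Δ := by
  have h1 := (hU.del hH Γ Δ ∅).deg (x := x) (by simpa using hx)
  have h2 : 0 < n - (Γ.card + Δ.card + (∅ : Finset Cube).card) := by
    rw [Finset.card_empty]; omega
  have h3 : {y | RainbowTree.del H κ Γ Δ ∅ x y}.Nonempty := by
    rw [← Set.encard_pos]
    exact lt_of_lt_of_le (by exact_mod_cast h2) h1
  obtain ⟨y, hy⟩ := h3
  exact ⟨y, hy.1, hy.2.1, hy.2.2.1⟩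

/-- The same with one more forbidden element, if some edge is forbidden twice. -/
lemma HasDeg.exists_next_of_back (hU : HasDeg U H n) (hH : IsColored H κ) {x p : Cube}
    (hx : x ∈ U) (hp : H x p) (Γ : Finset C) (Δ : Finset ℕ) (hΓ : κ x p ∈ Γ)
    (hΔ : coord s(x, p) ∈ Δ) (h : Γ.card + Δ.card ≤ n) :
    ∃ y, H x y ∧ κ x y ∉ Γ ∧ coord s(x, y) ∉ Δ := by
  have hpos : 0 < Δ.card := Finset.card_pos.2 ⟨_, hΔ⟩
  -- The direction of the edge to `p` need not be forbidden: it leads only to `p`, which is excluded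
  -- by its color.
  obtain ⟨y, h1, h2, h3⟩ := hU.exists_next hH hx Γ (Δ.erase (coord s(x, p)))
    (by rw [Finset.card_erase_of_mem hΔ]; omega)
  refine ⟨y, h1, h2, fun h4 => ?_⟩
  rw [Finset.mem_erase] at h3
  have : coord s(x, y) = coord s(x, p) := by
    by_contra hne
    exact h3 ⟨hne, h4⟩
  rw [eq_of_coord_eq (hH.cube h1) (hH.cube hp) this] at h2
  exact h2 hΓ

end

/-! ### Distances in the cube along paths of the tree -/

lemma encard_diff_triangle (x y z : Cube) :
    {i | x i ≠ z i}.encard ≤ {i | x i ≠ y i}.encard + {i | y i ≠ z i}.encard := by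
  refine le_trans (Set.encard_le_encard ?_) (Set.encard_union_le _ _)
  intro i hi
  by_contra h
  simp only [Set.mem_union, Set.mem_ofPred_eq, not_or, not_not] at h
  exact hi (h.1.trans h.2)

/-- A point that agrees with `y` where `p` does not, and is not further from `p` than `y`,
is `y`. -/
lemma eq_of_agree {p q y : Cube} (hf : {i | p i ≠ y i}.Finite)
    (h : ∀ i, p i ≠ y i → q i = y i) (hc : {i | p i ≠ q i}.encard ≤ {i | p i ≠ y i}.encard) :
    q = y := by
  have hsub : {i | p i ≠ y i} ⊆ {i | p i ≠ q i} := by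
    intro i hi
    rw [Set.mem_ofPred_eq, h i hi]
    exact hi
  have heq := hf.eq_of_subset_of_encard_le hsub hc
  funext i
  by_cases hi : p i = y i
  · have : i ∉ {i | p i ≠ q i} := by rw [← heq]; exact fun h => h hi
    rw [← hi]
    by_contra hne
    exact this (Ne.symm hne)
  · exact h i hi

namespace Ranked

variable {V : Type*} (P : Ranked V) {C : Type*}

/-- The color of the image of the edge from `v` to its parent. -/
def col (κ : Cube → Cube → C) (φ : V → Cube) (v : V) : C := κ (φ (P.par v)) (φ v)

/-- The coordinate of the image of the edge from `v` to its parent. -/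
noncomputable def dir (φ : V → Cube) (v : V) : ℕ := coord s(φ (P.par v), φ v)

/-- The vertices below `u` on the path from `u` to `w`. -/
def between (u w : V) : Set V := {x | P.Desc u x ∧ x ≠ u ∧ P.Desc x w}

/-- `φ` maps the edges from the vertices of `X` to their parents to edges of `H`. -/
def Hom (H : Cube → Cube → Prop) (φ : V → Cube) (X : Set V) : Prop :=
  ∀ v ∈ X, H (φ (P.par v)) (φ v)

variable {P} {φ ψ : V → Cube}

lemma between_self (u : V) : P.between u u = ∅ := by
  ext x
  simp only [between, Set.mem_ofPred_eq, Set.mem_empty_iff_false, iff_false, not_and]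
  intro h hne h'
  exact hne (h'.eq_of_le h.le)

lemma between_of_ne {u w : V} (h : P.Desc u w) (hne : u ≠ w) :
    P.between u w = insert w (P.between u (P.par w)) := by
  have hlt := h.lt_of_ne hne
  ext x
  simp only [between, Set.mem_ofPred_eq, Set.mem_insert_iff]
  constructor
  · rintro ⟨h1, h2, h3⟩
    by_cases hx : x = w
    · exact Or.inl hx
    · exact Or.inr ⟨h1, h2, h3.par_of_ne hx⟩
  · rintro (rfl | ⟨h1, h2, h3⟩)
    · exact ⟨h, hne.symm, Desc.refl _⟩
    · exact ⟨h1, h2, h3.trans (desc_par (by omega))⟩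

lemma not_mem_between_par {u w : V} (h : P.Desc u w) (hne : u ≠ w) :
    w ∉ P.between u (P.par w) := by
  intro hw
  have := h.lt_of_ne hne
  have h1 := hw.2.2.le
  rw [P.lev_par] at h1
  omega

/-- Induction along the path from `u` down to `w`. -/
lemma Desc.induction {u : V} {p : V → Prop} (h0 : p u)
    (h1 : ∀ w, P.Desc u w → u ≠ w → p (P.par w) → p w) {w : V} (h : P.Desc u w) : p w := by
  induction hn : P.lev w using Nat.strong_induction_on generalizing w with
  | _ n ih =>
    by_cases huw : u = w
    · exact huw ▸ h0
    · have := h.lt_of_ne huw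
      exact h1 w h huw (ih _ (by rw [P.lev_par]; omega) (h.par_of_ne huw) rfl)

lemma encard_between {u w : V} (h : P.Desc u w) :
    (P.between u w).encard = ((P.lev w - P.lev u : ℕ) : ℕ∞) := by
  refine Desc.induction (p := fun w => (P.between u w).encard = ((P.lev w - P.lev u : ℕ) : ℕ∞))
    ?_ ?_ h
  · simp [between_self]
  · intro w h hne ih
    rw [between_of_ne h hne, Set.encard_insert_of_notMem (not_mem_between_par h hne), ih]
    have := h.lt_of_ne hne
    rw [P.lev_par]
    norm_cast
    omega

lemma finite_between {u w : V} (h : P.Desc u w) : (P.between u w).Finite := by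
  rw [← Set.encard_lt_top_iff, encard_between h]
  exact ENat.natCast_lt_top _

lemma diff_subset {u w : V} (h : P.Desc u w) :
    P.Hom hypercube.Adj φ (P.between u w) →
      {i | φ u i ≠ φ w i} ⊆ P.dir φ '' P.between u w := by
  refine Desc.induction (p := fun w => P.Hom hypercube.Adj φ (P.between u w) →
      {i | φ u i ≠ φ w i} ⊆ P.dir φ '' P.between u w) ?_ ?_ h
  · intro _ i hi
    exact absurd rfl hi
  · intro w h hne ih hw i hi
    rw [between_of_ne h hne] at hw ⊢
    by_cases hp : φ (P.par w) i = φ w i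
    · have := ih (fun v hv => hw v (Set.mem_insert_of_mem _ hv)) (a := i)
        (by rw [Set.mem_ofPred_eq, hp]; exact hi)
      exact Set.image_mono (Set.subset_insert _ _) this
    · exact ⟨w, Set.mem_insert _ _,
        ((ne_iff_eq_coord (hw w (Set.mem_insert _ _)) i).1 hp).symm⟩

/-- With distinct directions no coordinate is flipped twice, so no flips cancel and the distance
equals the length of the path. -/
lemma diff_eq {u w : V} (h : P.Desc u w) :
    P.Hom hypercube.Adj φ (P.between u w) → Set.InjOn (P.dir φ) (P.between u w) →
      {i | φ u i ≠ φ w i} = P.dir φ '' P.between u w := by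
  refine Desc.induction (p := fun w => P.Hom hypercube.Adj φ (P.between u w) →
      Set.InjOn (P.dir φ) (P.between u w) →
      {i | φ u i ≠ φ w i} = P.dir φ '' P.between u w) ?_ ?_ h
  · intro _ _
    simp [between_self]
  · intro w h hne ih hw hinj
    have hsub := diff_subset h hw
    rw [between_of_ne h hne] at hw hinj hsub ⊢
    have ih' := ih (fun v hv => hw v (Set.mem_insert_of_mem _ hv))
      (hinj.mono (Set.subset_insert _ _))
    refine hsub.antisymm ?_
    have hww := fun i => ne_iff_eq_coord (hw w (Set.mem_insert _ _)) i
    have hnw : P.dir φ w ∉ P.dir φ '' P.between u (P.par w) := by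
      rintro ⟨x, hx, hxw⟩
      have := hinj (Set.mem_insert_of_mem _ hx) (Set.mem_insert _ _) hxw
      exact not_mem_between_par h hne (this ▸ hx)
    rintro i ⟨x, hx | hx, rfl⟩
    · subst hx
      have h1 := (hww (P.dir φ x)).2 rfl
      rw [← ih'] at hnw
      simp only [Set.mem_ofPred_eq, not_not] at hnw
      rw [Set.mem_ofPred_eq, hnw]
      exact h1
    · have h1 : P.dir φ x ∈ {i | φ u i ≠ φ (P.par w) i} := by
        rw [ih']; exact ⟨x, hx, rfl⟩
      have h2 : φ (P.par w) (P.dir φ x) = φ w (P.dir φ x) := by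
        by_contra hc
        have := (hww _).1 hc
        exact hnw ⟨x, hx, this⟩
      rw [Set.mem_ofPred_eq, ← h2]
      exact h1

lemma encard_diff_le {u w : V} (h : P.Desc u w)
    (hw : P.Hom hypercube.Adj φ (P.between u w)) :
    {i | φ u i ≠ φ w i}.encard ≤ ((P.lev w - P.lev u : ℕ) : ℕ∞) := by
  rw [← encard_between h]
  exact (Set.encard_le_encard (diff_subset h hw)).trans (Set.encard_image_le _ _)

lemma encard_diff_eq {u w : V} (h : P.Desc u w)
    (hw : P.Hom hypercube.Adj φ (P.between u w)) (hinj : Set.InjOn (P.dir φ) (P.between u w)) :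
    {i | φ u i ≠ φ w i}.encard = ((P.lev w - P.lev u : ℕ) : ℕ∞) := by
  rw [diff_eq h hw hinj, hinj.encard_image, encard_between h]

lemma agree_of_not_mem {u w : V} (h : P.Desc u w)
    (hw : P.Hom hypercube.Adj φ (P.between u w)) {i : ℕ}
    (hi : ∀ x ∈ P.between u w, P.dir φ x ≠ i) : φ u i = φ w i := by
  by_contra hc
  obtain ⟨x, hx, hxi⟩ := diff_subset h hw hc
  exact hi x hx hxi

lemma col_congr {κ : Cube → Cube → C} {v : V} (h : φ v = ψ v)
    (hp : φ (P.par v) = ψ (P.par v)) : P.col κ φ v = P.col κ ψ v := by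
  rw [col, col, h, hp]

lemma dir_congr {v : V} (h : φ v = ψ v) (hp : φ (P.par v) = ψ (P.par v)) :
    P.dir φ v = P.dir ψ v := by
  rw [dir, dir, h, hp]

lemma Hom.mono {H H' : Cube → Cube → Prop} {X X' : Set V} (h : P.Hom H φ X) (hX : X' ⊆ X)
    (hH : ∀ x y, H x y → H' x y) : P.Hom H' φ X' :=
  fun v hv => hH _ _ (h v (hX hv))

end Ranked

/-! ### The extension property and greedy extension -/

namespace Ranked

variable {V : Type*} {P : Ranked V} {C : Type*} {S : Finset V} {r c : V} {φ : V → Cube}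

variable (P C) in
/-- The extension theorem for the subtree `S` with root `r`. -/
def ExtensionProperty (S : Finset V) (r : V) : Prop :=
  ∀ (H : Cube → Cube → Prop) (κ : Cube → Cube → C) (U : Set Cube) (φ : V → Cube) (z : Cube),
    IsColored H κ → HasDeg U H (S.card - 1) → φ r ∈ U →
    P.Hom H φ ((P.half S (P.lev r)).erase r : Finset V) →
    Set.InjOn (P.col κ φ) ((P.half S (P.lev r)).erase r : Finset V) →
    Set.InjOn (P.dir φ) ((P.half S (P.lev r)).erase r : Finset V) →
    hypercube.Adj (φ r) z → ¬ H (φ r) z →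
    (∀ v ∈ (P.half S (P.lev r)).erase r, P.dir φ v ≠ coord s(φ r, z)) →
    ∃ Φ : V → Cube, (∀ v ∈ P.half S (P.lev r), Φ v = φ v) ∧
      P.Hom H Φ (S.erase r : Finset V) ∧
      Set.InjOn (P.col κ Φ) (S.erase r : Finset V) ∧
      Set.InjOn Φ (S : Set V) ∧ (∀ v ∈ S, Φ v ≠ z) ∧
      ∀ v ∈ P.half S (P.lev r + 1), Set.InjOn (P.dir Φ) (P.between r v)

lemma col_update {κ : Cube → Cube → C} {x v : V} {y : Cube} (h : v ≠ x) (hp : P.par v ≠ x) :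
    P.col κ (Function.update φ x y) v = P.col κ φ v :=
  col_congr (Function.update_of_ne h _ _) (Function.update_of_ne hp _ _)

lemma dir_update {x v : V} {y : Cube} (h : v ≠ x) (hp : P.par v ≠ x) :
    P.dir (Function.update φ x y) v = P.dir φ v :=
  dir_congr (Function.update_of_ne h _ _) (Function.update_of_ne hp _ _)

lemma col_update_self {κ : Cube → Cube → C} {x : V} {y : Cube} (hp : P.par x ≠ x) :
    P.col κ (Function.update φ x y) x = κ (φ (P.par x)) y := by
  rw [col, Function.update_self, Function.update_of_ne hp]

lemma dir_update_self {x : V} {y : Cube} (hp : P.par x ≠ x) :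
    P.dir (Function.update φ x y) x = coord s(φ (P.par x), y) := by
  rw [dir, Function.update_self, Function.update_of_ne hp]

lemma hom_update {H : Cube → Cube → Prop} {Z : Set V} {x : V} {y : Cube} (hZ : P.Hom H φ Z)
    (hx : x ∉ Z) (hpZ : ∀ v ∈ Z, P.par v ≠ x) (hp : P.par x ≠ x) (hy : H (φ (P.par x)) y) :
    P.Hom H (Function.update φ x y) (insert x Z) := by
  rintro v (rfl | hv)
  · rw [Function.update_self, Function.update_of_ne hp]
    exact hy
  · have hvx : v ≠ x := fun h => hx (h ▸ hv)
    rw [Function.update_of_ne hvx, Function.update_of_ne (hpZ v hv)]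
    exact hZ v hv

lemma injOn_col_update {κ : Cube → Cube → C} {Z : Set V} {x : V} {y : Cube}
    (hZ : Set.InjOn (P.col κ φ) Z)
    (hx : x ∉ Z) (hpZ : ∀ v ∈ Z, P.par v ≠ x) (hp : P.par x ≠ x)
    (hy : κ (φ (P.par x)) y ∉ P.col κ φ '' Z) :
    Set.InjOn (P.col κ (Function.update φ x y)) (insert x Z) := by
  have h : Set.EqOn (P.col κ (Function.update φ x y)) (P.col κ φ) Z := fun v hv =>
    col_update (fun h => hx (h ▸ hv)) (hpZ v hv)
  rw [Set.injOn_insert hx, h.injOn_iff, h.image_eq, col_update_self hp]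
  exact ⟨hZ, hy⟩

lemma injOn_dir_update {Z : Set V} {x : V} {y : Cube} (hZ : Set.InjOn (P.dir φ) Z)
    (hx : x ∉ Z) (hpZ : ∀ v ∈ Z, P.par v ≠ x) (hp : P.par x ≠ x)
    (hy : coord s(φ (P.par x), y) ∉ P.dir φ '' Z) :
    Set.InjOn (P.dir (Function.update φ x y)) (insert x Z) := by
  have h : Set.EqOn (P.dir (Function.update φ x y)) (P.dir φ) Z := fun v hv =>
    dir_update (fun h => hx (h ▸ hv)) (hpZ v hv)
  rw [Set.injOn_insert hx, h.injOn_iff, h.image_eq, dir_update_self hp]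
  exact ⟨hZ, hy⟩

lemma IsSubtree.par_ne {x : V} (hS : P.IsSubtree S r) (hx : x ∈ S) (hne : x ≠ r) :
    P.par x ≠ x := by
  intro h
  have := hS.lev_par_add hx hne
  rw [h] at this
  omega

/-- A doubly distinct homomorphism of a subtree extends greedily to a larger subtree `X` as long
as `X` has few edges. -/
lemma exists_doublyDistinct {H : Cube → Cube → Prop} {κ : Cube → Cube → C} {U : Set Cube} {n : ℕ}
    (hH : IsColored H κ) (hU : HasDeg U H n) {F : Finset V} (hF : P.IsSubtree F r) {z : Cube}
    (hr : φ r ∈ U) (hhom : P.Hom H φ (F.erase r : Finset V))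
    (hcol : Set.InjOn (P.col κ φ) (F.erase r : Finset V))
    (hdir : Set.InjOn (P.dir φ) (F.erase r : Finset V)) (hz : ¬ H (φ r) z)
    (hadj : hypercube.Adj (φ r) z)
    (hzd : ∀ v ∈ F.erase r, P.dir φ v ≠ coord s(φ r, z)) :
    ∀ (m : ℕ) (X : Finset V), X.card = m → P.IsSubtree X r → F ⊆ X → 2 * (X.card - 2) < n →
    ∃ ψ : V → Cube, (∀ v ∈ F, ψ v = φ v) ∧ P.Hom H ψ (X.erase r : Finset V) ∧
      Set.InjOn (P.col κ ψ) (X.erase r : Finset V) ∧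
      Set.InjOn (P.dir ψ) (X.erase r : Finset V) ∧
      ∀ v ∈ X.erase r, P.dir ψ v ≠ coord s(φ r, z) := by
  intro m
  induction m with
  | zero =>
    intro X hX hXr
    rw [Finset.card_eq_zero] at hX
    exact absurd hXr.root_mem (by simp [hX])
  | succ m ih =>
    intro X hXm hX hFX hn
    by_cases hXF : X ⊆ F
    · have : X = F := hXF.antisymm hFX
      subst this
      exact ⟨φ, fun _ _ => rfl, hhom, hcol, hdir, hzd⟩
    -- A missing vertex of greatest level has no child in `X`: a missing child would have a greater
    -- level, and a child in `F` would force `x` into `F`.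
    obtain ⟨x, hx, hmax⟩ := (X \ F).exists_max_image P.lev (Finset.sdiff_nonempty.2 hXF)
    rw [Finset.mem_sdiff] at hx
    have hxr : x ≠ r := fun h => hx.2 (h ▸ hF.root_mem)
    have hchild : ∀ v ∈ X, v ≠ r → P.par v ≠ x := by
      intro v hv hvr hpv
      have hl := hX.lev_par_add hv hvr
      by_cases hvF : v ∈ F
      · exact hx.2 (hpv ▸ hF.par_mem v hvF hvr)
      · have := hmax v (Finset.mem_sdiff.2 ⟨hv, hvF⟩)
        rw [hpv] at hl
        omega
    have hpx := hX.par_ne hx.1 hxr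
    have hX' : P.IsSubtree (X.erase x) r :=
      { root_mem := Finset.mem_erase.2 ⟨hxr.symm, hX.root_mem⟩
        par_mem := fun v hv hvr => by
          have hv := Finset.mem_of_mem_erase hv
          exact Finset.mem_erase.2 ⟨hchild v hv hvr, hX.par_mem v hv hvr⟩
        lt := fun v hv => hX.lt v (Finset.mem_of_mem_erase hv) }
    have hcard := Finset.card_erase_of_mem hx.1
    obtain ⟨ψ, h1, h2, h3, h4, h5⟩ := ih (X.erase x) (by omega) hX'
      (fun v hv => Finset.mem_erase.2 ⟨fun h => hx.2 (h ▸ hv), hFX hv⟩) (by omega)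
    set Z := (X.erase x).erase r with hZ
    have hZcard : Z.card = X.card - 2 := by
      rw [hZ, Finset.card_erase_of_mem hX'.root_mem, hcard]; omega
    have hXZ : X.erase r = insert x Z := by
      ext v
      simp only [hZ, Finset.mem_insert, Finset.mem_erase]
      constructor
      · rintro ⟨a, b⟩
        by_cases hvx : v = x
        · exact Or.inl hvx
        · exact Or.inr ⟨a, hvx, b⟩
      · rintro (rfl | ⟨a, b, c⟩)
        · exact ⟨hxr, hx.1⟩
        · exact ⟨a, c⟩
    have hxZ : x ∉ Z := by simp [hZ]
    have hpZ : ∀ v ∈ Z, P.par v ≠ x := by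
      intro v hv
      simp only [hZ, Finset.mem_erase] at hv
      exact hchild v hv.2.2 hv.1
    have hψr : ψ r = φ r := h1 r hF.root_mem
    have hpX' : P.par x ∈ X.erase x :=
      Finset.mem_erase.2 ⟨hpx, hX.par_mem x hx.1 hxr⟩
    have hnext : ∃ y, H (ψ (P.par x)) y ∧ κ (ψ (P.par x)) y ∉ Z.image (P.col κ ψ) ∧
        coord s(ψ (P.par x), y) ∉ Z.image (P.dir ψ) ∧
        coord s(ψ (P.par x), y) ≠ coord s(φ r, z) := by
      have hc1 : (Z.image (P.col κ ψ)).card ≤ Z.card := Finset.card_image_le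
      have hc2 : (Z.image (P.dir ψ)).card ≤ Z.card := Finset.card_image_le
      -- At the root the direction of `z` is avoided for free, because the edge to `z` is not in
      -- `H`.
      by_cases hpr : P.par x = r
      · rw [hpr, hψr]
        obtain ⟨y, hy1, hy2, hy3⟩ := hU.exists_next hH hr (Z.image (P.col κ ψ))
          (Z.image (P.dir ψ)) (by omega)
        refine ⟨y, hy1, hy2, hy3, fun h => hz ?_⟩
        rwa [← eq_of_coord_eq (hH.cube hy1) hadj h]
      -- Elsewhere the direction of `z` is one more forbidden element. The edge back to the next
      -- ancestor compensates for it, being forbidden both by color and by direction.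
      · have hpZ' : P.par x ∈ Z := Finset.mem_erase.2 ⟨hpr, hpX'⟩
        have hedge := h2 _ hpZ'
        obtain ⟨y, hy1, hy2, hy3⟩ := hU.exists_next_of_back hH (hU.mem hedge) (hH.symm hedge)
          (Z.image (P.col κ ψ)) (insert (coord s(φ r, z)) (Z.image (P.dir ψ)))
          (by
            rw [hH.col_symm]
            exact Finset.mem_image_of_mem _ hpZ')
          (by
            refine Finset.mem_insert_of_mem ?_
            rw [Sym2.eq_swap]
            exact Finset.mem_image_of_mem (P.dir ψ) hpZ')
          (by
            have := Finset.card_insert_le (coord s(φ r, z)) (Z.image (P.dir ψ))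
            omega)
        rw [Finset.mem_insert, not_or] at hy3
        exact ⟨y, hy1, hy2, hy3.2, hy3.1⟩
    obtain ⟨y, hy1, hy2, hy3, hy4⟩ := hnext
    refine ⟨Function.update ψ x y, ?_, ?_, ?_, ?_, ?_⟩
    · intro v hv
      rw [Function.update_of_ne (show v ≠ x from fun h => hx.2 (h ▸ hv)), h1 v hv]
    · rw [hXZ, Finset.coe_insert]
      exact hom_update h2 (by exact_mod_cast hxZ) (by exact_mod_cast hpZ) hpx hy1
    · rw [hXZ, Finset.coe_insert]
      refine injOn_col_update h3 (by exact_mod_cast hxZ) (by exact_mod_cast hpZ) hpx ?_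
      rw [← Finset.coe_image]
      exact_mod_cast hy2
    · rw [hXZ, Finset.coe_insert]
      refine injOn_dir_update h4 (by exact_mod_cast hxZ) (by exact_mod_cast hpZ) hpx ?_
      rw [← Finset.coe_image]
      exact_mod_cast hy3
    · intro v hv
      rw [hXZ, Finset.mem_insert] at hv
      rcases hv with rfl | hv
      · rwa [dir_update_self hpx]
      · rw [dir_update (show v ≠ x from fun h => hxZ (h ▸ hv)) (hpZ v hv)]
        exact h5 v hv

lemma IsSubtree.between_subset (hS : P.IsSubtree S r) {u w : V} (hu : u ∈ S) (hw : w ∈ S) :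
    P.between u w ⊆ (S.erase r : Finset V) := by
  rintro x ⟨h1, h2, h3⟩
  have hl := h1.lt_of_ne h2.symm
  have hl' := hS.le_lev hu
  rw [Finset.mem_coe, Finset.mem_erase]
  refine ⟨by rintro rfl; omega, hS.mem_of_desc hw h3 (by omega)⟩

/-- A vertex that is far from the root along directions other than that of `z` is not mapped
to `z`. -/
lemma ne_of_dir_ne {u w : V} {z : Cube} (hru : P.Desc r u) (huw : P.Desc u w)
    (hhom : P.Hom hypercube.Adj φ (P.between r w)) (hinj : Set.InjOn (P.dir φ) (P.between r u))
    (hadj : hypercube.Adj (φ r) z) (hd : ∀ x ∈ P.between r u, P.dir φ x ≠ coord s(φ r, z))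
    (hl : P.lev w - P.lev u ≤ P.lev u - P.lev r) : φ w ≠ z := by
  intro hwz
  have hhu : P.Hom hypercube.Adj φ (P.between r u) :=
    fun x hx => hhom x ⟨hx.1, hx.2.1, hx.2.2.trans huw⟩
  have hhw : P.Hom hypercube.Adj φ (P.between u w) := fun x hx => hhom x ⟨hru.trans hx.1, by
    rintro rfl
    have h1 := hx.1.lt_of_ne hx.2.1.symm
    have h2 := hru.le
    omega, hx.2.2⟩
  have h1 := diff_eq hru hhu hinj
  have hnot : coord s(φ r, z) ∉ {i | φ r i ≠ φ u i} := by
    rw [h1]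
    rintro ⟨x, hx, he⟩
    exact hd x hx he
  -- If `w` were mapped to `z`, its image would differ from that of `u` in all directions of the
  -- path from `r` to `u` and in the direction of `z`. These are more coordinates than the path from
  -- `u` to `w` can change.
  have hsub : insert (coord s(φ r, z)) {i | φ r i ≠ φ u i} ⊆ {i | φ u i ≠ φ w i} := by
    rw [hwz]
    rintro i (rfl | hi)
    · have e1 : φ r (coord s(φ r, z)) = φ u (coord s(φ r, z)) := by
        by_contra hc
        exact hnot hc
      rw [Set.mem_ofPred_eq, ← e1]
      exact (ne_iff_eq_coord hadj _).2 rfl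
    · have e1 : φ r i = z i := by
        by_contra hc
        exact hnot (((ne_iff_eq_coord hadj i).1 hc) ▸ hi)
      rw [Set.mem_ofPred_eq, ← e1]
      exact Ne.symm hi
  have h2 := (Set.encard_le_encard hsub).trans (encard_diff_le huw hhw)
  rw [Set.encard_insert_of_notMem hnot, encard_diff_eq hru hhu hinj] at h2
  have h3 : (P.lev u - P.lev r) + 1 ≤ P.lev w - P.lev u := by exact_mod_cast h2
  omega

end Ranked

/-! ### Splitting off a branch -/

namespace Ranked

variable {V : Type*} {P : Ranked V} {C : Type*} {S : Finset V} {r c : V}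

lemma IsSubtree.not_desc_par (hS : P.IsSubtree S r) {c : V} (hc : c ∈ S) (hcr : c ≠ r) :
    P.par c ∈ S \ P.below S c := by
  rw [Finset.mem_sdiff, mem_below]
  refine ⟨hS.par_mem c hc hcr, fun h => ?_⟩
  have := hS.lev_par_add hc hcr
  have := h.2.le
  omega

/-- If the branch at `c` has twice as many vertices as its upper half, then the extension theorem
for the branch and for the remaining tree imply it for the whole tree. -/
lemma extensionProperty_of_split (hS : P.IsSubtree S r) (hc : c ∈ S) (hcr : c ≠ r)
    (h1 : ∀ x ∈ S \ P.below S c, P.Desc x c → x ∈ P.half (S \ P.below S c) (P.lev r))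
    (h2 : 2 * (P.half S (P.lev c) ∩ P.below S c).card ≤ (P.below S c).card ∨
      (S \ P.below S c).card = 1)
    (hA : P.ExtensionProperty C (S \ P.below S c) r)
    (hB : P.ExtensionProperty C (P.below S c) c) : P.ExtensionProperty C S r := by
  intro H κ U φ z hH hU hr hhom hcol hdir hadj hz hzd
  set A := S \ P.below S c with hAdef
  set B := P.below S c with hBdef
  set Q := P.half S (P.lev c) ∩ B with hQ
  set v := P.par c with hv
  have hSA : P.IsSubtree A r := hS.sdiff_isSubtree hc hcr
  have hSB : P.IsSubtree B c := hS.below_isSubtree hc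
  have hvA : v ∈ A := hS.not_desc_par hc hcr
  have hlc : P.lev c = P.lev v + 1 := hS.lev_par_add hc hcr
  have hrv : P.lev r ≤ P.lev v := hSA.le_lev hvA
  have hvc : P.Desc v c := hS.desc_par' hc hcr
  have hABd : Disjoint A B := Finset.sdiff_disjoint
  have hnB : ∀ x ∈ A, x ∉ B := fun x hx => (Finset.mem_sdiff.1 hx).2
  have hAS : ∀ x ∈ A, x ∈ S := fun x hx => (Finset.mem_sdiff.1 hx).1
  have hBS : ∀ x ∈ B, x ∈ S := fun x hx => below_subset hx
  have hcases : ∀ x ∈ S, x ∈ A ∨ x ∈ B := fun x hx => by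
    by_cases h : x ∈ B
    · exact Or.inr h
    · exact Or.inl (Finset.mem_sdiff.2 ⟨hx, h⟩)
  have hBr : ∀ x ∈ B, x ≠ r := fun x hx h => hnB r hSA.root_mem (h ▸ hx)
  have hhalfA : ∀ t, P.lev r ≤ t → P.half A t = P.half S t ∩ A := fun t ht =>
    half_sdiff ht h1
  have hhalfB : ∀ t, P.half B t = P.half S t ∩ B := fun t => half_below t
  have hQB : ∀ x ∈ Q, x ∈ B := fun x hx => (Finset.mem_inter.1 hx).2
  have hvhalf : v ∈ P.half A (P.lev r) := h1 v hvA hvc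
  have hcQ : c ∈ Q := Finset.mem_inter.2
    ⟨mem_half.2 ⟨hc, by have := lev_le_top (P := P) hc; omega⟩, hSB.root_mem⟩
  have hQtree : P.IsSubtree Q c := by
    rw [hQ, ← hhalfB]
    exact hSB.half_isSubtree le_rfl
  set F := P.half S (P.lev r) with hF
  -- The floor halves of the remaining tree and of the branch. Their union is connected because `v`
  -- lies in the former and `c` in the latter.
  set X := P.half A (P.lev r) ∪ Q with hX
  have hFX : F ⊆ X := by
    intro x hx
    rw [hX, Finset.mem_union]
    rcases hcases x (half_subset hx) with h | h
    · exact Or.inl (by rw [hhalfA _ le_rfl]; exact Finset.mem_inter.2 ⟨hx, h⟩)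
    · exact Or.inr (Finset.mem_inter.2 ⟨half_mono (by omega) hx, h⟩)
  have hXS : X ⊆ S := by
    intro x hx
    rcases Finset.mem_union.1 hx with h | h
    · exact hAS x (half_subset h)
    · exact hBS x (hQB x h)
  have hXtree : P.IsSubtree X r :=
    { root_mem := Finset.mem_union_left _ (hSA.root_mem_half le_rfl)
      par_mem := by
        intro x hx hxr
        rcases Finset.mem_union.1 hx with h | h
        · exact Finset.mem_union_left _ ((hSA.half_isSubtree le_rfl).par_mem x h hxr)
        · by_cases hxc : x = c
          · rw [hxc]
            exact Finset.mem_union_left _ hvhalf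
          · exact Finset.mem_union_right _ (hQtree.par_mem x h hxc)
      lt := fun x hx => hS.lt x (hXS hx) }
  have hcardS : S.card = A.card + B.card := by
    rw [hAdef, Finset.card_sdiff_of_subset below_subset]
    have : B.card ≤ S.card := Finset.card_le_card below_subset
    change S.card = S.card - B.card + B.card
    omega
  have hcardX : X.card = (P.half A (P.lev r)).card + Q.card := by
    rw [hX, Finset.card_union_of_disjoint]
    exact hABd.mono half_subset Finset.inter_subset_right
  have hc1 := hSA.two_mul_card_half_le_card
  have hc2 : 2 * Q.card ≤ B.card + 1 := hS.card_half_below_le hc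
  have hc3 : 0 < (P.half A (P.lev r)).card :=
    Finset.card_pos.2 ⟨r, hSA.root_mem_half le_rfl⟩
  have hc4 : 0 < Q.card := Finset.card_pos.2 ⟨c, hcQ⟩
  have hc5 := Finset.card_le_card (half_subset : P.half A (P.lev r) ⊆ A)
  have hc6 : 0 < B.card := Finset.card_pos.2 ⟨c, hSB.root_mem⟩
  -- By the estimates for the two halves, 2(|X| - 2) ≤ (|A| - 1) + (|B| - 1) = |S| - 2.
  obtain ⟨ψ, hψφ, hψhom, hψcol, hψdir, hψz⟩ := exists_doublyDistinct hH hU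
    (hS.half_isSubtree le_rfl) hr hhom hcol hdir hz hadj hzd X.card X rfl hXtree hFX (by omega)
  have hψr : ψ r = φ r := hψφ r (hS.root_mem_half le_rfl)
  have hQX : ∀ x ∈ Q, x ∈ X.erase r := fun x hx =>
    Finset.mem_erase.2 ⟨hBr x (hQB x hx), Finset.mem_union_right _ hx⟩
  have hAX : ∀ x ∈ P.half A (P.lev r), x ≠ r → x ∈ X.erase r := fun x hx hxr =>
    Finset.mem_erase.2 ⟨hxr, Finset.mem_union_left _ hx⟩
  have hAXsub : (((P.half A (P.lev r)).erase r : Finset V) : Set V) ⊆ (X.erase r : Finset V) := by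
    intro x hx
    exact hAX x (Finset.mem_of_mem_erase hx) (Finset.ne_of_mem_erase hx)
  -- the extension on the remaining tree
  have hHA := hH.del (Q.image (P.col κ ψ)) (Q.image (P.dir ψ)) ∅
  have hUA := hU.del hH (Q.image (P.col κ ψ)) (Q.image (P.dir ψ)) ∅
  have hi1 : (Q.image (P.col κ ψ)).card ≤ Q.card := Finset.card_image_le
  have hi2 : (Q.image (P.dir ψ)).card ≤ Q.card := Finset.card_image_le
  have hnotQ : ∀ x ∈ (P.half A (P.lev r)).erase r, ∀ q ∈ Q, q ≠ x := by
    rintro x hx q hq rfl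
    exact hnB q (half_subset (Finset.mem_of_mem_erase hx)) (hQB q hq)
  -- The deletions cost at most 2|Q| ≤ |B|, which leaves degree |A| - 1. If `A` is only the root, no
  -- degree is needed.
  obtain ⟨ΦA, hA1, hA2, hA3, hA4, hA5, hA6⟩ := hA _ κ _ ψ z hHA
    (hUA.mono (by rw [Finset.card_empty]; omega)) (by rw [hψr]; simpa using hr)
    (by
      intro x hx
      have hx' : x ∈ X.erase r := hAX x (Finset.mem_of_mem_erase hx) (Finset.ne_of_mem_erase hx)
      refine ⟨hψhom x hx', fun h => ?_, fun h => ?_, Finset.notMem_empty _, Finset.notMem_empty _⟩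
      · obtain ⟨q, hq, he⟩ := Finset.mem_image.1 h
        exact hnotQ x hx q hq (hψcol (hQX q hq) hx' he)
      · obtain ⟨q, hq, he⟩ := Finset.mem_image.1 h
        exact hnotQ x hx q hq (hψdir (hQX q hq) hx' he))
    (hψcol.mono hAXsub)
    (hψdir.mono hAXsub)
    (hψr ▸ hadj) (fun h => hz (hψr ▸ h.1))
    (fun x hx => hψr ▸ hψz x (hAX x (Finset.mem_of_mem_erase hx) (Finset.ne_of_mem_erase hx)))
  -- the extension on the branch
  have hcX : c ∈ X.erase r := hQX c hcQ
  -- Deleting the color of the edge from `v` to `c` lets the image of `v` serve as bad vertex for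
  -- the branch. At most |A| colors are deleted, which leaves degree |B| - 1.
  set Γ := insert (P.col κ ψ c) ((A.erase r).image (P.col κ ΦA)) with hΓ
  have hΓc : Γ.card ≤ A.card := by
    have e1 : Γ.card ≤ _ :=
      Finset.card_insert_le (P.col κ ψ c) ((A.erase r).image (P.col κ ΦA))
    have e2 : ((A.erase r).image (P.col κ ΦA)).card ≤ (A.erase r).card := Finset.card_image_le
    rw [Finset.card_erase_of_mem hSA.root_mem] at e2
    have : 0 < A.card := hc3.trans_le hc5
    omega
  have hHB := hH.del Γ ∅ ∅
  have hUB := hU.del hH Γ ∅ ∅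
  have hcU : ψ c ∈ U := hU.mem (hψhom c hcX)
  have hhB : P.half B (P.lev c) = Q := hhalfB _
  have hEc : ∀ x ∈ Q.erase c, x ∈ X.erase r := fun x hx => hQX x (Finset.mem_of_mem_erase hx)
  obtain ⟨ΦB, hB1, hB2, hB3, hB4, hB5, hB6⟩ := hB _ κ _ ψ (ψ v) hHB
    (hUB.mono (by simp only [Finset.card_empty]; omega)) (by simpa using hcU)
    (by
      rw [hhB]
      intro x hx
      have hx' : x ∈ X.erase r := hEc x hx
      refine ⟨hψhom x hx', fun h => ?_, Finset.notMem_empty _, Finset.notMem_empty _,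
        Finset.notMem_empty _⟩
      rw [hΓ, Finset.mem_insert] at h
      rcases h with h | h
      · exact Finset.ne_of_mem_erase hx (hψcol hx' hcX h)
      · obtain ⟨a, ha, he⟩ := Finset.mem_image.1 h
        refine (hA2 a ha).2.1 ?_
        rw [Finset.mem_image]
        exact ⟨x, Finset.mem_of_mem_erase hx, he.symm⟩)
    (by rw [hhB]; exact hψcol.mono (fun x hx => hEc x hx))
    (by rw [hhB]; exact hψdir.mono (fun x hx => hEc x hx))
    ((hH.cube (hψhom c hcX)).symm)
    (by
      intro h
      refine h.2.1 ?_
      rw [hH.col_symm]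
      exact Finset.mem_insert_self _ _)
    (by
      rw [hhB]
      intro x hx h
      rw [Sym2.eq_swap] at h
      exact Finset.ne_of_mem_erase hx (hψdir (hEc x hx) hcX h))
  rw [hhB] at hB1
  -- the union of both
  set Φ : V → Cube := fun x => if x ∈ B then ΦB x else ΦA x with hΦ
  have hΦA : ∀ x ∈ A, Φ x = ΦA x := fun x hx => by rw [hΦ]; exact if_neg (hnB x hx)
  have hΦB : ∀ x ∈ B, Φ x = ΦB x := fun x hx => by rw [hΦ]; exact if_pos hx
  have hΦX : ∀ x ∈ X, Φ x = ψ x := by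
    intro x hx
    rcases Finset.mem_union.1 hx with h | h
    · rw [hΦA x (half_subset h), hA1 x h]
    · rw [hΦB x (hQB x h), hB1 x h]
  have hparA : ∀ x ∈ A.erase r, Φ (P.par x) = ΦA (P.par x) := fun x hx =>
    hΦA _ (hSA.par_mem x (Finset.mem_of_mem_erase hx) (Finset.ne_of_mem_erase hx))
  have hparB : ∀ x ∈ B.erase c, Φ (P.par x) = ΦB (P.par x) := fun x hx =>
    hΦB _ (hSB.par_mem x (Finset.mem_of_mem_erase hx) (Finset.ne_of_mem_erase hx))
  have hΦA' : ∀ x ∈ A.erase r, Φ x = ΦA x := fun x hx => hΦA x (Finset.mem_of_mem_erase hx)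
  have hΦB' : ∀ x ∈ B.erase c, Φ x = ΦB x := fun x hx => hΦB x (Finset.mem_of_mem_erase hx)
  have hΦX' : ∀ x ∈ X.erase r, Φ x = ψ x := fun x hx => hΦX x (Finset.mem_of_mem_erase hx)
  have hparX : ∀ x ∈ X.erase r, Φ (P.par x) = ψ (P.par x) := fun x hx =>
    hΦX _ (hXtree.par_mem x (Finset.mem_of_mem_erase hx) (Finset.ne_of_mem_erase hx))
  have htri : ∀ x ∈ S.erase r, x ∈ A.erase r ∨ x ∈ B.erase c ∨ x = c := by
    intro x hx
    rw [Finset.mem_erase] at hx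
    rcases hcases x hx.2 with h | h
    · exact Or.inl (Finset.mem_erase.2 ⟨hx.1, h⟩)
    · by_cases hxc : x = c
      · exact Or.inr (Or.inr hxc)
      · exact Or.inr (Or.inl (Finset.mem_erase.2 ⟨hxc, h⟩))
  have hcolA : ∀ x ∈ A.erase r, P.col κ Φ x = P.col κ ΦA x := fun x hx =>
    col_congr (hΦA' x hx) (hparA x hx)
  have hcolB : ∀ x ∈ B.erase c, P.col κ Φ x = P.col κ ΦB x := fun x hx =>
    col_congr (hΦB' x hx) (hparB x hx)
  have hcolc : P.col κ Φ c = P.col κ ψ c := col_congr (hΦX' c hcX) (hparX c hcX)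
  have hHom : P.Hom H Φ (S.erase r : Finset V) := by
    intro x hx
    rcases htri x hx with h | h | rfl
    · rw [hΦA' x h, hparA x h]
      exact (hA2 x h).1
    · rw [hΦB' x h, hparB x h]
      exact (hB2 x h).1
    · rw [hΦX' x hcX, hparX x hcX]
      exact hψhom x hcX
  have hHomQ : P.Hom hypercube.Adj Φ (S.erase r : Finset V) :=
    hHom.mono subset_rfl fun _ _ => hH.cube
  have hdirX : Set.InjOn (P.dir Φ) (X.erase r : Finset V) := by
    intro x hx y hy hxy
    rw [dir_congr (hΦX' x hx) (hparX x hx), dir_congr (hΦX' y hy) (hparX y hy)] at hxy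
    exact hψdir hx hy hxy
  have hdirz : ∀ x ∈ X.erase r, P.dir Φ x ≠ coord s(Φ r, z) := by
    intro x hx
    rw [dir_congr (hΦX' x hx) (hparX x hx), hΦX r hXtree.root_mem, hψr]
    exact hψz x hx
  have hXbetween : ∀ u ∈ X, ∀ w ∈ X, P.between w u ⊆ (X.erase r : Finset V) :=
    fun u hu w hw => hXtree.between_subset hw hu
  -- vertices of the branch, compared with an ancestor in the upper half
  have hmid : ∀ w ∈ B, ∃ u ∈ Q, P.Desc u w ∧ P.Desc v u ∧
      P.lev w - P.lev u ≤ P.lev u - P.lev v := by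
    intro w hw
    have hcw := (mem_below.1 hw).2
    have hl := hcw.le
    -- The halfway vertex between `v` and `w`, rounded away from `v`: it still lies in `Q`, and it
    -- is no farther from `w` than from `v`.
    obtain ⟨u, hu, huw, hul⟩ := hSB.exists_anc_mem hw
      (l := P.lev v + (P.lev w - P.lev v + 1) / 2) (by omega) (by omega)
    have hvu : P.Desc v u := hvc.trans (mem_below.1 hu).2
    refine ⟨u, Finset.mem_inter.2 ⟨mem_half.2 ⟨hBS u hu, ?_⟩, hu⟩, huw, hvu, by omega⟩
    have := le_top (P := P) (hBS w hw) huw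
    omega
  have hclash : ∀ w ∈ B, ∀ a ∈ A, Φ w ≠ Φ a := by
    intro w hw a ha hwa
    obtain ⟨u, hu, huw, hvu, hl⟩ := hmid w hw
    have huX : u ∈ X := Finset.mem_union_right _ hu
    have hvX : v ∈ X := Finset.mem_union_left _ hvhalf
    have hb1 : P.between v u ⊆ (X.erase r : Finset V) := hXbetween u huX v hvX
    have hb1' : P.between v u ⊆ (S.erase r : Finset V) :=
      hS.between_subset (hXS hvX) (hXS huX)
    have hb2 : P.between u w ⊆ (S.erase r : Finset V) :=
      hS.between_subset (hXS huX) (hBS w hw)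
    have hd1 := diff_eq hvu (fun x hx => hHomQ x (hb1' hx)) (hdirX.mono hb1)
    have he1 := encard_diff_eq hvu (fun x hx => hHomQ x (hb1' hx)) (hdirX.mono hb1)
    have he2 := encard_diff_le huw (fun x hx => hHomQ x (hb2 hx))
    have hbQ : ∀ x ∈ P.between v u, x ∈ Q := by
      intro x hx
      refine hQtree.mem_of_desc hu hx.2.2 ?_
      have := hx.1.lt_of_ne hx.2.1.symm
      omega
    -- The remaining tree was embedded without the directions of `Q`, so its whole image is constant
    -- in these coordinates.
    have hagree : ∀ b ∈ A, ∀ q ∈ Q, Φ r (P.dir Φ q) = Φ b (P.dir Φ q) := by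
      intro b hb q hq
      have hbb : P.between r b ⊆ (A.erase r : Finset V) := hSA.between_subset hSA.root_mem hb
      have hbb' : P.between r b ⊆ (S.erase r : Finset V) :=
        hS.between_subset hS.root_mem (hAS b hb)
      refine agree_of_not_mem (hSA.root_desc hb) (fun x hx => hHomQ x (hbb' hx)) ?_
      intro x hx he
      have hx' := hbb hx
      rw [dir_congr (hΦA' x hx') (hparA x hx'),
        dir_congr (hΦX' q (hQX q hq)) (hparX q (hQX q hq))] at he
      refine (hA2 x hx').2.2.1 ?_
      rw [Finset.mem_image]
      exact ⟨q, hq, he.symm⟩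
    have hflip : {i | Φ u i ≠ Φ v i} = {i | Φ v i ≠ Φ u i} := by
      ext i
      exact ne_comm
    -- Where the images of `u` and `v` differ, the common point agrees with the image of `v`, and it
    -- is no farther from that of `u`. So it is the image of `v`, the bad vertex of the branch.
    have hwv : Φ w = Φ v := by
      refine eq_of_agree (p := Φ u) ?_ ?_ ?_
      · rw [hflip, hd1]
        exact (finite_between hvu).image _
      · intro i hi
        have : i ∈ P.dir Φ '' P.between v u := by
          rw [← hd1]
          exact Ne.symm hi
        obtain ⟨x, hx, rfl⟩ := this
        rw [hwa, ← hagree a ha x (hbQ x hx), ← hagree v hvA x (hbQ x hx)]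
      · rw [hflip, he1]
        exact he2.trans (by exact_mod_cast hl)
    rw [hΦB w hw, hΦX v hvX] at hwv
    exact hB5 w hw hwv
  refine ⟨Φ, ?_, hHom, ?_, ?_, ?_, ?_⟩
  · intro x hx
    rw [hΦX x (hFX hx), hψφ x hx]
  · have hAB : ∀ x ∈ A.erase r, ∀ y ∈ S.erase r, y ∉ A.erase r → P.col κ Φ x ≠ P.col κ Φ y := by
      intro x hx y hy hyA he
      rw [hcolA x hx] at he
      rcases htri y hy with h | h | rfl
      · exact hyA h
      · rw [hcolB y h] at he
        refine (hB2 y h).2.1 ?_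
        rw [hΓ, Finset.mem_insert, Finset.mem_image]
        exact Or.inr ⟨x, hx, he⟩
      · rw [hcolc] at he
        refine (hA2 x hx).2.1 ?_
        rw [Finset.mem_image]
        exact ⟨y, hcQ, he.symm⟩
    have hBc : ∀ x ∈ B.erase c, P.col κ Φ x ≠ P.col κ Φ c := by
      intro x hx he
      rw [hcolB x hx, hcolc] at he
      refine (hB2 x hx).2.1 ?_
      rw [hΓ, Finset.mem_insert]
      exact Or.inl he
    intro x hx y hy he
    by_cases hxA : x ∈ A.erase r
    · by_cases hyA : y ∈ A.erase r
      · rw [hcolA x hxA, hcolA y hyA] at he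
        exact hA3 hxA hyA he
      · exact absurd he (hAB x hxA y hy hyA)
    · by_cases hyA : y ∈ A.erase r
      · exact absurd he.symm (hAB y hyA x hx hxA)
      · rcases htri x hx with h | h | rfl
        · exact absurd h hxA
        · rcases htri y hy with h' | h' | rfl
          · exact absurd h' hyA
          · rw [hcolB x h, hcolB y h'] at he
            exact hB3 h h' he
          · exact absurd he (hBc x h)
        · rcases htri y hy with h' | h' | rfl
          · exact absurd h' hyA
          · exact absurd he.symm (hBc y h')
          · rfl
  · intro x hx y hy he
    rcases hcases x hx with h | h <;> rcases hcases y hy with h' | h'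
    · rw [hΦA x h, hΦA y h'] at he
      exact hA4 h h' he
    · exact absurd he.symm (hclash y h' x h)
    · exact absurd he (hclash x h y h')
    · rw [hΦB x h, hΦB y h'] at he
      exact hB4 h h' he
  · intro x hx
    rcases hcases x hx with h | h
    · rw [hΦA x h]
      exact hA5 x h
    · obtain ⟨u, hu, huw, hvu, hl⟩ := hmid x h
      have huX : u ∈ X := Finset.mem_union_right _ hu
      have hrX := hXtree.root_mem
      have hb := hXbetween u huX r hrX
      refine ne_of_dir_ne (hXtree.root_desc huX) huw
        (fun y hy => hHomQ y (hS.between_subset hS.root_mem hx hy)) (hdirX.mono hb) ?_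
        (fun y hy => hdirz y (hb hy)) (by omega)
      rw [hΦX r hrX, hψr]
      exact hadj
  · intro x hx
    rcases hcases x (half_subset hx) with h | h
    · have hx' : x ∈ P.half A (P.lev r + 1) := by
        rw [hhalfA _ (by omega)]
        exact Finset.mem_inter.2 ⟨hx, h⟩
      have hb : P.between r x ⊆ (A.erase r : Finset V) := hSA.between_subset hSA.root_mem h
      intro y hy w hw he
      rw [dir_congr (hΦA' y (hb hy)) (hparA y (hb hy)),
        dir_congr (hΦA' w (hb hw)) (hparA w (hb hw))] at he
      exact hA6 x hx' hy hw he
    -- Inside the branch the ceiling half of `S` is contained in `Q`, since `c` is above the root;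
    -- on `X` all directions are distinct.
    · have hxQ : x ∈ Q := Finset.mem_inter.2 ⟨half_mono (by omega) hx, h⟩
      exact hdirX.mono (hXbetween x (Finset.mem_union_right _ hxQ) r hXtree.root_mem)

end Ranked

/-! ### Spiders -/

namespace Ranked

variable {V : Type*} {P : Ranked V} {C : Type*} {S : Finset V} {r : V}

variable (P) in
/-- A spider: all branches at the root are paths, the branch at `c` having `2 * k c + 1` vertices
with middle vertex `w c`. -/
structure IsSpider (S : Finset V) (r : V) (k : V → ℕ) (w : V → V) : Prop where
  tree : P.IsSubtree S r
  card_below : ∀ c ∈ P.children S r, (P.below S c).card = 2 * k c + 1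
  mid_mem : ∀ c ∈ P.children S r, w c ∈ P.below S c
  lev_mid : ∀ c ∈ P.children S r, P.lev (w c) = P.lev r + k c + 1
  desc : ∀ c ∈ P.children S r, ∀ x ∈ P.below S c, ∀ y ∈ P.below S c, P.lev x ≤ P.lev y →
    P.Desc x y
  mem_floor : ∀ c ∈ P.children S r, ∀ x ∈ P.below S c,
    (x ∈ P.half S (P.lev r) ↔ P.lev x ≤ P.lev r + k c)
  mem_ceil : ∀ c ∈ P.children S r, ∀ x ∈ P.below S c,
    (x ∈ P.half S (P.lev r + 1) ↔ P.lev x ≤ P.lev r + k c + 1)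
  lev_le : ∀ c ∈ P.children S r, ∀ x ∈ P.below S c, P.lev x ≤ P.lev r + 2 * k c + 1
  card_floor : ∀ c ∈ P.children S r, (P.half S (P.lev r) ∩ P.below S c).card = k c

/-- With one vertex on each level the branch is a path, and its `2 * k + 1` vertices occupy
consecutive levels above the root. All of them have the same top, so the floor half takes the `k`
vertices nearest to the root and the ceiling half also the middle one. -/
lemma exists_spider_branch (hS : P.IsSubtree S r) {c : V} (hc : c ∈ P.children S r)
    (hinj : Set.InjOn P.lev (P.below S c : Set V)) (hodd : Odd (P.below S c).card) :
    ∃ (k : ℕ) (w : V), (P.below S c).card = 2 * k + 1 ∧ w ∈ P.below S c ∧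
      P.lev w = P.lev r + k + 1 ∧
      (∀ x ∈ P.below S c, ∀ y ∈ P.below S c, P.lev x ≤ P.lev y → P.Desc x y) ∧
      (∀ x ∈ P.below S c, (x ∈ P.half S (P.lev r) ↔ P.lev x ≤ P.lev r + k)) ∧
      (∀ x ∈ P.below S c, (x ∈ P.half S (P.lev r + 1) ↔ P.lev x ≤ P.lev r + k + 1)) ∧
      (∀ x ∈ P.below S c, P.lev x ≤ P.lev r + 2 * k + 1) ∧
      (P.half S (P.lev r) ∩ P.below S c).card = k := by
  obtain ⟨hcS, -, hcl⟩ := mem_children.1 hc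
  have hB := hS.below_isSubtree hcS
  obtain ⟨l, hlS, hcd, hl⟩ := exists_top (P := P) hcS
  have hlB : l ∈ P.below S c := mem_below.2 ⟨hlS, hcd⟩
  have hle : ∀ x ∈ P.below S c, P.lev x ≤ P.lev l := fun x hx =>
    hl ▸ le_top (below_subset hx) (mem_below.1 hx).2
  have hge : ∀ x ∈ P.below S c, P.lev r + 1 ≤ P.lev x := fun x hx => hcl ▸ (mem_below.1 hx).2.le
  have hdesc : ∀ x ∈ P.below S c, ∀ y ∈ P.below S c, P.lev x ≤ P.lev y → P.Desc x y := by
    intro x hx y hy hxy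
    obtain ⟨u, hu, huy, hul⟩ := hB.exists_anc_mem hy (l := P.lev x) (by
      have := hge x hx; omega) hxy
    rwa [← hinj hu hx hul]
  have htop : ∀ x ∈ P.below S c, P.top S x = P.lev l := by
    intro x hx
    exact le_antisymm (hl ▸ top_anti (mem_below.1 hx).2)
      (le_top hlS (hdesc x hx l hlB (hle x hx)))
  have hcount : ∀ m ≤ P.lev l, P.lev r ≤ m →
      ((P.below S c).filter fun x => P.lev x ≤ m).card = m - P.lev r := by
    intro m hm hrm
    have himg : ((P.below S c).filter fun x => P.lev x ≤ m).image P.lev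
        = Finset.Ioc (P.lev r) m := by
      ext j
      simp only [Finset.mem_image, Finset.mem_filter, Finset.mem_Ioc]
      constructor
      · rintro ⟨x, ⟨hx, hxm⟩, rfl⟩
        exact ⟨hge x hx, hxm⟩
      · rintro ⟨h1, h2⟩
        obtain ⟨u, hu, -, hul⟩ := hB.exists_anc_mem hlB (l := j) (by omega) (by omega)
        exact ⟨u, ⟨hu, by omega⟩, hul⟩
    rw [← Nat.card_Ioc, ← himg, Finset.card_image_of_injOn]
    intro x hx y hy h
    exact hinj (Finset.mem_filter.1 hx).1 (Finset.mem_filter.1 hy).1 h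
  have hrl : P.lev r + 1 ≤ P.lev l := hge l hlB
  have hall : (P.below S c).card = P.lev l - P.lev r := by
    rw [← hcount _ le_rfl (by omega)]
    congr 1
    exact (Finset.filter_true_of_mem fun x hx => hle x hx).symm
  obtain ⟨k, hk⟩ := hodd
  have hfl : ∀ x ∈ P.below S c, (x ∈ P.half S (P.lev r) ↔ P.lev x ≤ P.lev r + k) := by
    intro x hx
    rw [mem_half, htop x hx]
    exact ⟨fun h => by have := h.2; omega, fun h => ⟨below_subset hx, by omega⟩⟩
  obtain ⟨w, hw, -, hwl⟩ := hB.exists_anc_mem hlB (l := P.lev r + k + 1) (by omega) (by omega)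
  refine ⟨k, w, hk, hw, hwl, hdesc, hfl, ?_, ?_, ?_⟩
  · intro x hx
    rw [mem_half, htop x hx]
    exact ⟨fun h => by have := h.2; omega, fun h => ⟨below_subset hx, by omega⟩⟩
  · intro x hx
    have := hle x hx
    omega
  · have : P.half S (P.lev r) ∩ P.below S c
        = (P.below S c).filter fun x => P.lev x ≤ P.lev r + k := by
      ext x
      rw [Finset.mem_inter, Finset.mem_filter]
      exact ⟨fun h => ⟨h.2, (hfl x h.2).1 h.1⟩, fun h => ⟨(hfl x h.1).2 h.2, h.1⟩⟩
    rw [this, hcount _ (by omega) (by omega)]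
    omega

lemma exists_isSpider (hS : P.IsSubtree S r)
    (hinj : ∀ c ∈ P.children S r, Set.InjOn P.lev (P.below S c : Set V))
    (hodd : ∀ c ∈ P.children S r, Odd (P.below S c).card) :
    ∃ k w, P.IsSpider S r k w := by
  have h : ∀ c, ∃ (k : ℕ) (w : V), c ∈ P.children S r →
      (P.below S c).card = 2 * k + 1 ∧ w ∈ P.below S c ∧
      P.lev w = P.lev r + k + 1 ∧
      (∀ x ∈ P.below S c, ∀ y ∈ P.below S c, P.lev x ≤ P.lev y → P.Desc x y) ∧
      (∀ x ∈ P.below S c, (x ∈ P.half S (P.lev r) ↔ P.lev x ≤ P.lev r + k)) ∧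
      (∀ x ∈ P.below S c, (x ∈ P.half S (P.lev r + 1) ↔ P.lev x ≤ P.lev r + k + 1)) ∧
      (∀ x ∈ P.below S c, P.lev x ≤ P.lev r + 2 * k + 1) ∧
      (P.half S (P.lev r) ∩ P.below S c).card = k := by
    intro c
    by_cases hc : c ∈ P.children S r
    · obtain ⟨k, w, h⟩ := exists_spider_branch hS hc (hinj c hc) (hodd c hc)
      exact ⟨k, w, fun _ => h⟩
    · exact ⟨0, c, fun h => absurd h hc⟩
  choose k w h using h
  exact ⟨k, w, hS, fun c hc => (h c hc).1, fun c hc => (h c hc).2.1, fun c hc => (h c hc).2.2.1,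
    fun c hc => (h c hc).2.2.2.1, fun c hc => (h c hc).2.2.2.2.1,
    fun c hc => (h c hc).2.2.2.2.2.1, fun c hc => (h c hc).2.2.2.2.2.2.1,
    fun c hc => (h c hc).2.2.2.2.2.2.2⟩

lemma self_mem_below {c : V} (hc : c ∈ P.children S r) : c ∈ P.below S c :=
  mem_below.2 ⟨(mem_children.1 hc).1, Desc.refl c⟩

namespace IsSpider

variable {k : V → ℕ} {w : V → V} (hT : P.IsSpider S r k w)
include hT

/-- A branch exceeds twice its part of the floor half by one vertex. This slack of one per branch
pays for placing the middle vertices. -/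
lemma card_sub_one : S.card - 1 = 2 * ((P.half S (P.lev r)).erase r).card +
    (P.children S r).card := by
  rw [← hT.tree.sum_card_below, ← hT.tree.sum_card_inter_below half_subset, Finset.mul_sum,
    Finset.card_eq_sum_ones, ← Finset.sum_add_distrib]
  refine Finset.sum_congr rfl fun c hc => ?_
  rw [hT.card_below c hc, hT.card_floor c hc]

lemma mid_mem_ceil {c : V} (hc : c ∈ P.children S r) : w c ∈ P.half S (P.lev r + 1) :=
  (hT.mem_ceil c hc _ (hT.mid_mem c hc)).2 (hT.lev_mid c hc).le

lemma mid_not_mem_floor {c : V} (hc : c ∈ P.children S r) : w c ∉ P.half S (P.lev r) := by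
  rw [hT.mem_floor c hc _ (hT.mid_mem c hc), hT.lev_mid c hc]
  omega

lemma mid_ne_root {c : V} (hc : c ∈ P.children S r) : w c ≠ r := by
  intro h
  have := hT.lev_mid c hc
  rw [h] at this
  omega

lemma eq_mid {c x : V} (hc : c ∈ P.children S r) (hx : x ∈ P.below S c)
    (hl : P.lev x = P.lev r + k c + 1) : x = w c := by
  have h := hT.lev_mid c hc
  exact (hT.desc c hc x hx _ (hT.mid_mem c hc) (by omega)).eq_of_le (by omega)

/-- The vertices of the upper half of a branch. -/
lemma mem_ceil_iff {c x : V} (hc : c ∈ P.children S r) (hx : x ∈ P.below S c) :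
    x ∈ P.half S (P.lev r + 1) ↔ x ∈ P.half S (P.lev r) ∨ x = w c := by
  constructor
  · intro h
    have h1 := (hT.mem_ceil c hc x hx).1 h
    by_cases h2 : P.lev x ≤ P.lev r + k c
    · exact Or.inl ((hT.mem_floor c hc x hx).2 h2)
    · exact Or.inr (hT.eq_mid hc hx (by omega))
  · rintro (h | rfl)
    · exact half_mono (by omega) h
    · exact hT.mid_mem_ceil hc

lemma ceil_eq : (P.half S (P.lev r + 1)).erase r
    = (P.half S (P.lev r)).erase r ∪ (P.children S r).image w := by
  ext x
  rw [Finset.mem_union, Finset.mem_image, Finset.mem_erase, Finset.mem_erase]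
  constructor
  · rintro ⟨hxr, hx⟩
    obtain ⟨c, hc, hcx⟩ := hT.tree.exists_child (half_subset hx) hxr
    rcases (hT.mem_ceil_iff hc (mem_below.2 ⟨half_subset hx, hcx⟩)).1 hx with h | h
    · exact Or.inl ⟨hxr, h⟩
    · exact Or.inr ⟨c, hc, h.symm⟩
  · rintro (⟨hxr, h⟩ | ⟨c, hc, rfl⟩)
    · exact ⟨hxr, half_mono (by omega) h⟩
    · exact ⟨hT.mid_ne_root hc, hT.mid_mem_ceil hc⟩

lemma mid_injOn : Set.InjOn w (P.children S r : Set V) := by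
  intro c hc d hd h
  by_contra hne
  have := disjoint_below (S := S) ((mem_children.1 hc).2.2.trans (mem_children.1 hd).2.2.symm) hne
  exact Finset.disjoint_left.1 this (hT.mid_mem c hc) (h ▸ hT.mid_mem d hd)

lemma mid_eq_of_leaf {c : V} (hc : c ∈ P.children S r) (hk : k c = 0) : w c = c :=
  (hT.eq_mid hc (mem_below.2 ⟨(mem_children.1 hc).1, Desc.refl c⟩)
    (by rw [hk, (mem_children.1 hc).2.2])).symm

lemma mem_floor_of_not_leaf {c : V} (hc : c ∈ P.children S r) (hk : k c ≠ 0) :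
    c ∈ (P.half S (P.lev r)).erase r := by
  refine Finset.mem_erase.2 ⟨children_ne_root hc, ?_⟩
  rw [hT.mem_floor c hc c (self_mem_below hc), (mem_children.1 hc).2.2]
  omega

lemma par_mid_mem {c : V} (hc : c ∈ P.children S r) (hk : k c ≠ 0) :
    P.par (w c) ∈ (P.half S (P.lev r)).erase r := by
  have hl := hT.lev_mid c hc
  have hlp := P.lev_par (w c)
  have hB := hT.tree.below_isSubtree (mem_children.1 hc).1
  have hne : w c ≠ c := by
    intro h
    have := (mem_children.1 hc).2.2
    rw [h] at hl
    omega
  have hp := hB.par_mem _ (hT.mid_mem c hc) hne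
  refine Finset.mem_erase.2 ⟨by intro h; rw [h] at hlp; omega, ?_⟩
  rw [hT.mem_floor c hc _ hp]
  omega

lemma par_mid_mem_floor {c : V} (hc : c ∈ P.children S r) :
    P.par (w c) ∈ P.half S (P.lev r) := by
  by_cases hk : k c = 0
  · rw [hT.mid_eq_of_leaf hc hk, (mem_children.1 hc).2.1]
    exact hT.tree.root_mem_half le_rfl
  · exact Finset.mem_of_mem_erase (hT.par_mid_mem hc hk)

lemma below_leaf {c : V} (hc : c ∈ P.children S r) (hk : k c = 0) : P.below S c = {c} := by
  have h := hT.card_below c hc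
  rw [hk, Finset.card_eq_one] at h
  obtain ⟨a, ha⟩ := h
  have := self_mem_below hc
  rw [ha, Finset.mem_singleton] at this
  rw [ha, this]

end IsSpider

end Ranked

/-! ### Placing the middle vertices of the legs -/

namespace Ranked

variable {V : Type*} {P : Ranked V} {C : Type*} {S : Finset V} {r : V} {k : V → ℕ} {w : V → V}

variable (P) in
/-- `ψ` is a rainbow extension of `φ` to the middle vertices of the branches at `T`, and the new
edges have directions not used before. -/
structure MidExtension (S : Finset V) (r : V) (w : V → V) (H : Cube → Cube → Prop)
    (κ : Cube → Cube → C) (φ : V → Cube) (T : Finset V) (ψ : V → Cube) : Prop where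
  eq : ∀ v ∈ P.half S (P.lev r), ψ v = φ v
  hom : P.Hom H ψ ((P.half S (P.lev r)).erase r ∪ T.image w : Finset V)
  col : Set.InjOn (P.col κ ψ) ((P.half S (P.lev r)).erase r ∪ T.image w : Finset V)
  dir : ∀ c ∈ T, ∀ v ∈ (P.half S (P.lev r)).erase r, P.dir ψ (w c) ≠ P.dir ψ v

lemma card_union_image_le (D T : Finset V) (w : V → V) :
    (D ∪ T.image w).card ≤ D.card + T.card :=
  (Finset.card_union_le _ _).trans (by have := Finset.card_image_le (s := T) (f := w); omega)

namespace IsSpider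

variable (hT : P.IsSpider S r k w)
include hT

lemma par_ne_mid {v c : V} (hc : c ∈ P.children S r) {T : Finset V} (hTc : T ⊆ P.children S r)
    (hv : v ∈ (P.half S (P.lev r)).erase r ∪ T.image w) : P.par v ≠ w c := by
  intro h
  have hF := hT.tree.half_isSubtree (t := P.lev r) le_rfl
  have : P.par v ∈ P.half S (P.lev r) := by
    rcases Finset.mem_union.1 hv with hv | hv
    · exact hF.par_mem v (Finset.mem_of_mem_erase hv) (Finset.ne_of_mem_erase hv)
    · obtain ⟨d, hd, rfl⟩ := Finset.mem_image.1 hv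
      exact hT.par_mid_mem_floor (hTc hd)
  exact hT.mid_not_mem_floor hc (h ▸ this)

lemma mid_not_mem {c : V} (hc : c ∈ P.children S r) {T : Finset V} (hTc : T ⊆ P.children S r)
    (hcT : c ∉ T) : w c ∉ (P.half S (P.lev r)).erase r ∪ T.image w := by
  intro h
  rcases Finset.mem_union.1 h with h | h
  · exact hT.mid_not_mem_floor hc (Finset.mem_of_mem_erase h)
  · obtain ⟨d, hd, h⟩ := Finset.mem_image.1 h
    exact hcT (hT.mid_injOn (hTc hd) hc h ▸ hd)

variable {H : Cube → Cube → Prop} {κ : Cube → Cube → C} {φ ψ : V → Cube} {T : Finset V} {c : V}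

lemma midExtension_update (hψ : P.MidExtension S r w H κ φ T ψ) (hTc : T ⊆ P.children S r)
    (hc : c ∈ P.children S r) (hcT : c ∉ T) {y : Cube} (hy : H (ψ (P.par (w c))) y)
    (hcol : κ (ψ (P.par (w c))) y ∉
      ((P.half S (P.lev r)).erase r ∪ T.image w).image (P.col κ ψ))
    (hdir : coord s(ψ (P.par (w c)), y) ∉ ((P.half S (P.lev r)).erase r).image (P.dir ψ)) :
    P.MidExtension S r w H κ φ (insert c T) (Function.update ψ (w c) y) ∧
      (∀ b ∈ T, P.dir (Function.update ψ (w c) y) (w b) = P.dir ψ (w b)) ∧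
      P.dir (Function.update ψ (w c) y) (w c) = coord s(ψ (P.par (w c)), y) := by
  set Z := (P.half S (P.lev r)).erase r ∪ T.image w with hZ
  have hwZ : w c ∉ Z := hT.mid_not_mem hc hTc hcT
  have hpZ : ∀ v ∈ Z, P.par v ≠ w c := fun v hv => hT.par_ne_mid hc hTc hv
  have hpw : P.par (w c) ≠ w c := fun h =>
    hT.mid_not_mem_floor hc (h ▸ hT.par_mid_mem_floor hc)
  have hZi : (P.half S (P.lev r)).erase r ∪ (insert c T).image w = insert (w c) Z := by
    rw [Finset.image_insert, Finset.union_insert]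
  have hne : ∀ v ∈ Z, v ≠ w c := fun v hv h => hwZ (h ▸ hv)
  have hdirZ : ∀ v ∈ Z, P.dir (Function.update ψ (w c) y) v = P.dir ψ v := fun v hv =>
    dir_update (hne v hv) (hpZ v hv)
  have hDZ : ∀ v ∈ (P.half S (P.lev r)).erase r, v ∈ Z := fun v hv => Finset.mem_union_left _ hv
  have hTZ : ∀ b ∈ T, w b ∈ Z := fun b hb =>
    Finset.mem_union_right _ (Finset.mem_image_of_mem w hb)
  refine ⟨⟨?_, ?_, ?_, ?_⟩, fun b hb => hdirZ _ (hTZ b hb), dir_update_self hpw⟩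
  · intro v hv
    rw [Function.update_of_ne, hψ.eq v hv]
    rintro rfl
    exact hT.mid_not_mem_floor hc hv
  · rw [hZi, Finset.coe_insert]
    exact hom_update hψ.hom (by exact_mod_cast hwZ) (by exact_mod_cast hpZ) hpw hy
  · rw [hZi, Finset.coe_insert]
    refine injOn_col_update hψ.col (by exact_mod_cast hwZ) (by exact_mod_cast hpZ) hpw ?_
    rw [← Finset.coe_image]
    exact_mod_cast hcol
  · intro b hb v hv
    rw [hdirZ v (hDZ v hv)]
    rcases Finset.mem_insert.1 hb with rfl | hb
    · rw [dir_update_self hpw]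
      intro h
      exact hdir (Finset.mem_image.2 ⟨v, hv, h.symm⟩)
    · rw [hdirZ _ (hTZ b hb)]
      exact hψ.dir b hb v hv

variable {U : Set Cube}

/-- A middle vertex of a branch with more than one vertex can be added, avoiding some directions. -/
lemma exists_insert (hH : IsColored H κ) (hU : HasDeg U H (S.card - 1))
    (hψ : P.MidExtension S r w H κ φ T ψ) (hTc : T ⊆ P.children S r)
    (hc : c ∈ P.children S r) (hcT : c ∉ T) (hk : k c ≠ 0) (Δ : Finset ℕ)
    (hΔ : T.card + Δ.card ≤ (P.children S r).card) :
    ∃ ψ', P.MidExtension S r w H κ φ (insert c T) ψ' ∧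
      (∀ b ∈ T, P.dir ψ' (w b) = P.dir ψ (w b)) ∧ P.dir ψ' (w c) ∉ Δ := by
  set D := (P.half S (P.lev r)).erase r with hD
  have hp : P.par (w c) ∈ D := hT.par_mid_mem hc hk
  have hpZ : P.par (w c) ∈ D ∪ T.image w := Finset.mem_union_left _ hp
  have hedge := hψ.hom _ hpZ
  have hcard : S.card - 1 = 2 * D.card + (P.children S r).card := hT.card_sub_one
  have h1 := card_union_image_le D T w
  -- There are at most |D| + |T| forbidden colors and |D| + |Δ| forbidden directions, in total at
  -- most |S| - 1. This is enough because the edge back towards the root is counted twice.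
  obtain ⟨y, hy1, hy2, hy3⟩ := hU.exists_next_of_back hH (hU.mem hedge) (hH.symm hedge)
    ((D ∪ T.image w).image (P.col κ ψ)) (D.image (P.dir ψ) ∪ Δ)
    (by rw [hH.col_symm]; exact Finset.mem_image_of_mem _ hpZ)
    (by
      refine Finset.mem_union_left _ ?_
      rw [Sym2.eq_swap]
      exact Finset.mem_image_of_mem (P.dir ψ) hp)
    (by
      have h2 : ((D ∪ T.image w).image (P.col κ ψ)).card ≤ (D ∪ T.image w).card :=
        Finset.card_image_le
      have h3 := Finset.card_union_le (D.image (P.dir ψ)) Δ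
      have h4 : (D.image (P.dir ψ)).card ≤ D.card := Finset.card_image_le
      omega)
  rw [Finset.mem_union, not_or] at hy3
  obtain ⟨e1, e2, e3⟩ := hT.midExtension_update hψ hTc hc hcT hy1 hy2 hy3.1
  exact ⟨_, e1, e2, e3 ▸ hy3.2⟩

/-- A leaf adjacent to the root can be added, avoiding the directions used at the middle of all
branches. -/
lemma exists_insert_leaf (hH : IsColored H κ) (hU : HasDeg U H (S.card - 1)) (hr : φ r ∈ U)
    (hψ : P.MidExtension S r w H κ φ T ψ) (hTc : T ⊆ P.children S r)
    (hc : c ∈ P.children S r) (hcT : c ∉ T) (hk : k c = 0) {z : Cube}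
    (hadj : hypercube.Adj (φ r) z) (hz : ¬ H (φ r) z) :
    ∃ ψ', P.MidExtension S r w H κ φ (insert c T) ψ' ∧
      (∀ b ∈ T, P.dir ψ' (w b) = P.dir ψ (w b)) ∧
      (∀ b ∈ T, P.dir ψ' (w c) ≠ P.dir ψ (w b)) ∧ P.dir ψ' (w c) ≠ coord s(φ r, z) := by
  set D := (P.half S (P.lev r)).erase r with hD
  have hwc : w c = c := hT.mid_eq_of_leaf hc hk
  have hpc : P.par (w c) = r := by rw [hwc]; exact (mem_children.1 hc).2.1
  have hψr : ψ r = φ r := hψ.eq r (hT.tree.root_mem_half le_rfl)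
  -- Edges at the root are left out: equal directions there mean equal edges, which the colors
  -- exclude. A middle direction in the second set is paid for by the first vertex of its leg, a
  -- child of the root in `D` that the first set omits. Hence |Δ| ≤ |D|.
  set Δ := (D.filter fun v => P.par v ≠ r).image (P.dir ψ) ∪
    ((T.filter fun b => k b ≠ 0).image fun b => P.dir ψ (w b)) with hΔ
  have hΔc : Δ.card ≤ D.card := by
    have h1 := Finset.card_union_le ((D.filter fun v => P.par v ≠ r).image (P.dir ψ))
      ((T.filter fun b => k b ≠ 0).image fun b => P.dir ψ (w b))
    have h2 : ((D.filter fun v => P.par v ≠ r).image (P.dir ψ)).card ≤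
      (D.filter fun v => P.par v ≠ r).card := Finset.card_image_le
    have h3 : ((T.filter fun b => k b ≠ 0).image fun b => P.dir ψ (w b)).card ≤
      (T.filter fun b => k b ≠ 0).card := Finset.card_image_le
    have h4 : (T.filter fun b => k b ≠ 0).card ≤ (D.filter fun v => P.par v = r).card := by
      refine Finset.card_le_card fun b hb => ?_
      rw [Finset.mem_filter] at hb ⊢
      exact ⟨hT.mem_floor_of_not_leaf (hTc hb.1) hb.2, (mem_children.1 (hTc hb.1)).2.1⟩
    have h5 := Finset.card_filter_add_card_filter_not (s := D) (fun v => P.par v = r)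
    rw [← hΔ] at h1
    simp only [ne_eq] at h1 h2 h3 h4 ⊢
    omega
  have hTcard : T.card < (P.children S r).card :=
    Finset.card_lt_card ⟨hTc, fun h => hcT (h hc)⟩
  have hcard : S.card - 1 = 2 * D.card + (P.children S r).card := hT.card_sub_one
  have h1 := card_union_image_le D T w
  have h2 : ((D ∪ T.image w).image (P.col κ ψ)).card ≤ (D ∪ T.image w).card :=
    Finset.card_image_le
  obtain ⟨y, hy1, hy2, hy3⟩ := hU.exists_next hH hr ((D ∪ T.image w).image (P.col κ ψ)) Δ
    (by omega)
  have hroot : ∀ v ∈ D ∪ T.image w, P.par v = r → coord s(φ r, y) ≠ P.dir ψ v := by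
    intro v hv hpv h
    have hedge := hψ.hom v hv
    rw [dir, hpv, hψr] at h
    rw [hpv, hψr] at hedge
    refine hy2 (Finset.mem_image.2 ⟨v, hv, ?_⟩)
    rw [col, hpv, hψr, eq_of_coord_eq (hH.cube hy1) (hH.cube hedge) h]
  have hyD : ∀ v ∈ D, coord s(φ r, y) ≠ P.dir ψ v := by
    intro v hv
    by_cases hpv : P.par v = r
    · exact hroot v (Finset.mem_union_left _ hv) hpv
    · intro h
      refine hy3 (Finset.mem_union_left _ (Finset.mem_image.2 ⟨v, ?_, h.symm⟩))
      exact Finset.mem_filter.2 ⟨hv, hpv⟩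
  have hyT : ∀ b ∈ T, coord s(φ r, y) ≠ P.dir ψ (w b) := by
    intro b hb
    by_cases hkb : k b = 0
    · refine hroot _ (Finset.mem_union_right _ (Finset.mem_image_of_mem w hb)) ?_
      rw [hT.mid_eq_of_leaf (hTc hb) hkb]
      exact (mem_children.1 (hTc hb)).2.1
    · intro h
      refine hy3 (Finset.mem_union_right _ (Finset.mem_image.2 ⟨b, ?_, h.symm⟩))
      exact Finset.mem_filter.2 ⟨hb, hkb⟩
  obtain ⟨e1, e2, e3⟩ := hT.midExtension_update (y := y) hψ hTc hc hcT (by rwa [hpc, hψr])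
    (by rwa [hpc, hψr]) (by
      rw [hpc, hψr]
      intro h
      obtain ⟨v, hv, he⟩ := Finset.mem_image.1 h
      exact hyD v hv he.symm)
  rw [hpc, hψr] at e3
  refine ⟨_, e1, e2, fun b hb => e3 ▸ hyT b hb, fun h => hz ?_⟩
  rw [e3] at h
  rwa [← eq_of_coord_eq (hH.cube hy1) hadj h]

/-- Middle edges already placed keep their directions, so what was arranged for the first two legs
survives. -/
lemma exists_insert_many (hH : IsColored H κ) (hU : HasDeg U H (S.card - 1)) (N : Finset V) :
    ∀ (T : Finset V) (ψ : V → Cube), P.MidExtension S r w H κ φ T ψ → T ∪ N ⊆ P.children S r →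
    (∀ c ∈ N, k c ≠ 0) →
    ∃ ψ', P.MidExtension S r w H κ φ (T ∪ N) ψ' ∧ ∀ b ∈ T, P.dir ψ' (w b) = P.dir ψ (w b) := by
  induction N using Finset.induction_on with
  | empty =>
    intro T ψ hψ _ _
    exact ⟨ψ, by rwa [Finset.union_empty], fun _ _ => rfl⟩
  | insert c N hcN ih =>
    intro T ψ hψ hTN hk
    obtain ⟨ψ', h1, h2⟩ := ih T ψ hψ
      (fun x hx => hTN (Finset.union_subset_union_right (Finset.subset_insert _ _) hx))
      (fun b hb => hk b (Finset.mem_insert_of_mem hb))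
    rw [Finset.union_insert] at hTN ⊢
    by_cases hc : c ∈ T ∪ N
    · exact ⟨ψ', by rwa [Finset.insert_eq_of_mem hc], h2⟩
    · have hlt : (T ∪ N).card < (P.children S r).card := by
        have := Finset.card_le_card hTN
        rw [Finset.card_insert_of_notMem hc] at this
        omega
      obtain ⟨ψ'', h3, h4, -⟩ := hT.exists_insert hH hU h1
        (fun x hx => hTN (Finset.mem_insert_of_mem hx)) (hTN (Finset.mem_insert_self _ _)) hc
        (hk c (Finset.mem_insert_self _ _)) ∅ (by rw [Finset.card_empty]; omega)
      exact ⟨ψ'', h3, fun b hb => by rw [h4 b (Finset.mem_union_left _ hb), h2 b hb]⟩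

/-- Leaves at the root come after the longer legs, so that each can avoid the middle directions of
all legs placed before it. -/
lemma exists_insert_leaves (hH : IsColored H κ) (hU : HasDeg U H (S.card - 1)) (hr : φ r ∈ U)
    {z : Cube} (hadj : hypercube.Adj (φ r) z) (hz : ¬ H (φ r) z) (N : Finset V) :
    ∀ (T : Finset V) (ψ : V → Cube), P.MidExtension S r w H κ φ T ψ → T ∪ N ⊆ P.children S r →
    Disjoint T N → (∀ c ∈ N, k c = 0) →
    ∃ ψ', P.MidExtension S r w H κ φ (T ∪ N) ψ' ∧ (∀ b ∈ T, P.dir ψ' (w b) = P.dir ψ (w b)) ∧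
      ∀ c ∈ N, P.dir ψ' (w c) ≠ coord s(φ r, z) ∧
        ∀ b ∈ T ∪ N, b ≠ c → P.dir ψ' (w b) ≠ P.dir ψ' (w c) := by
  induction N using Finset.induction_on with
  | empty =>
    intro T ψ hψ _ _ _
    exact ⟨ψ, by rwa [Finset.union_empty], fun _ _ => rfl, fun c hc => absurd hc (by simp)⟩
  | insert c N hcN ih =>
    intro T ψ hψ hTN hd hk
    rw [Finset.disjoint_insert_right] at hd
    obtain ⟨ψ', h1, h2, h3⟩ := ih T ψ hψ
      (fun x hx => hTN (Finset.union_subset_union_right (Finset.subset_insert _ _) hx)) hd.2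
      (fun b hb => hk b (Finset.mem_insert_of_mem hb))
    rw [Finset.union_insert] at hTN ⊢
    have hc : c ∉ T ∪ N := by
      rw [Finset.mem_union, not_or]
      exact ⟨hd.1, hcN⟩
    obtain ⟨ψ'', h4, h5, h6, h7⟩ := hT.exists_insert_leaf hH hU hr h1
      (fun x hx => hTN (Finset.mem_insert_of_mem hx)) (hTN (Finset.mem_insert_self _ _)) hc
      (hk c (Finset.mem_insert_self _ _)) hadj hz
    refine ⟨ψ'', h4, fun b hb => by rw [h5 b (Finset.mem_union_left _ hb), h2 b hb], ?_⟩
    intro d hdN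
    rcases Finset.mem_insert.1 hdN with rfl | hdN
    · refine ⟨h7, fun b hb hbd => ?_⟩
      rcases Finset.mem_insert.1 hb with rfl | hb
      · exact absurd rfl hbd
      · rw [h5 b hb]
        exact (h6 b hb).symm
    · have hd' : d ∈ T ∪ N := Finset.mem_union_right _ hdN
      rw [h5 d hd']
      refine ⟨(h3 d hdN).1, fun b hb hbd => ?_⟩
      rcases Finset.mem_insert.1 hb with rfl | hb
      · exact h6 d hd'
      · rw [h5 b hb]
        exact (h3 d hdN).2 b hb hbd

/-- The rainbow extension to the upper halves of all branches. -/
lemma exists_midExtension (hH : IsColored H κ) (hU : HasDeg U H (S.card - 1)) (hr : φ r ∈ U)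
    {z : Cube} (hadj : hypercube.Adj (φ r) z) (hz : ¬ H (φ r) z)
    (hch : 2 ≤ (P.children S r).card)
    (hhom : P.Hom H φ ((P.half S (P.lev r)).erase r : Finset V))
    (hcol : Set.InjOn (P.col κ φ) ((P.half S (P.lev r)).erase r : Finset V)) :
    ∃ ψ, P.MidExtension S r w H κ φ (P.children S r) ψ ∧
      (∀ c ∈ P.children S r, k c = 0 → P.dir ψ (w c) ≠ coord s(φ r, z) ∧
        ∀ b ∈ P.children S r, b ≠ c → P.dir ψ (w b) ≠ P.dir ψ (w c)) ∧
      ((P.children S r).filter (fun c => k c ≠ 0) = ∅ ∨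
        ∃ c₁ ∈ (P.children S r).filter (fun c => k c ≠ 0), P.dir ψ (w c₁) ≠ coord s(φ r, z) ∧
          ((P.children S r).filter (fun c => k c ≠ 0) = {c₁} ∨
            ∃ c₂ ∈ (P.children S r).filter (fun c => k c ≠ 0),
              P.dir ψ (w c₂) ≠ P.dir ψ (w c₁))) := by
  set N := (P.children S r).filter (fun c => k c ≠ 0) with hN
  set M := (P.children S r).filter (fun c => k c = 0) with hM
  have hNM : N ∪ M = P.children S r := by
    rw [hN, hM, Finset.union_comm]
    exact Finset.filter_union_filter_not_eq _ _
  have hdisj : Disjoint N M := by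
    rw [hN, hM, disjoint_comm]
    exact Finset.disjoint_filter_filter_not _ _ _
  have h0 : P.MidExtension S r w H κ φ ∅ φ :=
    { eq := fun _ _ => rfl
      hom := by simpa using hhom
      col := by simpa using hcol
      dir := fun c hc => absurd hc (by simp) }
  have hNc : ∀ c ∈ N, c ∈ P.children S r ∧ k c ≠ 0 := fun c hc => Finset.mem_filter.1 hc
  suffices hmain : ∃ ψ, P.MidExtension S r w H κ φ N ψ ∧ (N = ∅ ∨
        ∃ c₁ ∈ N, P.dir ψ (w c₁) ≠ coord s(φ r, z) ∧
          (N = {c₁} ∨ ∃ c₂ ∈ N, P.dir ψ (w c₂) ≠ P.dir ψ (w c₁))) by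
    obtain ⟨ψ, h1, h2⟩ := hmain
    obtain ⟨ψ', h3, h4, h5⟩ := hT.exists_insert_leaves hH hU hr hadj hz M N ψ h1 hNM.le hdisj
      (fun c hc => (Finset.mem_filter.1 hc).2)
    rw [hNM] at h3 h5
    refine ⟨ψ', h3, fun c hc hk => h5 c (Finset.mem_filter.2 ⟨hc, hk⟩), ?_⟩
    rcases h2 with h2 | ⟨c₁, hc₁, h2, h6⟩
    · exact Or.inl h2
    · refine Or.inr ⟨c₁, hc₁, by rwa [h4 c₁ hc₁], ?_⟩
      rcases h6 with h6 | ⟨c₂, hc₂, h6⟩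
      · exact Or.inl h6
      · exact Or.inr ⟨c₂, hc₂, by rwa [h4 c₁ hc₁, h4 c₂ hc₂]⟩
  rcases N.eq_empty_or_nonempty with hNe | ⟨c₁, hc₁⟩
  · rw [hNe]
    exact ⟨φ, h0, Or.inl rfl⟩
  -- Only two directions are restricted further: that of `c₁` avoids `z`, and that of `c₂` avoids
  -- `c₁`. The second choice spends one unit on the color at `c₁` and one on its direction, hence
  -- needs two children of the root.
  obtain ⟨ψ₁, h1, -, h2⟩ := hT.exists_insert hH hU h0 (Finset.empty_subset _) (hNc c₁ hc₁).1
    (Finset.notMem_empty _) (hNc c₁ hc₁).2 {coord s(φ r, z)}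
    (by rw [Finset.card_empty, Finset.card_singleton]; omega)
  rw [Finset.mem_singleton] at h2
  by_cases hN1 : N = {c₁}
  · rw [hN1]
    exact ⟨ψ₁, by simpa using h1, Or.inr ⟨c₁, Finset.mem_singleton_self _, h2, Or.inl rfl⟩⟩
  obtain ⟨c₂, hc₂, hne⟩ : ∃ c₂ ∈ N, c₂ ≠ c₁ := by
    by_contra! hcon
    exact hN1 (Finset.eq_singleton_iff_unique_mem.2 ⟨hc₁, hcon⟩)
  have hins1 : insert c₁ (∅ : Finset V) ⊆ P.children S r := by
    simpa using (hNc c₁ hc₁).1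
  obtain ⟨ψ₂, h3, h4, h5⟩ := hT.exists_insert hH hU h1 hins1 (hNc c₂ hc₂).1
    (by simpa using hne) (hNc c₂ hc₂).2 {P.dir ψ₁ (w c₁)}
    (by rw [Finset.card_insert_of_notMem (Finset.notMem_empty _), Finset.card_empty,
      Finset.card_singleton]; omega)
  rw [Finset.mem_singleton] at h5
  have hsub : insert c₂ (insert c₁ (∅ : Finset V)) ∪ N = N := by
    rw [Finset.union_eq_right]
    intro x hx
    simp only [Finset.mem_insert, Finset.notMem_empty, or_false] at hx
    rcases hx with rfl | rfl
    · exact hc₂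
    · exact hc₁
  obtain ⟨ψ₃, h6, h7⟩ := hT.exists_insert_many hH hU N _ ψ₂ h3
    (by rw [hsub]; exact fun c hc => (hNc c hc).1) (fun c hc => (hNc c hc).2)
  rw [hsub] at h6
  have e1 : P.dir ψ₃ (w c₁) = P.dir ψ₁ (w c₁) := by
    rw [h7 c₁ (by simp), h4 c₁ (by simp)]
  have e2 : P.dir ψ₃ (w c₂) = P.dir ψ₂ (w c₂) := h7 c₂ (by simp)
  refine ⟨ψ₃, h6, Or.inr ⟨c₁, hc₁, by rwa [e1], Or.inr ⟨c₂, hc₂, by rwa [e1, e2]⟩⟩⟩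

end IsSpider

end Ranked

/-! ### Completing the legs one at a time -/

namespace Ranked

variable {V : Type*} {P : Ranked V} {C : Type*} {S : Finset V} {r : V} {k : V → ℕ} {w : V → V}

/-- An element of `J` that can be removed such that the same alternative holds for the rest. -/
lemma exists_erase {f : V → ℕ} {d : ℕ} {J : Finset V}
    (hJ : ∃ c₁ ∈ J, f c₁ ≠ d ∧ (J = {c₁} ∨ ∃ c₂ ∈ J, f c₂ ≠ f c₁)) :
    ∃ i ∈ J, (J.erase i = ∅ ∨ ∃ c₁ ∈ J.erase i, f c₁ ≠ d ∧
        (J.erase i = {c₁} ∨ ∃ c₂ ∈ J.erase i, f c₂ ≠ f c₁)) ∧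
      ((J.erase i = ∅ ∧ f i ≠ d) ∨ ∃ j ∈ J.erase i, f j ≠ f i) := by
  obtain ⟨c₁, hc₁, hd, h | ⟨c₂, hc₂, hne⟩⟩ := hJ
  · have : J.erase c₁ = ∅ := by rw [h]; simp
    exact ⟨c₁, hc₁, Or.inl this, Or.inl ⟨this, hd⟩⟩
  have hcc : c₂ ≠ c₁ := by rintro rfl; exact hne rfl
  -- A third element can be removed while `c₁` and `c₂` stay; as their values differ, one of them
  -- differs from that of `i`.
  by_cases hi : ∃ i ∈ J, i ≠ c₁ ∧ i ≠ c₂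
  · obtain ⟨i, hi, hi1, hi2⟩ := hi
    have e1 : c₁ ∈ J.erase i := Finset.mem_erase.2 ⟨hi1.symm, hc₁⟩
    have e2 : c₂ ∈ J.erase i := Finset.mem_erase.2 ⟨hi2.symm, hc₂⟩
    refine ⟨i, hi, Or.inr ⟨c₁, e1, hd, Or.inr ⟨c₂, e2, hne⟩⟩, Or.inr ?_⟩
    by_cases h : f c₁ = f i
    · exact ⟨c₂, e2, fun h' => hne (h'.trans h.symm)⟩
    · exact ⟨c₁, e1, h⟩
  -- Only `c₁` and `c₂` are present. Removing `c₂` leaves the one whose value is not `d`.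
  · have hJe : J.erase c₂ = {c₁} := by
      refine Finset.eq_singleton_iff_unique_mem.2
        ⟨Finset.mem_erase.2 ⟨hcc.symm, hc₁⟩, fun x hx => ?_⟩
      by_contra hx1
      exact hi ⟨x, Finset.mem_of_mem_erase hx, hx1, Finset.ne_of_mem_erase hx⟩
    have e1 : c₁ ∈ J.erase c₂ := hJe ▸ Finset.mem_singleton_self _
    exact ⟨c₂, hc₂, Or.inr ⟨c₁, e1, hd, Or.inl hJe⟩, Or.inr ⟨c₁, e1, hne.symm⟩⟩

/-- The neighbor of `x` in direction `d`. -/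
def step (x : Cube) (d : ℕ) : Cube := Function.update x d (!x d)

lemma step_self (x : Cube) (d : ℕ) : step x d d = !x d := Function.update_self _ _ _

lemma step_of_ne (x : Cube) {d i : ℕ} (h : i ≠ d) : step x d i = x i :=
  Function.update_of_ne h _ _

lemma eq_step {x z : Cube} (h : hypercube.Adj x z) : z = step x (coord s(x, z)) := by
  funext i
  by_cases hi : i = coord s(x, z)
  · have h1 := (ne_iff_eq_coord h i).2 hi
    rw [← hi, step_self]
    cases hx : x i <;> cases hz : z i <;> simp_all
  · rw [step_of_ne x hi]
    by_contra hne
    exact hi ((ne_iff_eq_coord h i).1 (Ne.symm hne))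

variable (P) in
/-- In the branch at `c`, `Ψ` neither uses a direction of the lower half of the branch at `b` nor
visits the neighbor of the root in the direction of the middle edge. -/
structure Avoids (S : Finset V) (r : V) (w : V → V) (ψ Ψ : V → Cube) (c b : V) : Prop where
  dir : ∀ x ∈ P.below S c, ∀ v ∈ P.half S (P.lev r) ∩ P.below S b, P.dir Ψ x ≠ P.dir ψ v
  ne : ∀ x ∈ P.below S c, Ψ x ≠ step (ψ r) (P.dir ψ (w c))

namespace IsSpider

variable (hT : P.IsSpider S r k w)
include hT

variable {κ : Cube → Cube → C} {ψ : V → Cube}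

lemma card_ceil_below {c : V} (hc : c ∈ P.children S r) :
    (P.half S (P.lev r + 1) ∩ P.below S c).card = k c + 1 := by
  have : P.half S (P.lev r + 1) ∩ P.below S c
      = insert (w c) (P.half S (P.lev r) ∩ P.below S c) := by
    ext x
    rw [Finset.mem_inter, Finset.mem_insert, Finset.mem_inter]
    constructor
    · rintro ⟨h1, h2⟩
      rcases (hT.mem_ceil_iff hc h2).1 h1 with h | h
      · exact Or.inr ⟨h, h2⟩
      · exact Or.inl h
    · rintro (rfl | ⟨h1, h2⟩)
      · exact ⟨hT.mid_mem_ceil hc, hT.mid_mem c hc⟩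
      · exact ⟨half_mono (by omega) h1, h2⟩
  rw [this, Finset.card_insert_of_notMem, hT.card_floor c hc]
  exact fun h => hT.mid_not_mem_floor hc (Finset.mem_inter.1 h).1

lemma below_ne_root {c x : V} (hc : c ∈ P.children S r) (hx : x ∈ P.below S c) : x ≠ r := by
  rintro rfl
  have h1 := (mem_below.1 hx).2.le
  have h2 := (mem_children.1 hc).2.2
  omega

lemma injOn_dir_ceil_below {c : V} (hc : c ∈ P.children S r)
    (hdir : Set.InjOn (P.dir ψ) ((P.half S (P.lev r)).erase r : Finset V))
    (hmid : ∀ c ∈ P.children S r, ∀ v ∈ (P.half S (P.lev r)).erase r,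
      P.dir ψ (w c) ≠ P.dir ψ v) :
    Set.InjOn (P.dir ψ) (P.half S (P.lev r + 1) ∩ P.below S c : Finset V) := by
  intro x hx y hy he
  rw [Finset.mem_coe, Finset.mem_inter] at hx hy
  have hD : ∀ x ∈ P.below S c, x ∈ P.half S (P.lev r) → x ∈ (P.half S (P.lev r)).erase r :=
    fun x hx h => Finset.mem_erase.2 ⟨hT.below_ne_root hc hx, h⟩
  rcases (hT.mem_ceil_iff hc hx.2).1 hx.1 with h | h <;>
    rcases (hT.mem_ceil_iff hc hy.2).1 hy.1 with h' | h'
  · exact hdir (hD x hx.2 h) (hD y hy.2 h') he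
  · rw [h'] at he
    exact absurd he.symm (hmid c hc x (hD x hx.2 h))
  · rw [h] at he
    exact absurd he (hmid c hc y (hD y hy.2 h'))
  · rw [h, h']

/-- The extension of a homomorphism of the upper halves of the branches to the branches at `J`. -/
lemma exists_legs {d : ℕ}
    (hIH : ∀ c ∈ P.children S r, P.ExtensionProperty C (P.below S c) c)
    (hcol : Set.InjOn (P.col κ ψ) ((P.half S (P.lev r + 1)).erase r : Finset V))
    (hdir : Set.InjOn (P.dir ψ) ((P.half S (P.lev r)).erase r : Finset V))
    (hmid : ∀ c ∈ P.children S r, ∀ v ∈ (P.half S (P.lev r)).erase r,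
      P.dir ψ (w c) ≠ P.dir ψ v) :
    ∀ (n : ℕ) (J : Finset V), J.card = n → J ⊆ (P.children S r).filter (fun c => k c ≠ 0) →
    (J = ∅ ∨ ∃ c₁ ∈ J, P.dir ψ (w c₁) ≠ d ∧
      (J = {c₁} ∨ ∃ c₂ ∈ J, P.dir ψ (w c₂) ≠ P.dir ψ (w c₁))) →
    ∀ (H : Cube → Cube → Prop) (U : Set Cube), IsColored H κ →
    HasDeg U H (((P.half S (P.lev r + 1)).erase r).card + ∑ c ∈ J, k c) →
    P.Hom H ψ ((P.half S (P.lev r + 1)).erase r : Finset V) →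
    ∃ Ψ : V → Cube, (∀ v ∈ P.half S (P.lev r + 1), Ψ v = ψ v) ∧
      P.Hom H Ψ ((P.half S (P.lev r + 1)).erase r ∪ J.biUnion (P.below S) : Finset V) ∧
      Set.InjOn (P.col κ Ψ)
        ((P.half S (P.lev r + 1)).erase r ∪ J.biUnion (P.below S) : Finset V) ∧
      (∀ c ∈ J, Set.InjOn Ψ (P.below S c : Set V) ∧ ∀ x ∈ P.below S c, Ψ x ≠ ψ r) ∧
      (∀ c ∈ J, ∀ b ∈ J, c ≠ b → P.dir ψ (w c) = P.dir ψ (w b) →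
        P.Avoids S r w ψ Ψ c b ∨ P.Avoids S r w ψ Ψ b c) ∧
      ∀ c ∈ J, P.dir ψ (w c) = d →
        ∀ x ∈ P.below S c, Ψ x ≠ step (ψ r) (P.dir ψ (w c)) := by
  set F := P.half S (P.lev r) with hF
  set G := P.half S (P.lev r + 1) with hG
  have hrG : r ∈ G := hT.tree.root_mem_half (by omega)
  intro n
  induction n with
  | zero =>
    intro J hJ _ _ H U hH hU hhom
    rw [Finset.card_eq_zero] at hJ
    subst hJ
    refine ⟨ψ, fun _ _ => rfl, ?_, ?_, ?_, ?_, ?_⟩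
    · simpa using hhom
    · simpa using hcol
    all_goals simp
  | succ n ih =>
    intro J hJn hJ hcond H U hH hU hhom
    have hcond' : ∃ c₁ ∈ J, P.dir ψ (w c₁) ≠ d ∧
        (J = {c₁} ∨ ∃ c₂ ∈ J, P.dir ψ (w c₂) ≠ P.dir ψ (w c₁)) := by
      rcases hcond with h | h
      · rw [h, Finset.card_empty] at hJn
        omega
      · exact h
    -- The leg at `i` is completed now and has to avoid the legs of `J.erase i`. Either one of these
    -- has another middle direction, which provides a spare unit of degree, or `i` is the last leg
    -- and its direction is not `d`, so nothing has to be avoided.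
    obtain ⟨i, hiJ, hrest, hlast⟩ := exists_erase (f := fun c => P.dir ψ (w c)) hcond'
    have hJc : ∀ c ∈ J, c ∈ P.children S r := fun c hc => (Finset.mem_filter.1 (hJ hc)).1
    have hJk : ∀ c ∈ J, k c ≠ 0 := fun c hc => (Finset.mem_filter.1 (hJ hc)).2
    have hi := hJc i hiJ
    set J' := J.erase i with hJ'
    have hJ'J : ∀ c ∈ J', c ∈ J := fun c hc => Finset.mem_of_mem_erase hc
    set B := P.below S i with hB
    set Q := G ∩ B with hQ
    have hBt : P.IsSubtree B i := hT.tree.below_isSubtree (mem_children.1 hi).1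
    have hBr : ∀ x ∈ B, x ≠ r := fun x hx => hT.below_ne_root hi hx
    have hQG : ∀ x ∈ Q, x ∈ G.erase r := fun x hx =>
      Finset.mem_erase.2 ⟨hBr x (Finset.mem_inter.1 hx).2, (Finset.mem_inter.1 hx).1⟩
    have hiQ : i ∈ Q := Finset.mem_inter.2 ⟨child_mem_half hi, hBt.root_mem⟩
    have hQcard : Q.card = k i + 1 := hT.card_ceil_below hi
    have hlev : P.lev i = P.lev r + 1 := (mem_children.1 hi).2.2
    have hpi : P.par i = r := (mem_children.1 hi).2.1
    have hhalfB : P.half B (P.lev i) = Q := by rw [hB, half_below, hlev]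
    have hQt : P.IsSubtree Q i := hhalfB ▸ hBt.half_isSubtree le_rfl
    have hsum : ∑ c ∈ J, k c = k i + ∑ c ∈ J', k c := (Finset.add_sum_erase J k hiJ).symm
    have hQdir : Set.InjOn (P.dir ψ) (Q : Set V) := hT.injOn_dir_ceil_below hi hdir hmid
    have hQcases : ∀ x ∈ Q, x ∈ F ∨ x = w i := fun x hx =>
      (hT.mem_ceil_iff hi (Finset.mem_inter.1 hx).2).1 (Finset.mem_inter.1 hx).1
    have hdisj : ∀ b ∈ J', ∀ x ∈ P.below S b, x ∉ B := by
      intro b hb x hx hxB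
      have hbc := hJc b (hJ'J b hb)
      have := disjoint_below (S := S) ((mem_children.1 hbc).2.2.trans hlev.symm)
        (Finset.ne_of_mem_erase hb)
      exact Finset.disjoint_left.1 this hx hxB
    -- directions and vertices to be avoided in the branch at `i`
    obtain ⟨Δ, Y, hcard, hQΔ, hQY, hDΔ, hyY⟩ : ∃ (Δ : Finset ℕ) (Y : Finset Cube),
        Δ.card + Y.card ≤ ∑ c ∈ J', k c ∧ (∀ x ∈ Q, P.dir ψ x ∉ Δ) ∧ (∀ x ∈ Q, ψ x ∉ Y) ∧
        (∀ b ∈ J', P.dir ψ (w i) = P.dir ψ (w b) → ∀ v ∈ F ∩ P.below S b, P.dir ψ v ∈ Δ) ∧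
        (J' ≠ ∅ ∨ P.dir ψ (w i) = d → step (ψ r) (P.dir ψ (w i)) ∈ Y) := by
      rcases hlast with ⟨hJe, hne⟩ | ⟨j, hj, hne⟩
      · refine ⟨∅, ∅, by simp, by simp, by simp, ?_, ?_⟩
        · rw [hJe]; simp
        · rintro (h | h)
          · exact absurd hJe h
          · exact absurd h hne
      set K := J'.filter fun b => P.dir ψ (w i) = P.dir ψ (w b) with hK
      refine ⟨(K.biUnion fun b => F ∩ P.below S b).image (P.dir ψ),
        {step (ψ r) (P.dir ψ (w i))}, ?_, ?_, ?_, ?_, ?_⟩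
      · have h1 : ((K.biUnion fun b => F ∩ P.below S b).image (P.dir ψ)).card ≤ ∑ b ∈ K, k b := by
          refine Finset.card_image_le.trans (Finset.card_biUnion_le.trans (le_of_eq ?_))
          refine Finset.sum_congr rfl fun b hb => ?_
          exact hT.card_floor b (hJc b (hJ'J b (Finset.mem_filter.1 hb).1))
        have h2 : ∑ b ∈ K, k b + k j ≤ ∑ b ∈ J', k b := by
          have hjK : j ∉ K := fun h => hne (Finset.mem_filter.1 h).2.symm
          rw [add_comm, ← Finset.sum_insert hjK]
          refine Finset.sum_le_sum_of_subset fun x hx => ?_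
          rcases Finset.mem_insert.1 hx with rfl | hx
          · exact hj
          · exact (Finset.mem_filter.1 hx).1
        have h3 := hJk j (hJ'J j hj)
        rw [Finset.card_singleton]
        omega
      · intro x hx h
        obtain ⟨v, hv, he⟩ := Finset.mem_image.1 h
        obtain ⟨b, hb, hv⟩ := Finset.mem_biUnion.1 hv
        rw [Finset.mem_filter] at hb
        have hbc := hJc b (hJ'J b hb.1)
        rw [Finset.mem_inter] at hv
        have hvD : v ∈ F.erase r := Finset.mem_erase.2 ⟨hT.below_ne_root hbc hv.2, hv.1⟩
        rcases hQcases x hx with hxF | rfl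
        · have hxB := (Finset.mem_inter.1 hx).2
          have := hdir hvD (Finset.mem_erase.2 ⟨hBr x hxB, hxF⟩) he
          exact hdisj b hb.1 v hv.2 (this ▸ hxB)
        · exact hmid i hi v hvD he.symm
      -- Every image of `Q` differs from that of the root in the direction of the first edge of the
      -- leg. This is not the middle direction, as the leg is longer than one vertex, so the
      -- forbidden neighbor of the root is not hit.
      · intro x hx hxy
        rw [Finset.mem_singleton] at hxy
        have hxB := (Finset.mem_inter.1 hx).2
        have hrx : P.Desc r x := hT.tree.root_desc (below_subset hxB)
        have hsub : P.between r x ⊆ (Q : Set V) := by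
          rintro v ⟨h1, h2, h3⟩
          refine hQt.mem_of_desc hx h3 ?_
          have := h1.lt_of_ne h2.symm
          omega
        have hd1 := diff_eq hrx (fun v hv => hH.cube (hhom v (hQG v (hsub hv))))
          (hQdir.mono hsub)
        have hix : i ∈ P.between r x := ⟨hT.tree.root_desc (mem_children.1 hi).1, hBr i hBt.root_mem,
          (mem_below.1 hxB).2⟩
        have h1 : P.dir ψ i ∈ {j | ψ r j ≠ ψ x j} := by
          rw [hd1]; exact ⟨i, hix, rfl⟩
        have h2 : P.dir ψ i ≠ P.dir ψ (w i) :=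
          (hmid i hi i (hT.mem_floor_of_not_leaf hi (hJk i hiJ))).symm
        rw [hxy, Set.mem_ofPred_eq, step_of_ne _ h2] at h1
        exact h1 rfl
      · intro b hb he v hv
        exact Finset.mem_image_of_mem _ (Finset.mem_biUnion.2
          ⟨b, Finset.mem_filter.2 ⟨hb, he⟩, hv⟩)
      · intro _
        exact Finset.mem_singleton_self _
    -- the branch at `i`
    set R := G.erase r \ Q.erase i with hR
    set Γ := R.image (P.col κ ψ) with hΓ
    have hQGs : Q.erase i ⊆ G.erase r := fun x hx => hQG x (Finset.mem_of_mem_erase hx)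
    have hRcard : R.card + k i = (G.erase r).card := by
      have h1 := Finset.card_sdiff_add_card_eq_card hQGs
      rw [Finset.card_erase_of_mem hiQ, hQcard] at h1
      exact h1
    have hΓcard : Γ.card ≤ R.card := Finset.card_image_le
    have hiG := hQG i hiQ
    -- The edge from the root to `i` is deleted through its color, so the image of the root can
    -- serve as bad vertex for the leg.
    have hiR : i ∈ R := Finset.mem_sdiff.2 ⟨hiG, Finset.notMem_erase _ _⟩
    have hBcard : B.card = 2 * k i + 1 := hT.card_below i hi
    have hψi := hhom i hiG
    rw [hpi] at hψi
    have hsubR : ∀ x ∈ Q.erase i, P.col κ ψ x ∉ Γ := by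
      intro x hx h
      obtain ⟨v, hv, he⟩ := Finset.mem_image.1 h
      rw [Finset.mem_sdiff] at hv
      exact hv.2 (hcol hv.1 (hQGs hx) he ▸ hx)
    -- The colors in `Γ` leave `k i` of the first term of the degree, and `Δ` and `Y` cost at most
    -- the sum over `J'`. What remains is at least `2 * k i`, the number of edges of the leg.
    obtain ⟨Φ, hΦ1, hΦ2, hΦ3, hΦ4, hΦ5, -⟩ := hIH i hi _ κ _ ψ (ψ r) (hH.del Γ Δ Y)
      ((hU.del hH Γ Δ Y).mono (by rw [hBcard]; omega))
      ⟨hU.mem hψi, by exact_mod_cast hQY i hiQ⟩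
      (by
        rw [hhalfB]
        intro x hx
        refine ⟨hhom x (hQGs hx), hsubR x hx, hQΔ x (Finset.mem_of_mem_erase hx), ?_,
          hQY x (Finset.mem_of_mem_erase hx)⟩
        exact hQY _ (hQt.par_mem x (Finset.mem_of_mem_erase hx) (Finset.ne_of_mem_erase hx)))
      (by rw [hhalfB]; exact hcol.mono hQGs)
      (by rw [hhalfB]; exact hQdir.mono (fun x hx => Finset.mem_of_mem_erase hx))
      (hH.cube hψi).symm
      (by
        intro h
        refine h.2.1 ?_
        rw [hH.col_symm]
        refine Finset.mem_image.2 ⟨i, hiR, ?_⟩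
        rw [col, hpi])
      (by
        rw [hhalfB]
        intro x hx h
        rw [Sym2.eq_swap] at h
        refine Finset.ne_of_mem_erase hx (hQdir (Finset.mem_of_mem_erase hx) hiQ ?_)
        rw [h, dir, hpi])
    rw [hhalfB] at hΦ1
    -- the other branches
    have hBGcard : (B \ G).card = k i := by
      have h1 := Finset.card_sdiff_add_card_inter B G
      rw [Finset.inter_comm, ← hQ, hQcard, hBcard] at h1
      omega
    set Γ' := (B \ G).image (P.col κ Φ) with hΓ'
    have hΓ'card : Γ'.card ≤ k i := hBGcard ▸ Finset.card_image_le
    have hBG : ∀ x ∈ B \ G, x ∈ B.erase i := by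
      intro x hx
      rw [Finset.mem_sdiff] at hx
      refine Finset.mem_erase.2 ⟨?_, hx.1⟩
      rintro rfl
      exact hx.2 (Finset.mem_inter.1 hiQ).1
    have hΦQ : ∀ x ∈ Q.erase i, P.col κ Φ x = P.col κ ψ x := fun x hx =>
      col_congr (hΦ1 x (Finset.mem_of_mem_erase hx))
        (hΦ1 _ (hQt.par_mem x (Finset.mem_of_mem_erase hx) (Finset.ne_of_mem_erase hx)))
    -- At most `k i` new colors are deleted, which is the term of `i` in the degree hypothesis.
    obtain ⟨Ψ, h1, h2, h3, h4, h5, h6⟩ := ih J' (by rw [hJ', Finset.card_erase_of_mem hiJ]; omega)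
      (fun c hc => hJ (hJ'J c hc)) hrest _ _ (hH.del Γ' ∅ ∅)
      ((hU.del hH Γ' ∅ ∅).mono (by simp only [Finset.card_empty]; omega))
      (by
        intro v hv
        refine ⟨hhom v hv, fun h => ?_, Finset.notMem_empty _, Finset.notMem_empty _,
          Finset.notMem_empty _⟩
        obtain ⟨x, hx, he⟩ := Finset.mem_image.1 h
        by_cases hvQ : v ∈ Q.erase i
        · change P.col κ Φ x = P.col κ ψ v at he
          rw [← hΦQ v hvQ] at he
          have hxv := hΦ3 (hBG x hx) (Finset.mem_erase.2 ⟨Finset.ne_of_mem_erase hvQ,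
            (Finset.mem_inter.1 (Finset.mem_of_mem_erase hvQ)).2⟩) he
          rw [hxv] at hx
          exact (Finset.mem_sdiff.1 hx).2 (Finset.mem_of_mem_erase hv)
        · refine (hΦ2 x (hBG x hx)).2.1 ?_
          exact Finset.mem_image.2 ⟨v, Finset.mem_sdiff.2 ⟨hv, hvQ⟩, he.symm⟩)
    -- the union
    set Θ : V → Cube := fun x => if x ∈ B then Φ x else Ψ x with hΘ
    have hΘB : ∀ x ∈ B, Θ x = Φ x := fun x hx => by rw [hΘ]; exact if_pos hx
    have hΘn : ∀ x, x ∉ B → Θ x = Ψ x := fun x hx => by rw [hΘ]; exact if_neg hx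
    have hΘG : ∀ x ∈ G, Θ x = ψ x := by
      intro x hx
      by_cases hxB : x ∈ B
      · rw [hΘB x hxB, hΦ1 x (Finset.mem_inter.2 ⟨hx, hxB⟩)]
      · rw [hΘn x hxB, h1 x hx]
    have hGt : P.IsSubtree G r := hT.tree.half_isSubtree (by omega)
    have hparG : ∀ x ∈ G.erase r, P.par x ∈ G := fun x hx =>
      hGt.par_mem x (Finset.mem_of_mem_erase hx) (Finset.ne_of_mem_erase hx)
    have hΘBp : ∀ x ∈ B.erase i, Θ x = Φ x ∧ Θ (P.par x) = Φ (P.par x) := fun x hx =>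
      ⟨hΘB x (Finset.mem_of_mem_erase hx),
        hΘB _ (hBt.par_mem x (Finset.mem_of_mem_erase hx) (Finset.ne_of_mem_erase hx))⟩
    have hΘGp : ∀ x ∈ G.erase r, Θ x = ψ x ∧ Θ (P.par x) = ψ (P.par x) := fun x hx =>
      ⟨hΘG x (Finset.mem_of_mem_erase hx), hΘG _ (hparG x hx)⟩
    set X := G.erase r ∪ J'.biUnion (P.below S) with hX
    have hΘJ : ∀ b ∈ J', ∀ x ∈ P.below S b, Θ x = Ψ x ∧ Θ (P.par x) = Ψ (P.par x) := by
      intro b hb x hx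
      have hxB := hdisj b hb x hx
      have hbc := hJc b (hJ'J b hb)
      refine ⟨hΘn x hxB, hΘn _ fun h => hxB (mem_below.2 ⟨below_subset hx, ?_⟩)⟩
      exact (mem_below.1 h).2.trans
        (hT.tree.desc_par' (below_subset hx) (hT.below_ne_root hbc hx))
    have hΘX : ∀ x ∈ X, Θ x = Ψ x ∧ Θ (P.par x) = Ψ (P.par x) := by
      intro x hx
      rcases Finset.mem_union.1 hx with hx | hx
      · rw [(hΘGp x hx).1, (hΘGp x hx).2, h1 x (Finset.mem_of_mem_erase hx), h1 _ (hparG x hx)]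
        exact ⟨rfl, rfl⟩
      · obtain ⟨b, hb, hx⟩ := Finset.mem_biUnion.1 hx
        exact hΘJ b hb x hx
    have hcover : ∀ x ∈ G.erase r ∪ J.biUnion (P.below S), x ∈ X ∨ x ∈ B \ G := by
      intro x hx
      rcases Finset.mem_union.1 hx with hx | hx
      · exact Or.inl (Finset.mem_union_left _ hx)
      · obtain ⟨b, hb, hx⟩ := Finset.mem_biUnion.1 hx
        by_cases hbi : b = i
        · rw [hbi] at hx
          by_cases hxG : x ∈ G
          · exact Or.inl (Finset.mem_union_left _ (Finset.mem_erase.2 ⟨hBr x hx, hxG⟩))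
          · exact Or.inr (Finset.mem_sdiff.2 ⟨hx, hxG⟩)
        · exact Or.inl (Finset.mem_union_right _
            (Finset.mem_biUnion.2 ⟨b, Finset.mem_erase.2 ⟨hbi, hb⟩, hx⟩))
    have hcolX : ∀ x ∈ X, P.col κ Θ x = P.col κ Ψ x := fun x hx =>
      col_congr (hΘX x hx).1 (hΘX x hx).2
    have hcolBG : ∀ x ∈ B \ G, P.col κ Θ x = P.col κ Φ x := fun x hx =>
      col_congr (hΘBp x (hBG x hx)).1 (hΘBp x (hBG x hx)).2
    have hcross : ∀ x ∈ X, ∀ y ∈ B \ G, P.col κ Θ x ≠ P.col κ Θ y := by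
      intro x hx y hy he
      rw [hcolX x hx, hcolBG y hy] at he
      exact (h2 x hx).2.1 (Finset.mem_image.2 ⟨y, hy, he.symm⟩)
    have hcasesB : ∀ x ∈ B, x ∈ Q ∨ x ∈ B.erase i := by
      intro x hx
      by_cases h : x = i
      · exact Or.inl (h ▸ hiQ)
      · exact Or.inr (Finset.mem_erase.2 ⟨h, hx⟩)
    have hneY : ∀ x ∈ B, Θ x ∉ Y := by
      intro x hx
      rcases hcasesB x hx with h | h
      · rw [hΘG x (Finset.mem_inter.1 h).1]
        exact hQY x h
      · rw [(hΘBp x h).1]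
        exact (hΦ2 x h).2.2.2.2
    have hneΔ : ∀ x ∈ B, P.dir Θ x ∉ Δ := by
      intro x hx
      rcases hcasesB x hx with h | h
      · rw [dir_congr (hΘGp x (hQG x h)).1 (hΘGp x (hQG x h)).2]
        exact hQΔ x h
      · rw [dir_congr (hΘBp x h).1 (hΘBp x h).2]
        exact (hΦ2 x h).2.2.1
    have havoid : ∀ b ∈ J', P.dir ψ (w i) = P.dir ψ (w b) → P.Avoids S r w ψ Θ i b := by
      intro b hb he
      refine ⟨fun x hx v hv h => hneΔ x hx (h ▸ hDΔ b hb he v hv), fun x hx h => ?_⟩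
      refine hneY x hx (h ▸ hyY (Or.inl ?_))
      rintro h'
      rw [h'] at hb
      exact absurd hb (Finset.notMem_empty _)
    have htransfer : ∀ b ∈ J', ∀ c, P.Avoids S r w ψ Ψ b c → P.Avoids S r w ψ Θ b c := by
      intro b hb c h
      refine ⟨fun x hx => ?_, fun x hx => ?_⟩
      · rw [dir_congr (hΘJ b hb x hx).1 (hΘJ b hb x hx).2]
        exact h.dir x hx
      · rw [(hΘJ b hb x hx).1]
        exact h.ne x hx
    refine ⟨Θ, hΘG, ?_, ?_, ?_, ?_, ?_⟩
    · intro x hx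
      rcases hcover x hx with h | h
      · rw [(hΘX x h).1, (hΘX x h).2]
        exact (h2 x h).1
      · rw [(hΘBp x (hBG x h)).1, (hΘBp x (hBG x h)).2]
        exact (hΦ2 x (hBG x h)).1
    · intro x hx y hy he
      rcases hcover x hx with h | h <;> rcases hcover y hy with h' | h'
      · rw [hcolX x h, hcolX y h'] at he
        exact h3 h h' he
      · exact absurd he (hcross x h y h')
      · exact absurd he.symm (hcross y h' x h)
      · rw [hcolBG x h, hcolBG y h'] at he
        exact hΦ3 (hBG x h) (hBG y h') he
    · intro c hc
      by_cases hci : c = i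
      · rw [hci]
        refine ⟨fun x hx y hy he => ?_, fun x hx => ?_⟩
        · rw [hΘB x hx, hΘB y hy] at he
          exact hΦ4 hx hy he
        · rw [hΘB x hx]
          exact hΦ5 x hx
      · have hc' : c ∈ J' := Finset.mem_erase.2 ⟨hci, hc⟩
        refine ⟨fun x hx y hy he => ?_, fun x hx => ?_⟩
        · rw [(hΘJ c hc' x hx).1, (hΘJ c hc' y hy).1] at he
          exact (h4 c hc').1 hx hy he
        · rw [(hΘJ c hc' x hx).1]
          exact (h4 c hc').2 x hx
    · intro c hc b hb hcb he
      by_cases hci : c = i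
      · subst hci
        exact Or.inl (havoid b (Finset.mem_erase.2 ⟨hcb.symm, hb⟩) he)
      by_cases hbi : b = i
      · subst hbi
        exact Or.inr (havoid c (Finset.mem_erase.2 ⟨hci, hc⟩) he.symm)
      have hc' : c ∈ J' := Finset.mem_erase.2 ⟨hci, hc⟩
      have hb' : b ∈ J' := Finset.mem_erase.2 ⟨hbi, hb⟩
      rcases h5 c hc' b hb' hcb he with h | h
      · exact Or.inl (htransfer c hc' b h)
      · exact Or.inr (htransfer b hb' c h)
    · intro c hc he x hx
      by_cases hci : c = i
      · rw [hci] at he hx ⊢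
        intro h
        exact hneY x hx (h ▸ hyY (Or.inr he))
      · have hc' : c ∈ J' := Finset.mem_erase.2 ⟨hci, hc⟩
        rw [(hΘJ c hc' x hx).1]
        exact h6 c hc' he x hx

end IsSpider

end Ranked

/-! ### Legs of a spider do not meet -/

namespace Ranked

variable {V : Type*} {P : Ranked V} {C : Type*} {S : Finset V} {r : V} {k : V → ℕ} {w : V → V}
  {φ : V → Cube}

/-- Two vertices that are far from the root along disjoint sets of directions are mapped to
different points. -/
lemma ne_of_disjoint_dir {u x u' x' : V} (hru : P.Desc r u) (hux : P.Desc u x)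
    (hru' : P.Desc r u') (hux' : P.Desc u' x')
    (hhom : P.Hom hypercube.Adj φ (P.between r x)) (hhom' : P.Hom hypercube.Adj φ (P.between r x'))
    (hinj : Set.InjOn (P.dir φ) (P.between r u)) (hinj' : Set.InjOn (P.dir φ) (P.between r u'))
    (hd : Disjoint (P.dir φ '' P.between r u) (P.dir φ '' P.between r u'))
    (hl : P.lev x - P.lev u < P.lev u - P.lev r)
    (hl' : P.lev x' - P.lev u' ≤ P.lev u' - P.lev r) : φ x ≠ φ x' := by
  intro he
  have hup : ∀ {u x : V}, P.Desc r u → P.Desc u x → P.Hom hypercube.Adj φ (P.between r x) →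
      P.Hom hypercube.Adj φ (P.between r u) ∧ P.Hom hypercube.Adj φ (P.between u x) := by
    intro u x hru hux hhom
    refine ⟨fun y hy => hhom y ⟨hy.1, hy.2.1, hy.2.2.trans hux⟩, fun y hy =>
      hhom y ⟨hru.trans hy.1, ?_, hy.2.2⟩⟩
    rintro rfl
    have h1 := hy.1.lt_of_ne hy.2.1.symm
    have h2 := hru.le
    omega
  obtain ⟨h1, h2⟩ := hup hru hux hhom
  obtain ⟨h1', h2'⟩ := hup hru' hux' hhom'
  have e1 := diff_eq hru h1 hinj
  have e1' := diff_eq hru' h1' hinj'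
  rw [← e1, ← e1'] at hd
  -- Disjoint sets of flipped coordinates add up: the images of `u` and `u'` are as far apart as the
  -- sum of their distances from the root. The paths to `x` and `x'` are too short to bridge this.
  have hsub : {i | φ r i ≠ φ u i} ∪ {i | φ r i ≠ φ u' i} ⊆ {i | φ u i ≠ φ u' i} := by
    rintro i (hi | hi)
    · have : i ∉ {i | φ r i ≠ φ u' i} := Set.disjoint_left.1 hd hi
      have h : φ r i = φ u' i := by
        by_contra hc
        exact this hc
      rw [Set.mem_ofPred_eq, ← h]
      exact Ne.symm hi
    · have : i ∉ {i | φ r i ≠ φ u i} := Set.disjoint_right.1 hd hi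
      have h : φ r i = φ u i := by
        by_contra hc
        exact this hc
      rw [Set.mem_ofPred_eq, ← h]
      exact hi
  have hA := Set.encard_le_encard hsub
  rw [Set.encard_union_eq hd, encard_diff_eq hru h1 hinj, encard_diff_eq hru' h1' hinj'] at hA
  have hB := encard_diff_triangle (φ u) (φ x) (φ u')
  have hC := encard_diff_le hux h2
  have hD := encard_diff_le hux' h2'
  have hflip : {i | φ x i ≠ φ u' i} = {i | φ u' i ≠ φ x' i} := by
    rw [he]
    ext i
    exact ne_comm
  rw [hflip] at hB
  have hE := hA.trans (hB.trans (add_le_add hC hD))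
  have hF : P.lev u - P.lev r + (P.lev u' - P.lev r) ≤
      P.lev x - P.lev u + (P.lev x' - P.lev u') := by exact_mod_cast hE
  omega

namespace IsSpider

variable (hT : P.IsSpider S r k w)
include hT

lemma between_subset_ceil {c u : V} (hc : c ∈ P.children S r)
    (hu : u ∈ P.half S (P.lev r + 1) ∩ P.below S c) :
    P.between r u ⊆ (P.half S (P.lev r + 1) ∩ P.below S c : Finset V) := by
  have hB := hT.tree.below_isSubtree (mem_children.1 hc).1
  rintro x ⟨h1, h2, h3⟩
  rw [Finset.mem_inter] at hu
  have hl := h1.lt_of_ne h2.symm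
  rw [Finset.mem_coe, Finset.mem_inter]
  refine ⟨hT.tree.half_desc_closed hu.1 h3 hl.le, hB.mem_of_desc hu.2 h3 ?_⟩
  rw [(mem_children.1 hc).2.2]
  omega

/-- If one branch avoids the directions of the lower half of another one, then the other one can
meet it only in the neighbor of the root in the direction of the middle edge. -/
lemma ne_of_avoids {ψ Ψ : V → Cube} {i j : V} (hi : i ∈ P.children S r)
    (hj : j ∈ P.children S r)
    (hhom : P.Hom hypercube.Adj Ψ (S.erase r : Finset V)) (hr : Ψ r = ψ r)
    (hdirG : ∀ x ∈ (P.half S (P.lev r + 1)).erase r, P.dir Ψ x = P.dir ψ x)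
    (hinj : Set.InjOn (P.dir ψ) (P.half S (P.lev r + 1) ∩ P.below S j : Finset V))
    (he : P.dir ψ (w i) = P.dir ψ (w j)) (hav : P.Avoids S r w ψ Ψ i j) {x x' : V}
    (hx : x ∈ P.below S i) (hx' : x' ∈ P.below S j) (hwx : P.Desc (w j) x') : Ψ x ≠ Ψ x' := by
  intro hxx
  set f := P.dir ψ (w j) with hf
  set y := step (ψ r) f with hy
  have hwS := below_subset (hT.mid_mem j hj)
  have hrw : P.Desc r (w j) := hT.tree.root_desc hwS
  have hwQ : w j ∈ P.half S (P.lev r + 1) ∩ P.below S j :=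
    Finset.mem_inter.2 ⟨hT.mid_mem_ceil hj, hT.mid_mem j hj⟩
  have hbQ := hT.between_subset_ceil hj hwQ
  have hbS : P.between r (w j) ⊆ (S.erase r : Finset V) :=
    hT.tree.between_subset hT.tree.root_mem hwS
  have hQG : ∀ v ∈ P.between r (w j), v ∈ (P.half S (P.lev r + 1)).erase r := fun v hv =>
    Finset.mem_erase.2 ⟨hv.2.1, (Finset.mem_inter.1 (hbQ hv)).1⟩
  have hinj' : Set.InjOn (P.dir Ψ) (P.between r (w j)) := by
    intro a ha b hb h
    rw [hdirG a (hQG a ha), hdirG b (hQG b hb)] at h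
    exact hinj (hbQ ha) (hbQ hb) h
  have hd := diff_eq hrw (fun v hv => hhom v (hbS hv)) hinj'
  have hcard := encard_diff_eq hrw (fun v hv => hhom v (hbS hv)) hinj'
  have hwb : w j ∈ P.between r (w j) := ⟨hrw, hT.mid_ne_root hj, Desc.refl _⟩
  have hfmem : f ∈ {a | Ψ r a ≠ Ψ (w j) a} := by
    rw [hd]
    exact ⟨w j, hwb, hdirG _ (hQG _ hwb)⟩
  -- Since `y` is the root's image with the middle direction flipped, the image of `w j` differs
  -- from it exactly in the `k j` directions of the lower half of the leg.
  have hset : {a | Ψ (w j) a ≠ y a} = {a | Ψ r a ≠ Ψ (w j) a} \ {f} := by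
    ext a
    rw [Set.mem_sdiff, Set.mem_singleton_iff]
    by_cases ha : a = f
    · have h1 : Ψ r f ≠ Ψ (w j) f := hfmem
      rw [hr] at h1
      rw [ha]
      simp only [Set.mem_ofPred_eq, not_true_eq_false, and_false, iff_false, not_not, hy,
        step_self]
      revert h1
      cases ψ r f <;> cases Ψ (w j) f <;> decide
    · simp only [Set.mem_ofPred_eq, hy, step_of_ne _ ha, ha, not_false_eq_true, and_true, hr]
      exact ne_comm
  have hfin : {a | Ψ (w j) a ≠ y a}.Finite := by
    rw [hset, hd]
    exact ((finite_between hrw).image _).subset Set.sdiff_subset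
  have hcard' : {a | Ψ (w j) a ≠ y a}.encard = (k j : ℕ∞) := by
    have h1 := Set.encard_sdiff_singleton_add_one hfmem
    rw [← hset, hcard, hT.lev_mid j hj] at h1
    have h2 : P.lev r + k j + 1 - P.lev r = k j + 1 := by omega
    rw [h2, Nat.cast_add, Nat.cast_one] at h1
    exact WithTop.add_right_cancel ENat.one_ne_top h1
  -- In these directions the common point agrees with the root, because the leg at `i` never uses
  -- them, and `x'` is at most `k j` steps from `w j`. So all these steps go into flipping them
  -- back, and the common point is `y`, which the leg at `i` avoids.
  have hxy : Ψ x' = y := by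
    refine eq_of_agree hfin ?_ ?_
    · intro a ha
      have ha' : a ∈ {a | Ψ r a ≠ Ψ (w j) a} \ {f} := hset ▸ ha
      obtain ⟨ha1, ha2⟩ := ha'
      rw [Set.mem_singleton_iff] at ha2
      rw [hd] at ha1
      obtain ⟨v, hv, rfl⟩ := ha1
      rw [hdirG v (hQG v hv)] at ha2 ⊢
      have hvQ := Finset.mem_inter.1 (hbQ hv)
      have hvD : v ∈ P.half S (P.lev r) ∩ P.below S j := by
        rcases (hT.mem_ceil_iff hj hvQ.2).1 hvQ.1 with h | h
        · exact Finset.mem_inter.2 ⟨h, hvQ.2⟩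
        · exact absurd (by rw [h]) ha2
      rw [← hxx, hy, step_of_ne _ ha2, ← hr]
      symm
      have hxS := below_subset hx
      have hiB := hT.tree.below_isSubtree (mem_children.1 hi).1
      refine agree_of_not_mem (hT.tree.root_desc hxS)
        (fun b hb => hhom b (hT.tree.between_subset hT.tree.root_mem hxS hb)) ?_
      intro b hb
      refine hav.dir b (hiB.mem_of_desc hx hb.2.2 ?_) v hvD
      rw [(mem_children.1 hi).2.2]
      exact hb.1.lt_of_ne hb.2.1.symm
    · have hb : P.between (w j) x' ⊆ (S.erase r : Finset V) :=
        hT.tree.between_subset hwS (below_subset hx')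
      refine (encard_diff_le hwx fun v hv => hhom v (hb hv)).trans ?_
      rw [hcard', hT.lev_mid j hj]
      have := hT.lev_le j hj x' hx'
      norm_cast
      omega
  refine hav.ne x hx ?_
  rw [hxx, hxy, hy, he]

/-- The extension theorem for spiders with at least two branches. -/
lemma extensionProperty (hch : 2 ≤ (P.children S r).card)
    (hIH : ∀ c ∈ P.children S r, P.ExtensionProperty C (P.below S c) c) :
    P.ExtensionProperty C S r := by
  intro H κ U φ z hH hU hr hhom hcol hdir hadj hz hzd
  set F := P.half S (P.lev r) with hF
  set G := P.half S (P.lev r + 1) with hG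
  have hS := hT.tree
  obtain ⟨ψ, hψ, hleaf, hcond⟩ := hT.exists_midExtension hH hU hr hadj hz hch hhom hcol
  have hrF : r ∈ F := hS.root_mem_half le_rfl
  have hrG : r ∈ G := hS.root_mem_half (by omega)
  have hψr : ψ r = φ r := hψ.eq r hrF
  have hFt : P.IsSubtree F r := hS.half_isSubtree le_rfl
  have hFdir : ∀ v ∈ F.erase r, P.dir ψ v = P.dir φ v := fun v hv =>
    dir_congr (hψ.eq v (Finset.mem_of_mem_erase hv))
      (hψ.eq _ (hFt.par_mem v (Finset.mem_of_mem_erase hv) (Finset.ne_of_mem_erase hv)))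
  have hψdir : Set.InjOn (P.dir ψ) (F.erase r : Finset V) := by
    intro x hx y hy h
    rw [hFdir x hx, hFdir y hy] at h
    exact hdir hx hy h
  have hGeq : G.erase r = F.erase r ∪ (P.children S r).image w := hT.ceil_eq
  have hGcard : (G.erase r).card + ∑ c ∈ (P.children S r).filter (fun c => k c ≠ 0), k c ≤
      S.card - 1 := by
    have h1 := card_union_image_le (F.erase r) (P.children S r) w
    have h2 : S.card - 1 = 2 * (F.erase r).card + (P.children S r).card := hT.card_sub_one
    have h3 : ∑ c ∈ (P.children S r).filter (fun c => k c ≠ 0), k c = (F.erase r).card := by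
      rw [← hS.sum_card_inter_below half_subset, Finset.sum_filter_ne_zero]
      exact Finset.sum_congr rfl fun c hc => (hT.card_floor c hc).symm
    rw [hGeq]
    omega
  obtain ⟨Ψ, h1, h2, h3, h4, h5, h6⟩ := hT.exists_legs (κ := κ) (ψ := ψ) (d := coord s(φ r, z)) hIH
    (by rw [← hG, hGeq]; exact hψ.col) hψdir hψ.dir _ _ rfl subset_rfl hcond H U hH
    (hU.mono hGcard) (by rw [← hG, hGeq]; exact hψ.hom)
  have hcover : G.erase r ∪ ((P.children S r).filter (fun c => k c ≠ 0)).biUnion (P.below S)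
      = S.erase r := by
    ext x
    rw [Finset.mem_union, Finset.mem_erase, Finset.mem_erase, Finset.mem_biUnion]
    constructor
    · rintro (⟨h, hx⟩ | ⟨c, hc, hx⟩)
      · exact ⟨h, half_subset hx⟩
      · exact ⟨hT.below_ne_root (Finset.mem_filter.1 hc).1 hx, below_subset hx⟩
    · rintro ⟨hxr, hx⟩
      obtain ⟨c, hc, hcx⟩ := hS.exists_child hx hxr
      have hxc : x ∈ P.below S c := mem_below.2 ⟨hx, hcx⟩
      by_cases hk : k c = 0
      · left
        rw [hT.below_leaf hc hk, Finset.mem_singleton] at hxc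
        rw [hxc]
        exact ⟨children_ne_root hc, child_mem_half hc⟩
      · exact Or.inr ⟨c, Finset.mem_filter.2 ⟨hc, hk⟩, hxc⟩
  rw [hcover] at h2 h3
  have hHomQ : P.Hom hypercube.Adj Ψ (S.erase r : Finset V) :=
    h2.mono subset_rfl fun _ _ => hH.cube
  have hΨr : Ψ r = ψ r := h1 r hrG
  have hGt : P.IsSubtree G r := hS.half_isSubtree (by omega)
  have hdirG : ∀ x ∈ G.erase r, P.dir Ψ x = P.dir ψ x := fun x hx =>
    dir_congr (h1 x (Finset.mem_of_mem_erase hx))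
      (h1 _ (hGt.par_mem x (Finset.mem_of_mem_erase hx) (Finset.ne_of_mem_erase hx)))
  have hQinj : ∀ c ∈ P.children S r, Set.InjOn (P.dir ψ) (G ∩ P.below S c : Finset V) :=
    fun c hc => hT.injOn_dir_ceil_below hc hψdir hψ.dir
  have hQG : ∀ c ∈ P.children S r, ∀ x ∈ G ∩ P.below S c, x ∈ G.erase r := fun c hc x hx =>
    Finset.mem_erase.2 ⟨hT.below_ne_root hc (Finset.mem_inter.1 hx).2, (Finset.mem_inter.1 hx).1⟩
  have hΨinj : ∀ c ∈ P.children S r, ∀ u ∈ G ∩ P.below S c,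
      Set.InjOn (P.dir Ψ) (P.between r u) := by
    intro c hc u hu a ha b hb h
    have hb' := hT.between_subset_ceil hc hu
    rw [hdirG a (hQG c hc a (hb' ha)), hdirG b (hQG c hc b (hb' hb))] at h
    exact hQinj c hc (hb' ha) (hb' hb) h
  have hbS : ∀ x ∈ S, P.Hom hypercube.Adj Ψ (P.between r x) := fun x hx v hv =>
    hHomQ v (hS.between_subset hS.root_mem hx hv)
  have hne_root : ∀ c ∈ P.children S r, ∀ x ∈ P.below S c, Ψ x ≠ Ψ r := by
    intro c hc x hx
    rw [hΨr]
    by_cases hk : k c = 0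
    · rw [hT.below_leaf hc hk, Finset.mem_singleton] at hx
      have hcS : c ∈ S.erase r := Finset.mem_erase.2 ⟨children_ne_root hc, (mem_children.1 hc).1⟩
      have := hHomQ c hcS
      rw [(mem_children.1 hc).2.1, hΨr] at this
      rw [hx]
      exact this.ne'
    · exact (h4 c (Finset.mem_filter.2 ⟨hc, hk⟩)).2 x hx
  have hinjB : ∀ c ∈ P.children S r, Set.InjOn Ψ (P.below S c : Set V) := by
    intro c hc
    by_cases hk : k c = 0
    · rw [hT.below_leaf hc hk, Finset.coe_singleton]
      exact Set.injOn_singleton _ _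
    · exact (h4 c (Finset.mem_filter.2 ⟨hc, hk⟩)).1
  -- an ancestor in the upper half
  have hmid : ∀ c ∈ P.children S r, ∀ x ∈ P.below S c, ∃ u ∈ G ∩ P.below S c, P.Desc u x ∧
      P.lev x - P.lev u < P.lev u - P.lev r ∧ (u ∈ F ∨ (u = w c ∧ P.Desc (w c) x)) := by
    intro c hc x hx
    have hlx : P.lev r < P.lev x := hS.lt x (below_subset hx) (hT.below_ne_root hc hx)
    have hlw := hT.lev_mid c hc
    by_cases hxF : x ∈ F
    · exact ⟨x, Finset.mem_inter.2 ⟨half_mono (by omega) hxF, hx⟩, Desc.refl x, by omega,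
        Or.inl hxF⟩
    · have h : ¬ P.lev x ≤ P.lev r + k c := fun h' => hxF ((hT.mem_floor c hc x hx).2 h')
      have hl := hT.lev_le c hc x hx
      have hd := hT.desc c hc _ (hT.mid_mem c hc) x hx (by omega)
      exact ⟨w c, Finset.mem_inter.2 ⟨hT.mid_mem_ceil hc, hT.mid_mem c hc⟩, hd, by omega,
        Or.inr ⟨rfl, hd⟩⟩
  have hdisj : ∀ i ∈ P.children S r, ∀ j ∈ P.children S r, i ≠ j →
      Disjoint (P.below S i) (P.below S j) := fun i hi j hj hij =>
    disjoint_below ((mem_children.1 hi).2.2.trans (mem_children.1 hj).2.2.symm) hij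
  have hclash : ∀ i ∈ P.children S r, ∀ j ∈ P.children S r, i ≠ j → ∀ x ∈ P.below S i,
      ∀ x' ∈ P.below S j, Ψ x ≠ Ψ x' := by
    intro i hi j hj hij x hx x' hx'
    obtain ⟨u, hu, hux, hlu, hcu⟩ := hmid i hi x hx
    obtain ⟨u', hu', hux', hlu', hcu'⟩ := hmid j hj x' hx'
    have hbu := hT.between_subset_ceil hi hu
    have hbu' := hT.between_subset_ceil hj hu'
    have hru := hS.root_desc (half_subset (Finset.mem_inter.1 hu).1)
    have hru' := hS.root_desc (half_subset (Finset.mem_inter.1 hu').1)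
    by_cases hdis : Disjoint (P.dir Ψ '' P.between r u) (P.dir Ψ '' P.between r u')
    · exact ne_of_disjoint_dir hru hux hru' hux' (hbS x (below_subset hx))
        (hbS x' (below_subset hx')) (hΨinj i hi u hu) (hΨinj j hj u' hu') hdis hlu hlu'.le
    obtain ⟨_, ⟨a, ha, rfl⟩, ⟨b, hb, hab⟩⟩ := Set.not_disjoint_iff.1 hdis
    rw [hdirG a (hQG i hi a (hbu ha)), hdirG b (hQG j hj b (hbu' hb))] at hab
    have haQ := Finset.mem_inter.1 (hbu ha)
    have hbQ := Finset.mem_inter.1 (hbu' hb)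
    have haw : a ∈ F ∨ a = w i := (hT.mem_ceil_iff hi haQ.2).1 haQ.1
    have hbw : b ∈ F ∨ b = w j := (hT.mem_ceil_iff hj hbQ.2).1 hbQ.1
    have hD : ∀ {c v : V}, c ∈ P.children S r → v ∈ P.below S c → v ∈ F → v ∈ F.erase r :=
      fun hc hv h => Finset.mem_erase.2 ⟨hT.below_ne_root hc hv, h⟩
    -- Directions in the floor half are distinct and differ from all middle ones, so a common
    -- direction belongs to both middle edges.
    have hab' : a = w i ∧ b = w j := by
      rcases haw with h | h <;> rcases hbw with h' | h'
      · have := hψdir (hD hj hbQ.2 h') (hD hi haQ.2 h) hab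
        exact absurd (this ▸ hbQ.2) (Finset.disjoint_left.1 (hdisj i hi j hj hij) haQ.2)
      · rw [h'] at hab
        exact absurd hab (hψ.dir j hj a (hD hi haQ.2 h))
      · rw [h] at hab
        exact absurd hab.symm (hψ.dir i hi b (hD hj hbQ.2 h'))
      · exact ⟨h, h'⟩
    rw [hab'.1, hab'.2] at hab
    -- A leaf at the root shares its direction with no other middle edge. So both legs are longer,
    -- and one of them avoids the other.
    have hki : k i ≠ 0 := fun h => (hleaf i hi h).2 j hj hij.symm hab
    have hkj : k j ≠ 0 := fun h => (hleaf j hj h).2 i hi hij hab.symm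
    have hdesc : ∀ {c u x : V}, c ∈ P.children S r → P.Desc u x → w c ∈ P.between r u →
        P.Desc (w c) x := fun hc hux hw => hw.2.2.trans hux
    rcases h5 i (Finset.mem_filter.2 ⟨hi, hki⟩) j (Finset.mem_filter.2 ⟨hj, hkj⟩) hij hab.symm
      with h | h
    · exact hT.ne_of_avoids hi hj hHomQ hΨr hdirG (hQinj j hj) hab.symm h hx hx'
        (hdesc hj hux' (hab'.2 ▸ hb))
    · exact (hT.ne_of_avoids hj hi hHomQ hΨr hdirG (hQinj i hi) hab h hx' hx
        (hdesc hi hux (hab'.1 ▸ ha))).symm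
  have hbranch : ∀ x ∈ S, x = r ∨ ∃ c ∈ P.children S r, x ∈ P.below S c := by
    intro x hx
    by_cases h : x = r
    · exact Or.inl h
    · obtain ⟨c, hc, hcx⟩ := hS.exists_child hx h
      exact Or.inr ⟨c, hc, mem_below.2 ⟨hx, hcx⟩⟩
  refine ⟨Ψ, ?_, h2, h3, ?_, ?_, ?_⟩
  · intro v hv
    rw [h1 v (half_mono (by omega) hv), hψ.eq v hv]
  · intro x hx y hy he
    rcases hbranch x hx with h | ⟨i, hi, h⟩ <;> rcases hbranch y hy with h' | ⟨j, hj, h'⟩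
    · rw [h, h']
    · rw [h] at he
      exact absurd he.symm (hne_root j hj y h')
    · rw [h'] at he
      exact absurd he (hne_root i hi x h)
    · by_cases hij : i = j
      · subst hij
        exact hinjB i hi h h' he
      · exact absurd he (hclash i hi j hj hij x h y h')
  · intro x hx
    rcases hbranch x hx with h | ⟨i, hi, h⟩
    · rw [h, hΨr, hψr]
      exact hadj.ne
    -- If the middle edge has the direction of `z`, then the neighbor of the root that the leg
    -- avoids is `z` itself.
    by_cases hfi : P.dir ψ (w i) = coord s(φ r, z)
    · have hki : k i ≠ 0 := fun h => (hleaf i hi h).1 hfi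
      have := h6 i (Finset.mem_filter.2 ⟨hi, hki⟩) hfi x h
      rw [hfi, hψr, ← eq_step hadj] at this
      exact this
    · obtain ⟨u, hu, hux, hlu, -⟩ := hmid i hi x h
      have hbu := hT.between_subset_ceil hi hu
      refine ne_of_dir_ne (hS.root_desc (half_subset (Finset.mem_inter.1 hu).1)) hux (hbS x hx)
        (hΨinj i hi u hu) (by rw [hΨr, hψr]; exact hadj) ?_ hlu.le
      intro v hv
      have hvQ := hbu hv
      rw [hdirG v (hQG i hi v hvQ), hΨr, hψr]
      rw [Finset.mem_coe, Finset.mem_inter] at hvQ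
      rcases (hT.mem_ceil_iff hi hvQ.2).1 hvQ.1 with h' | h'
      · have hvD : v ∈ F.erase r := Finset.mem_erase.2 ⟨hT.below_ne_root hi hvQ.2, h'⟩
        rw [hFdir v hvD]
        exact hzd v hvD
      · rw [h']
        exact hfi
  · intro v hv
    rcases hbranch v (half_subset hv) with h | ⟨i, hi, h⟩
    · rw [h, between_self]
      exact Set.injOn_empty _
    · exact hΨinj i hi v (Finset.mem_inter.2 ⟨hv, h⟩)

end IsSpider

end Ranked

/-! ### The induction -/

namespace Ranked

variable {V : Type*} {P : Ranked V} {C : Type*} {S : Finset V} {r : V}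

lemma extensionProperty_of_no_children (hS : P.IsSubtree S r) (h0 : P.children S r = ∅) :
    P.ExtensionProperty C S r := by
  intro H κ U φ z hH hU hr hhom hcol hdir hadj hz hzd
  have hSr : ∀ x ∈ S, x = r := by
    intro x hx
    by_contra hne
    obtain ⟨c, hc, -⟩ := hS.exists_child hx hne
    rw [h0] at hc
    exact Finset.notMem_empty c hc
  have he : ∀ x, x ∉ S.erase r := fun x hx =>
    (Finset.mem_erase.1 hx).1 (hSr x (Finset.mem_erase.1 hx).2)
  refine ⟨φ, fun _ _ => rfl, fun x hx => absurd hx (he x), fun x hx => absurd hx (he x), ?_, ?_, ?_⟩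
  · intro x hx y hy _
    rw [hSr x hx, hSr y hy]
  · intro x hx
    rw [hSr x hx]
    exact hadj.ne
  · intro x hx
    rw [hSr x (half_subset hx), between_self]
    exact Set.injOn_empty _

/-- The equality case of the estimate for the upper half of the branch at a child. -/
lemma card_below_grandchild (hS : P.IsSubtree S r) {c d : V} (hc : c ∈ P.children S r)
    (h : (P.below S c).card < 2 * (P.half S (P.lev c) ∩ P.below S c).card)
    (hd : d ∈ P.children (P.below S c) c) :
    (P.below S d).card = 2 * (P.half S (P.lev c) ∩ P.below S d).card := by
  have hlc := (mem_children.1 hc).2.2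
  obtain ⟨h1, h2⟩ := hS.card_below_child (t := P.lev c) (mem_children.1 hc).1
    (by rw [hlc]; exact child_mem_half hc)
  have hle : ∀ e ∈ P.children (P.below S c) c,
      2 * (P.half S (P.lev c) ∩ P.below S e).card ≤ (P.below S e).card := fun e he =>
    hS.half_below_card (mem_children.1 he).2.2
  have hsum := Finset.sum_le_sum hle
  rw [← Finset.mul_sum] at hsum
  -- The vertex `c` adds 1 to one side and 2 to the other, so the strict inequality still forces
  -- equality in the sum, hence in each term.
  refine ((Finset.sum_eq_sum_iff_of_le hle).1 ?_ d hd).symm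
  rw [← Finset.mul_sum]
  omega

/-- By the equality case all branches at grandchildren are even, and `c` adds one. -/
lemma odd_card_below_child (hS : P.IsSubtree S r) {c : V} (hc : c ∈ P.children S r)
    (h : (P.below S c).card < 2 * (P.half S (P.lev c) ∩ P.below S c).card) :
    Odd (P.below S c).card := by
  have hlc := (mem_children.1 hc).2.2
  obtain ⟨h1, h2⟩ := hS.card_below_child (t := P.lev c) (mem_children.1 hc).1
    (by rw [hlc]; exact child_mem_half hc)
  rw [h1, Finset.sum_congr rfl fun d hd => card_below_grandchild hS hc h hd, ← Finset.mul_sum]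
  exact ⟨_, rfl⟩

/-- Apart from `c` there is at most one branch, and equality in the reflection makes it a path. -/
lemma injOn_lev_below_child (hS : P.IsSubtree S r) {c : V} (hc : c ∈ P.children S r)
    (h : (P.below S c).card < 2 * (P.half S (P.lev c) ∩ P.below S c).card)
    (h1 : (P.children (P.below S c) c).card ≤ 1) :
    Set.InjOn P.lev (P.below S c : Set V) := by
  have hB := hS.below_isSubtree (mem_children.1 hc).1
  intro x hx y hy hxy
  rw [Finset.mem_coe] at hx hy
  by_cases hxc : x = c
  · have := hB.eq_root hy (by rw [← hxy, hxc])
    rw [hxc, this]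
  by_cases hyc : y = c
  · have := hB.eq_root hx (by rw [hxy, hyc])
    rw [hyc, this]
  obtain ⟨d, hd, hdx⟩ := hB.exists_child hx hxc
  obtain ⟨e, he, hey⟩ := hB.exists_child hy hyc
  obtain rfl := Finset.card_le_one.1 h1 d hd e he
  exact hS.injOn_lev_below (mem_children.1 hd).2.2 (card_below_grandchild hS hc h hd).le
    (mem_below.2 ⟨below_subset hx, hdx⟩) (mem_below.2 ⟨below_subset hy, hey⟩) hxy

lemma card_below_lt (hS : P.IsSubtree S r) {c : V} (hc : c ∈ S) (hcr : c ≠ r) :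
    (P.below S c).card < S.card := by
  refine Finset.card_lt_card ⟨below_subset, fun h => ?_⟩
  have := (mem_below.1 (h hS.root_mem)).2.le
  have := hS.lt c hc hcr
  omega

lemma card_sdiff_below_lt {c : V} (hc : c ∈ S) : (S \ P.below S c).card < S.card :=
  Finset.card_lt_card ⟨Finset.sdiff_subset, fun h =>
    (Finset.mem_sdiff.1 (h hc)).2 (mem_below.2 ⟨hc, Desc.refl c⟩)⟩

/-- The proper ancestors of a child lie in every half of the remaining tree. -/
lemma mem_half_of_desc_child (hS : P.IsSubtree S r) {c : V} (hc : c ∈ P.children S r) :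
    ∀ x ∈ S \ P.below S c, P.Desc x c → x ∈ P.half (S \ P.below S c) (P.lev r) := by
  intro x hx hxc
  have hcS := (mem_children.1 hc).1
  have hA := hS.sdiff_isSubtree hcS (children_ne_root hc)
  have hne : x ≠ c := by
    rintro rfl
    exact (Finset.mem_sdiff.1 hx).2 (mem_below.2 ⟨hcS, Desc.refl x⟩)
  have h1 := hxc.lt_of_ne hne
  have h2 := (mem_children.1 hc).2.2
  rw [hA.eq_root hx (by omega)]
  exact hA.root_mem_half le_rfl

/-- Relative to the root, `c` has level one, and the other grandchild `e` of level two survives the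
removal of `d`. This is just enough to keep `c` in the floor half. -/
lemma mem_half_of_desc_grandchild (hS : P.IsSubtree S r) {c d e : V} (hc : c ∈ P.children S r)
    (hd : d ∈ P.children (P.below S c) c) (he : e ∈ P.children (P.below S c) c) (hde : d ≠ e) :
    ∀ x ∈ S \ P.below S d, P.Desc x d → x ∈ P.half (S \ P.below S d) (P.lev r) := by
  intro x hx hxd
  obtain ⟨hdB, hdc, hld⟩ := mem_children.1 hd
  obtain ⟨heB, hec, hle⟩ := mem_children.1 he
  have hlc := (mem_children.1 hc).2.2
  have hdS := below_subset hdB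
  have hdr : d ≠ r := by rintro rfl; omega
  have hA := hS.sdiff_isSubtree hdS hdr
  have hne : x ≠ d := by
    rintro rfl
    exact (Finset.mem_sdiff.1 hx).2 (mem_below.2 ⟨hdS, Desc.refl x⟩)
  have h1 := hxd.lt_of_ne hne
  by_cases hlx : P.lev x ≤ P.lev r
  · rw [hA.eq_root hx hlx]
    exact hA.root_mem_half le_rfl
  · have hxc : x = c := hxd.unique (mem_below.1 hdB).2 (by omega)
    have heA : e ∈ S \ P.below S d := by
      rw [Finset.mem_sdiff, mem_below]
      exact ⟨below_subset heB, fun h => hde (h.2.eq_of_le (by omega))⟩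
    have := le_top heA (hxc ▸ (mem_below.1 heB).2 : P.Desc x e)
    rw [mem_half]
    exact ⟨hx, by omega⟩

/-- The extension theorem. -/
theorem extensionProperty (hS : P.IsSubtree S r) : P.ExtensionProperty C S r := by
  induction hn : S.card using Nat.strong_induction_on generalizing S r with
  | _ n ih =>
  have hsplit : ∀ {c : V}, c ∈ S → c ≠ r →
      (∀ x ∈ S \ P.below S c, P.Desc x c → x ∈ P.half (S \ P.below S c) (P.lev r)) →
      (2 * (P.half S (P.lev c) ∩ P.below S c).card ≤ (P.below S c).card ∨
        (S \ P.below S c).card = 1) → P.ExtensionProperty C S r := fun hc hcr h1 h2 =>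
    extensionProperty_of_split hS hc hcr h1 h2
      (ih _ (hn ▸ card_sdiff_below_lt hc) (hS.sdiff_isSubtree hc hcr) rfl)
      (ih _ (hn ▸ card_below_lt hS hc hcr) (hS.below_isSubtree hc) rfl)
  by_cases h0 : P.children S r = ∅
  · exact extensionProperty_of_no_children hS h0
  by_cases hone : (P.children S r).card = 1
  -- With a single child the remaining tree is the root alone, and no estimate for the branch is
  -- needed.
  · obtain ⟨c, hc⟩ := Finset.card_eq_one.1 hone
    have hcm : c ∈ P.children S r := by rw [hc]; exact Finset.mem_singleton_self c
    refine hsplit (mem_children.1 hcm).1 (children_ne_root hcm) (mem_half_of_desc_child hS hcm)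
      (Or.inr ?_)
    have h1 := hS.sum_card_below
    rw [hc, Finset.sum_singleton] at h1
    rw [Finset.card_sdiff_of_subset below_subset, h1]
    have := Finset.card_pos.2 ⟨r, hS.root_mem⟩
    omega
  have htwo : 2 ≤ (P.children S r).card := by
    have := Finset.card_pos.2 (Finset.nonempty_iff_ne_empty.2 h0)
    omega
  by_cases hex : ∃ c ∈ P.children S r,
      2 * (P.half S (P.lev c) ∩ P.below S c).card ≤ (P.below S c).card
  · obtain ⟨c, hc, h⟩ := hex
    exact hsplit (mem_children.1 hc).1 (children_ne_root hc) (mem_half_of_desc_child hS hc)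
      (Or.inl h)
  push Not at hex
  by_cases hgc : ∃ c ∈ P.children S r, 1 < (P.children (P.below S c) c).card
  · obtain ⟨c, hc, h⟩ := hgc
    obtain ⟨d, hd, e, he, hde⟩ := Finset.one_lt_card.1 h
    have hdS := below_subset (mem_children.1 hd).1
    have hdr : d ≠ r := by
      have := (mem_children.1 hd).2.2
      have := (mem_children.1 hc).2.2
      rintro rfl
      omega
    refine hsplit hdS hdr (mem_half_of_desc_grandchild hS hc hd he hde) (Or.inl ?_)
    -- The branch at `d` has an even number of vertices, so the extra 1 in this estimate can be
    -- dropped.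
    have h1 := hS.card_half_below_le hdS
    have h2 := card_below_grandchild hS hc (hex c hc) hd
    omega
  push Not at hgc
  obtain ⟨k, w, hT⟩ := exists_isSpider hS
    (fun c hc => injOn_lev_below_child hS hc (hex c hc) (hgc c hc))
    (fun c hc => odd_card_below_child hS hc (hex c hc))
  exact hT.extensionProperty htwo fun c hc =>
    ih _ (hn ▸ card_below_lt hS (mem_children.1 hc).1 (children_ne_root hc))
      (hS.below_isSubtree (mem_children.1 hc).1) rfl

end Ranked

/-! ### Rooted trees as sets with parents and levels -/

namespace Ranked

variable {V : Type*} {P : Ranked V} {T : SimpleGraph V} {r : V}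

variable (P T r) in
/-- `P` consists of the parents and levels of the vertices of the tree `T` with root `r`. -/
structure Ranks : Prop where
  tree : T.IsTree
  lev_eq : ∀ v, P.lev v = T.dist v r
  adj : ∀ v, v ≠ r → T.Adj (P.par v) v

/-- The parent is the second vertex of a shortest walk to the root. The root is its own parent, in
accordance with `0 - 1 = 0`. -/
lemma exists_ranks (hT : T.IsTree) (r : V) : ∃ P : Ranked V, P.Ranks T r := by
  have h : ∀ v, ∃ u, T.dist u r = T.dist v r - 1 ∧ (v ≠ r → T.Adj u v) := by
    intro v
    obtain ⟨p, hp⟩ := hT.connected.exists_walk_length_eq_dist v r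
    cases p with
    | nil => exact ⟨r, by simp, fun h => absurd rfl h⟩
    | cons ha q =>
      rename_i u
      rw [SimpleGraph.Walk.length_cons] at hp
      have h1 := T.dist_le q
      have h2 := hT.connected.dist_triangle (u := v) (v := u) (w := r)
      rw [SimpleGraph.dist_eq_one_iff_adj.2 ha] at h2
      exact ⟨u, by omega, fun _ => ha.symm⟩
  choose f hf using h
  exact ⟨⟨f, fun v => T.dist v r, fun v => (hf v).1⟩, hT, fun _ => rfl, fun v => (hf v).2⟩

namespace Ranks

variable (hP : P.Ranks T r)
include hP

lemma lev_root : P.lev r = 0 := by rw [hP.lev_eq, SimpleGraph.dist_self]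

lemma lev_pos {v : V} (h : v ≠ r) : 0 < P.lev v := by
  rw [hP.lev_eq]
  exact hP.tree.connected.pos_dist_of_ne h

lemma isSubtree [Fintype V] : P.IsSubtree Finset.univ r where
  root_mem := Finset.mem_univ _
  par_mem _ _ _ := Finset.mem_univ _
  lt _ _ h := hP.lev_root ▸ hP.lev_pos h

/-- The path from the root to a vertex. -/
lemma exists_path (v : V) : ∃ p : T.Walk r v, p.length = P.lev v ∧ p.IsPath ∧
    (∀ x, x ∈ p.support ↔ P.Desc x v) ∧
    ∀ e, e ∈ p.edges ↔ ∃ x ∈ P.between r v, e = s(P.par x, x) := by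
  have hr := hP.lev_root
  induction hn : P.lev v using Nat.strong_induction_on generalizing v with
  | _ n ih =>
  by_cases hv : v = r
  · subst hv
    refine ⟨.nil, by simp [← hn, hr], by simp, fun x => ?_, fun e => ?_⟩
    · rw [SimpleGraph.Walk.support_nil, List.mem_singleton]
      exact ⟨fun h => h ▸ Desc.refl x, fun h => h.eq_of_le (by omega)⟩
    · simp [between_self]
  · have hpos := hP.lev_pos hv
    obtain ⟨p, hl, -, hs, he⟩ := ih _ (by rw [P.lev_par]; omega) (P.par v) rfl
    have hrv : P.Desc r v := by
      obtain ⟨u, hu, hl⟩ := exists_anc (P := P) v (Nat.zero_le _)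
      have : u = r := by
        by_contra h
        have := hP.lev_pos h
        omega
      exact this ▸ hu
    have hlen : (p.concat (hP.adj v hv)).length = P.lev v := by
      rw [SimpleGraph.Walk.length_concat, hl, P.lev_par]
      omega
    refine ⟨p.concat (hP.adj v hv), by rw [hlen, hn], ?_, fun x => ?_, fun e => ?_⟩
    · refine SimpleGraph.Walk.isPath_of_length_eq_dist _ ?_
      rw [hlen, hP.lev_eq, SimpleGraph.dist_comm]
    · rw [SimpleGraph.Walk.support_concat, List.mem_append, List.mem_singleton, hs]
      constructor
      · rintro (h | rfl)
        · exact h.trans (desc_par hpos)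
        · exact Desc.refl x
      · intro h
        by_cases hx : x = v
        · exact Or.inr hx
        · exact Or.inl (h.par_of_ne hx)
    · rw [SimpleGraph.Walk.edges_concat, List.concat_eq_append, List.mem_append,
        List.mem_singleton, he, between_of_ne hrv (Ne.symm hv)]
      constructor
      · rintro (⟨x, hx, rfl⟩ | rfl)
        · exact ⟨x, Set.mem_insert_of_mem _ hx, rfl⟩
        · exact ⟨v, Set.mem_insert _ _, rfl⟩
      · rintro ⟨x, rfl | hx, rfl⟩
        · exact Or.inr rfl
        · exact Or.inl ⟨x, hx, rfl⟩

lemma isDescendant_iff {v w : V} : IsDescendant T r v w ↔ P.Desc v w := by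
  obtain ⟨p, -, hp, hs, -⟩ := hP.exists_path w
  rw [← hs]
  constructor
  · rintro ⟨q, hq, h⟩
    rwa [(hP.tree.existsUnique_path r w).unique hp hq]
  · exact fun h => ⟨p, hp, h⟩

lemma mem_edges {v : V} {p : T.Walk r v} (hp : p.IsPath) {e : Sym2 V} (he : e ∈ p.edges) :
    ∃ x ∈ P.between r v, e = s(P.par x, x) := by
  obtain ⟨q, -, hq, -, h⟩ := hP.exists_path v
  rw [(hP.tree.existsUnique_path r v).unique hp hq] at he
  exact (h e).1 he

/-- Both `u` and the parent of `v` are the penultimate vertex of a path from the root to `v`, and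
this path is unique. -/
lemma par_eq_of_adj {u v : V} (h : T.Adj u v) (hl : P.lev v = P.lev u + 1) :
    P.par v = u := by
  have hv : v ≠ r := by
    rintro rfl
    rw [hP.lev_root] at hl
    omega
  have key : ∀ {x : V} (hx : T.Adj x v), P.lev v = P.lev x + 1 →
      ∃ p : T.Walk r v, p.IsPath ∧ p.penultimate = x := by
    intro x hx hlx
    obtain ⟨p, hp, -⟩ := hP.exists_path x
    refine ⟨p.concat hx, SimpleGraph.Walk.isPath_of_length_eq_dist _ ?_, by simp⟩
    rw [SimpleGraph.Walk.length_concat, hp, SimpleGraph.dist_comm, ← hP.lev_eq, hlx]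
  obtain ⟨p, hp, rfl⟩ := key h hl
  obtain ⟨q, hq, hq'⟩ := key (hP.adj v hv) (by
    have := hP.lev_pos hv
    rw [P.lev_par]
    omega)
  rw [← hq', (hP.tree.existsUnique_path r v).unique hq hp]

lemma adj_cases {u v : V} (h : T.Adj u v) : (v ≠ r ∧ P.par v = u) ∨ (u ≠ r ∧ P.par u = v) := by
  have hr := hP.lev_root
  have h1 := hP.tree.dist_eq_dist_add_one_of_adj r h
  rw [T.dist_comm, T.dist_comm (u := r), ← hP.lev_eq, ← hP.lev_eq] at h1
  rcases h1 with h1 | h1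
  · refine Or.inr ⟨?_, hP.par_eq_of_adj h.symm h1⟩
    rintro rfl
    omega
  · refine Or.inl ⟨?_, hP.par_eq_of_adj h h1⟩
    rintro rfl
    omega

lemma exists_eq_of_mem_edgeSet {e : Sym2 V} (he : e ∈ T.edgeSet) :
    ∃ v, v ≠ r ∧ e = s(P.par v, v) := by
  induction e with
  | _ u v =>
    rcases hP.adj_cases (u := u) (v := v) he with ⟨h, hp⟩ | ⟨h, hp⟩
    · exact ⟨v, h, by rw [hp]⟩
    · exact ⟨u, h, by rw [hp]; exact Sym2.eq_swap⟩

lemma eq_of_edge_eq {v w : V} (hv : v ≠ r) (h : s(P.par v, v) = s(P.par w, w)) : v = w := by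
  rcases Sym2.eq_iff.1 h with ⟨-, h⟩ | ⟨h1, h2⟩
  · exact h
  · have := hP.lev_pos hv
    have e1 := P.lev_par v
    have e2 := P.lev_par w
    rw [h1] at e1
    rw [← h2] at e2
    omega

lemma level_eq (v : V) : level T r v = P.lev v := (hP.lev_eq v).symm

lemma levelMax_eq [Fintype V] (v : V) : levelMax T r v = P.top Finset.univ v := by
  refine IsGreatest.csSup_eq ⟨?_, ?_⟩
  · obtain ⟨w, -, h, hl⟩ := exists_top (P := P) (Finset.mem_univ v)
    exact ⟨w, hP.isDescendant_iff.2 h, (hP.level_eq w).trans hl⟩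
  · rintro n ⟨w, h, rfl⟩
    rw [hP.level_eq]
    exact le_top (Finset.mem_univ w) (hP.isDescendant_iff.1 h)

lemma mem_floorHalf [Fintype V] {v : V} :
    v ∈ floorHalf T r ↔ v ∈ P.half Finset.univ (P.lev r) := by
  rw [floorHalf, Set.mem_ofPred_eq, hP.level_eq, hP.levelMax_eq, mem_half, hP.lev_root,
    Nat.le_div_iff_mul_le two_pos, mul_comm]
  simp

lemma mem_ceilHalf [Fintype V] {v : V} :
    v ∈ ceilHalf T r ↔ v ∈ P.half Finset.univ (P.lev r + 1) := by
  rw [ceilHalf, Set.mem_ofPred_eq, hP.level_eq, hP.levelMax_eq, mem_half, hP.lev_root,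
    Nat.le_div_iff_mul_le two_pos, mul_comm]
  simp

end Ranks

end Ranked

/-! ### Colorings of the line graph and the main theorem -/

section Color

variable {C : Type*} {G : hypercube.Subgraph} (c : G.coe.lineGraph.Coloring C)

/-- The color of the edge between two points of the cube. -/
noncomputable def edgeColor (x y : Cube) : Option C :=
  if h : G.Adj x y then some (c ⟨s(⟨x, h.fst_mem⟩, ⟨y, h.snd_mem⟩), h⟩) else none

lemma edgeColor_hom {W : Type*} {F : SimpleGraph W} (ψ : F →g G.coe) {a b : W} (h : F.Adj a b) :
    edgeColor c (ψ a) (ψ b) = some (c (ψ.mapEdgeSet ⟨s(a, b), h⟩)) :=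
  dif_pos (ψ.map_adj h)

lemma isColored_edgeColor : IsColored G.Adj (edgeColor c) where
  symm h := h.symm
  cube h := h.adj_sub
  col_symm x y := by
    by_cases h : G.Adj x y
    · rw [edgeColor, edgeColor, dif_pos h, dif_pos h.symm]
      congr 3
      exact Sym2.eq_swap
    · rw [edgeColor, edgeColor, dif_neg h, dif_neg fun h' => h h'.symm]
  proper {x y y'} h h' he := by
    rw [edgeColor, edgeColor, dif_pos h, dif_pos h', Option.some_inj] at he
    by_contra hne
    refine c.valid (SimpleGraph.lineGraph_adj_iff_exists.2 ⟨?_, ⟨x, h.fst_mem⟩, ?_, ?_⟩) he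
    · intro heq
      exact hne (congrArg Subtype.val (Sym2.congr_right.1 (congrArg Subtype.val heq)))
    · exact Sym2.mem_mk_left _ _
    · exact Sym2.mem_mk_left _ _

end Color

end RainbowTree

open RainbowTree in
theorem theorem3p2 {V C : Type*} [Finite V] (T : SimpleGraph V) (hT : T.IsTree) (r : V)
    (G : hypercube.Subgraph) (c : G.coe.lineGraph.Coloring C)
    (hdeg : T.edgeSet.encard ≤ minDeg G)
    (φ : T.induce (floorHalf T r) →g G.coe) (hφ : DoublyDistinct c φ)
    (z : Cube)
    (hz : (hypercube.deleteEdges G.edgeSet).Adj (φ ⟨r, root_mem_floorHalf T r⟩) z)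
    (hcoord : ∀ e ∈ (T.induce (floorHalf T r)).edgeSet,
      imageCoord φ e ≠ coord s((φ ⟨r, root_mem_floorHalf T r⟩ : Cube), z)) :
    ∃ Φ : T →g G.coe,
      (∀ v : floorHalf T r, Φ v = φ v) ∧
      Rainbow c Φ ∧
      Function.Injective Φ ∧
      (∀ v, (Φ v : Cube) ≠ z) ∧
      PathDistinct (⟨r, root_mem_ceilHalf T r⟩ : ceilHalf T r) (restrict Φ (ceilHalf T r)) := by
  classical
  have : Fintype V := Fintype.ofFinite V
  obtain ⟨P, hP⟩ := Ranked.exists_ranks hT r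
  have hS := hP.isSubtree
  -- The value outside the floor half is arbitrary: the extension property refers to the given map
  -- only on the floor half, which contains the parents of its vertices.
  set ψ : V → Cube := fun v => if h : v ∈ floorHalf T r then φ ⟨v, h⟩ else fun _ => false with hψ
  have hψ' : ∀ v : floorHalf T r, ψ v = φ v := fun v => dif_pos v.2
  have hF : ∀ v ∈ (P.half Finset.univ (P.lev r)).erase r, v ≠ r ∧ v ∈ floorHalf T r ∧
      P.par v ∈ floorHalf T r := fun v hv => by
    obtain ⟨h1, h2⟩ := Finset.mem_erase.1 hv
    rw [hP.mem_floorHalf, hP.mem_floorHalf]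
    exact ⟨h1, h2, (hS.half_isSubtree le_rfl).par_mem v h2 h1⟩
  have hedge : ∀ v, v ≠ r → ∀ (hv : v ∈ floorHalf T r) (hp : P.par v ∈ floorHalf T r),
      (T.induce (floorHalf T r)).Adj ⟨P.par v, hp⟩ ⟨v, hv⟩ := fun v h _ _ => hP.adj v h
  have hedge_inj : ∀ v w (hv : v ∈ floorHalf T r) (hp : P.par v ∈ floorHalf T r)
      (hw : w ∈ floorHalf T r) (hq : P.par w ∈ floorHalf T r), v ≠ r →
      s((⟨P.par v, hp⟩ : floorHalf T r), ⟨v, hv⟩) = s(⟨P.par w, hq⟩, ⟨w, hw⟩) → v = w := by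
    intro v w hv hp hw hq h he
    exact hP.eq_of_edge_eq h (congrArg (Sym2.map Subtype.val) he)
  have hdir : ∀ v (hv : v ∈ floorHalf T r) (hp : P.par v ∈ floorHalf T r),
      P.dir ψ v = imageCoord φ s(⟨P.par v, hp⟩, ⟨v, hv⟩) := by
    intro v hv hp
    rw [Ranked.dir, hψ' ⟨v, hv⟩, hψ' ⟨P.par v, hp⟩]
    rfl
  rw [SimpleGraph.deleteEdges_adj, SimpleGraph.Subgraph.mem_edgeSet,
    ← hψ' ⟨r, root_mem_floorHalf T r⟩] at hz
  rw [← hψ' ⟨r, root_mem_floorHalf T r⟩] at hcoord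
  have hrU : ψ r ∈ G.verts := hψ' ⟨r, root_mem_floorHalf T r⟩ ▸ (φ _).2
  have hU : HasDeg G.verts G.Adj ((Finset.univ : Finset V).card - 1) := by
    refine ⟨fun h => h.snd_mem, fun {x} hx => ?_⟩
    have h1 : T.edgeSet.encard = (((Finset.univ : Finset V).card - 1 : ℕ) : ℕ∞) := by
      rw [← SimpleGraph.coe_edgeFinset, Set.encard_coe_eq_coe_finsetCard, Finset.card_univ,
        ← hT.card_edgeFinset, Nat.add_sub_cancel]
    rw [← h1]
    exact hdeg.trans (iInf_le (fun v : G.verts => (G.neighborSet v).encard) ⟨x, hx⟩)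
  -- Pairs that are not edges of `G` carry the additional color `none`, hence the color type `Option
  -- C`.
  obtain ⟨Ψ, h1, h2, h3, h4, h5, h6⟩ := Ranked.extensionProperty (P := P) (C := Option C) hS
    G.Adj (edgeColor c) G.verts ψ z (isColored_edgeColor c) hU hrU
    (fun v hv => by
      obtain ⟨h, hv, hp⟩ := hF v hv
      rw [hψ' ⟨v, hv⟩, hψ' ⟨P.par v, hp⟩]
      exact φ.map_adj (hedge v h hv hp))
    (fun v hv w hw he => by
      obtain ⟨h, hv, hp⟩ := hF v hv
      obtain ⟨h', hw, hq⟩ := hF w hw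
      rw [Ranked.col, Ranked.col, hψ' ⟨v, hv⟩, hψ' ⟨P.par v, hp⟩, hψ' ⟨w, hw⟩,
        hψ' ⟨P.par w, hq⟩, edgeColor_hom c φ (hedge v h hv hp),
        edgeColor_hom c φ (hedge w h' hw hq), Option.some_inj] at he
      exact hedge_inj v w hv hp hw hq h (Subtype.mk.inj (hφ.1 he)))
    (fun v hv w hw he => by
      obtain ⟨h, hv, hp⟩ := hF v hv
      obtain ⟨h', hw, hq⟩ := hF w hw
      rw [hdir v hv hp, hdir w hw hq] at he
      exact hedge_inj v w hv hp hw hq h (hφ.2 (hedge v h hv hp) (hedge w h' hw hq) he))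
    hz.1 hz.2
    (fun v hv => by
      obtain ⟨h, hv, hp⟩ := hF v hv
      rw [hdir v hv hp]
      exact hcoord _ (hedge v h hv hp))
  have hadj : ∀ v, v ≠ r → G.Adj (Ψ (P.par v)) (Ψ v) := fun v hv =>
    h2 v (Finset.mem_erase.2 ⟨hv, Finset.mem_univ v⟩)
  have hmem : ∀ v, Ψ v ∈ G.verts := by
    intro v
    by_cases hv : v = r
    · rw [hv, h1 r (hS.root_mem_half le_rfl)]
      exact hrU
    · exact (hadj v hv).snd_mem
  let Φ : T →g G.coe :=
    { toFun := fun v => ⟨Ψ v, hmem v⟩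
      map_rel' := by
        intro u v h
        rcases hP.adj_cases h with ⟨hv, rfl⟩ | ⟨hu, rfl⟩
        · exact hadj v hv
        · exact (hadj u hu).symm }
  refine ⟨Φ, ?_, ?_, ?_, ?_, ?_⟩
  · intro v
    exact Subtype.ext ((h1 v (hP.mem_floorHalf.1 v.2)).trans (hψ' v))
  · rintro ⟨e, he⟩ ⟨f, hf⟩ hef
    obtain ⟨v, hv, rfl⟩ := hP.exists_eq_of_mem_edgeSet he
    obtain ⟨w, hw, rfl⟩ := hP.exists_eq_of_mem_edgeSet hf
    have : v = w := by
      refine h3 (Finset.mem_erase.2 ⟨hv, Finset.mem_univ v⟩)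
        (Finset.mem_erase.2 ⟨hw, Finset.mem_univ w⟩) ?_
      exact (edgeColor_hom c Φ he).trans ((congrArg some hef).trans (edgeColor_hom c Φ hf).symm)
    subst this
    rfl
  · intro v w h
    exact h4 (Finset.mem_univ v) (Finset.mem_univ w) (congrArg Subtype.val h)
  · exact fun v => h5 v (Finset.mem_univ v)
  · intro v _ p hp e he f hf hef
    -- Inside `T` the path becomes the unique path from the root, so its edges join the vertices
    -- between `r` and `v` to their parents.
    have hedges : ∀ e ∈ p.edges, ∃ x ∈ P.between r v, e.map Subtype.val = s(P.par x, x) := by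
      intro e he
      refine hP.mem_edges (p := p.map (SimpleGraph.Embedding.induce (ceilHalf T r)).toHom)
        (hp.map Subtype.val_injective) ?_
      exact (SimpleGraph.Walk.edges_map _ p).symm ▸ List.mem_map_of_mem he
    have himg : ∀ e x, e.map Subtype.val = s(P.par x, x) →
        imageCoord (restrict Φ (ceilHalf T r)) e = P.dir Ψ x := by
      intro e x h
      have : e.map (fun w => ((restrict Φ (ceilHalf T r)) w : Cube)) =
          (e.map Subtype.val).map Ψ := by
        rw [Sym2.map_map]
        rfl
      rw [imageCoord, this, h]
      rfl
    obtain ⟨x, hx, hex⟩ := hedges e he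
    obtain ⟨y, hy, hfy⟩ := hedges f hf
    rw [himg e x hex, himg f y hfy] at hef
    have := h6 v (hP.mem_ceilHalf.1 v.2) hx hy hef
    rw [← this, ← hex] at hfy
    exact (Sym2.map.injective Subtype.val_injective hfy).symm
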